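/- **Setting.** A structured system with $n\ge 1$ states, $m$ inputs and $p$ outputs is a triple of zero patterns $\bar A\in\{0,\star\}^{n\times n}$, $\bar B\in\{0,\star\}^{n\times m}$, $\bar C\in\{0,\star\}^{p\times n}$; a cost matrix is $P\in(\mathbb R\cup\{+\infty\})^{m\times p}$, where $P_{ij}$ is the cost of the feedback edge $(y_j,u_i)$ from output $y_j$ to input $u_i$ ($+\infty$ for a forbidden one). The state digraph $\mathcal D(\bar A)$ has the vertices $x_1,\dots,x_n$ and an edge $x_j\to x_i$ if $\bar A_{ij}=\star$. It is assumed that the directed acyclic graph of the strongly connected components of $\mathcal D(\bar A)$ is a directed path $\mathcal C_1\to\mathcal C_2\to\dots\to\mathcal C_\ell$. **Dynamic programming algorithm (Algorithm 2).** Find $\mathcal C_1,\dots,\mathcal C_\ell$ and, for $1\le k\le\ell$, $U_k=\{u_i:\bar B_{ri}=\star \text{ for some } x_r\in\mathcal C_k\}$, $Y_k=\{y_j:\bar C_{jr}=\star\text{ for some }x_r\in\mathcal C_k\}$, $\mathcal U_k=\bigcup_{i\le k}U_i$, $\mathcal Y_k=\bigcup_{i\ge k}Y_i$. Put $W([0])=0$,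 $\mathcal S_0=\emptyset$. For $k=1,\dots,\ell$ let $A_k=\{(y_j,u_i):y_j\in\mathcal Y_k,\ u_i\in\mathcal U_k\}$, let $t(i)=\min\{q:u_i\in\mathcal U_q\}$ for $u_i\in\mathcal U_k$, and put $W([k])=\min_{(y_j,u_i)\in A_k}\{P_{ij}+W([t(i)-1])\}$ and $\mathcal S_k=\{(y_w,u_v)\}\cup\mathcal S_{t(v)-1}$, where $(y_w,u_v)\in A_k$ attains the minimum. Output $\bar K^a\in\{0,\star\}^{m\times p}$ with $\bar K^a_{ij}=\star$ iff $(y_j,u_i)\in\mathcal S_\ell$. (If some $A_k$ is empty, the algorithm reports that it cannot be carried out.) **Two-stage algorithm (Algorithm 3).** Run Algorithm 2. Let $\mathcal B$ be the bipartite graph with left vertices $x'_i,u'_i,y'_j$, right vertices $x_i,u_i,y_j$ and the edges $(x'_i,x_j)$ if $\bar A_{ij}=\star$, $(x'_i,u_j)$ if $\bar B_{ij}=\star$, $(y'_j,x_i)$ if $\bar C_{ji}=\star$, $(u'_i,y_j)$ for all $i,j$, $(u'_i,u_i)$ for all $i$, and $(y'_j,y_j)$ for all $j$; the edge $(u'_i,y_j)$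 has cost $P_{ij}$, all others have cost $0$. Find a minimum-cost perfect matching $M^\star$ of $\mathcal B$, let $\bar K^b_{ij}=\star$ iff $(u'_i,y_j)\in M^\star$, and output $\bar K^A$ with $\bar K^A_{ij}=\star$ iff $\bar K^a_{ij}=\star$ or $\bar K^b_{ij}=\star$. (If Algorithm 2 cannot be carried out or there is no perfect matching, this is reported.) **Theorem 5.** For structured systems with $n$ states, $m=O(n)$ inputs and $p=O(n)$ outputs as above, both Algorithm 2 and Algorithm 3 have complexity $O(n^3)$. That is, each of the two is implemented by a single program for a unit-cost random access machine (which adds, subtracts and compares real costs, and whose integer arithmetic consists of $\pm1$ and comparisons) such that for every $c$ there is a $D$ with the property: for all $n\ge1$ and $m,p\le cn$, and for every such system and every cost matrix, the program halts after at most $Dn^3$ steps, with the quantities computed by the algorithm in its memory: for Algorithm 2 the $\mathcal C_k,U_k,Y_k,\mathcal U_k,\mathcal Y_k,W([k]),\mathcal S_k$ and the output $\bar K^a$; for Algorithm 3 in addition $M^\star$, $\bar K^b$ and the output $\bar K^A$. -/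

import Mathlib

namespace FeedbackSelection

/-! ## Structured systems, their digraph and the bipartite graph -/

/-- A structured system with `n` states, `m` inputs and `p` outputs: the zero patterns
(`true` is a free entry `⋆`, `false` a fixed zero) of the state, input and output matrix. -/
structure StructuredSystem (n m p : ℕ) where
  A : Matrix (Fin n) (Fin n) Bool
  B : Matrix (Fin n) (Fin m) Bool
  C : Matrix (Fin p) (Fin n) Bool

/-- `P i j` is the cost of feeding output `j` to input `i`; it is `⊤` if this is forbidden. -/
abbrev CostMatrix (m p : ℕ) := Matrix (Fin m) (Fin p) (WithTop ℝ)

/-- A feedback pattern: `K i j = true` if output `j` is fed to input `i`. -/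
abbrev FeedbackMatrix (m p : ℕ) := Matrix (Fin m) (Fin p) Bool

namespace StructuredSystem

variable {n m p : ℕ}

/-- The edges of the state digraph: `x → y` if `A y x` is a free entry. -/
def Edge (S : StructuredSystem n m p) (x y : Fin n) : Prop := S.A y x = true

/-- `X` is (the vertex set of) a strongly connected component of the state digraph. -/
def IsSCC (S : StructuredSystem n m p) (X : Set (Fin n)) : Prop :=
  ∃ x, X = {y | Relation.ReflTransGen S.Edge x y ∧ Relation.ReflTransGen S.Edge y x}

/-- `𝒞 1, …, 𝒞 ℓ` lists every strongly connected component of the state digraph exactly once, and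
the DAG of components is the directed path `𝒞 1 → 𝒞 2 → ⋯ → 𝒞 ℓ`. -/
structure IsLineOrder (S : StructuredSystem n m p) (ℓ : ℕ) (𝒞 : ℕ → Set (Fin n)) : Prop where
  scc : ∀ k ∈ Set.Icc 1 ℓ, S.IsSCC (𝒞 k)
  inj : Set.InjOn 𝒞 (Set.Icc 1 ℓ)
  surj : ∀ X, S.IsSCC X → ∃ k ∈ Set.Icc 1 ℓ, 𝒞 k = X
  path : ∀ j ∈ Set.Icc 1 ℓ, ∀ k ∈ Set.Icc 1 ℓ, j ≠ k →
    ((∃ x ∈ 𝒞 j, ∃ y ∈ 𝒞 k, S.Edge x y) ↔ k = j + 1)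

/-- The DAG of the strongly connected components of the state digraph is a line graph. -/
def IsLineGraph (S : StructuredSystem n m p) : Prop := ∃ ℓ 𝒞, S.IsLineOrder ℓ 𝒞

/-- The inputs that actuate some state in `𝒞 k`. -/
def U (S : StructuredSystem n m p) (𝒞 : ℕ → Set (Fin n)) (k : ℕ) : Set (Fin m) :=
  {i | ∃ r ∈ 𝒞 k, S.B r i = true}

/-- The outputs that sense some state in `𝒞 k`. -/
def Y (S : StructuredSystem n m p) (𝒞 : ℕ → Set (Fin n)) (k : ℕ) : Set (Fin p) :=
  {j | ∃ r ∈ 𝒞 k, S.C j r = true}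

/-- `U 1 ∪ ⋯ ∪ U k`. -/
def cumU (S : StructuredSystem n m p) (𝒞 : ℕ → Set (Fin n)) (k : ℕ) : Set (Fin m) :=
  ⋃ i ∈ Set.Icc 1 k, S.U 𝒞 i

/-- `Y k ∪ ⋯ ∪ Y ℓ`. -/
def cumY (S : StructuredSystem n m p) (ℓ : ℕ) (𝒞 : ℕ → Set (Fin n)) (k : ℕ) : Set (Fin p) :=
  ⋃ i ∈ Set.Icc k ℓ, S.Y 𝒞 i

/-- The feedback edges `(y_j, u_i)` that cover `𝒞 k`. -/
def coverEdges (S : StructuredSystem n m p) (ℓ : ℕ) (𝒞 : ℕ → Set (Fin n)) (k : ℕ) :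
    Set (Fin p × Fin m) :=
  {e | e.1 ∈ S.cumY ℓ 𝒞 k ∧ e.2 ∈ S.cumU 𝒞 k}

/-- The least `q` with `u_i ∈ U 1 ∪ ⋯ ∪ U q` (used only if there is such a `q`). -/
noncomputable def first (S : StructuredSystem n m p) (𝒞 : ℕ → Set (Fin n)) (i : Fin m) : ℕ :=
  sInf {q | i ∈ S.cumU 𝒞 q}

end StructuredSystem

/-- The vertices on either side of the bipartite graph: states, inputs, outputs. -/
abbrev Vertex (n m p : ℕ) := Fin n ⊕ Fin m ⊕ Fin p

/-- Adjacency of the left (primed) vertex and the right vertex in the bipartite graph of a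
closed-loop structured system. -/
def BipAdj {n m p : ℕ} (S : StructuredSystem n m p) (K : FeedbackMatrix m p) :
    Vertex n m p → Vertex n m p → Prop
  | .inl i, .inl j => S.A i j = true
  | .inl i, .inr (.inl j) => S.B i j = true
  | .inr (.inl i), .inr (.inr j) => K i j = true
  | .inr (.inl i), .inr (.inl j) => i = j
  | .inr (.inr j), .inl i => S.C j i = true
  | .inr (.inr i), .inr (.inr j) => i = j
  | _, _ => False

/-- The cost of an edge of the bipartite graph: `P i j` on `(u'_i, y_j)`, zero elsewhere. -/
def bipCost {n m p : ℕ} (P : CostMatrix m p) (e : Vertex n m p × Vertex n m p) : WithTop ℝ :=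
  match e with
  | (.inr (.inl i), .inr (.inr j)) => P i j
  | _ => 0

/-- A perfect matching of a bipartite graph both of whose sides are copies of `V`. -/
structure IsPerfectMatching {V : Type} [Fintype V] (G : V → V → Prop) (M : Finset (V × V)) :
    Prop where
  sub : ∀ e ∈ M, G e.1 e.2
  left : ∀ e ∈ M, ∀ f ∈ M, e.1 = f.1 → e = f
  right : ∀ e ∈ M, ∀ f ∈ M, e.2 = f.2 → e = f
  card : M.card = Fintype.card V

/-- A perfect matching of minimum total cost. -/
structure IsMinCostPerfectMatching {V : Type} [Fintype V] (G : V → V → Prop)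
    (c : V × V → WithTop ℝ) (M : Finset (V × V)) : Prop where
  perfect : IsPerfectMatching G M
  min : ∀ M', IsPerfectMatching G M' → ∑ e ∈ M, c e ≤ ∑ e ∈ M', c e

/-! ## The two algorithms -/

/-- A run of the dynamic programming algorithm: the values that its variables take. Ties
between minimizers may be broken in any way. A run needs an edge to minimize over in every
stage, i.e. each of the sets `coverEdges` has to be nonempty. -/
structure DPRun {n m p : ℕ} (S : StructuredSystem n m p) (P : CostMatrix m p) where
  /-- the number of components -/
  ℓ : ℕ
  /-- the components, in the order of the line graph -/
  𝒞 : ℕ → Set (Fin n)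
  line : S.IsLineOrder ℓ 𝒞
  /-- the optimal costs `W([k])` -/
  W : ℕ → WithTop ℝ
  /-- the selected edges `(y_j, u_i)` -/
  sel : ℕ → Set (Fin p × Fin m)
  W_zero : W 0 = 0
  sel_zero : sel 0 = ∅
  W_stage : ∀ k ∈ Set.Icc 1 ℓ, IsLeast
    ((fun e : Fin p × Fin m => P e.2 e.1 + W (S.first 𝒞 e.2 - 1)) '' S.coverEdges ℓ 𝒞 k) (W k)
  sel_stage : ∀ k ∈ Set.Icc 1 ℓ, ∃ e ∈ S.coverEdges ℓ 𝒞 k,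
    W k = P e.2 e.1 + W (S.first 𝒞 e.2 - 1) ∧ sel k = insert e (sel (S.first 𝒞 e.2 - 1))
  /-- the output -/
  Ka : FeedbackMatrix m p
  Ka_eq : ∀ i j, Ka i j = true ↔ (j, i) ∈ sel ℓ

/-- A run of the two-stage algorithm: a run of the dynamic programming algorithm, a minimum
cost perfect matching of the bipartite graph with all feedback edges, and the union of the two
feedback patterns. -/
structure TwoStageRun {n m p : ℕ} (S : StructuredSystem n m p) (P : CostMatrix m p) where
  dp : DPRun S P
  M : Finset (Vertex n m p × Vertex n m p)
  M_min : IsMinCostPerfectMatching (BipAdj S (fun _ _ => true)) (bipCost P) M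
  Kb : FeedbackMatrix m p
  Kb_eq : ∀ i j, Kb i j = true ↔ (.inr (.inl i), .inr (.inr j)) ∈ M
  /-- the output -/
  KA : FeedbackMatrix m p
  KA_eq : ∀ i j, KA i j = true ↔ dp.Ka i j = true ∨ Kb i j = true

/-! ## The machine: a unit-cost RAM

Natural numbers serve as indices and flags; the only arithmetic on them is `± 1`, so that after
`t` steps no index exceeds the input parameters by more than `t` plus a constant, i.e. indices
have `O(log n)` bits as long as `t` is polynomial. Costs are reals that can be added, subtracted
and compared. Memory consists of registers and of two-dimensional arrays. -/

structure Memory where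
  reg : ℕ → ℕ
  arr : ℕ → ℕ → ℕ → ℕ
  rreg : ℕ → ℝ
  rarr : ℕ → ℕ → ℕ → ℝ

/-- Instructions. The arguments `x y z i j` are names of registers, `a` is the name of an array
and `k` is a constant. -/
inductive Instr where
  | const (x k : ℕ)
  | copy (x y : ℕ)
  | inc (x : ℕ)
  | dec (x : ℕ)
  | load (x a i j : ℕ)
  | store (a i j x : ℕ)
  | rzero (x : ℕ)
  | rone (x : ℕ)
  | rcopy (x y : ℕ)
  | radd (x y z : ℕ)
  | rsub (x y z : ℕ)
  | rload (x a i j : ℕ)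
  | rstore (a i j x : ℕ)

namespace Memory

def setReg (s : Memory) (x v : ℕ) : Memory := { s with reg := Function.update s.reg x v }

def setArr (s : Memory) (a i j v : ℕ) : Memory :=
  { s with
    arr := Function.update s.arr a
      (Function.update (s.arr a) i (Function.update (s.arr a i) j v)) }

noncomputable def setRreg (s : Memory) (x : ℕ) (v : ℝ) : Memory :=
  { s with rreg := Function.update s.rreg x v }

noncomputable def setRarr (s : Memory) (a i j : ℕ) (v : ℝ) : Memory :=
  { s with
    rarr := Function.update s.rarr a
      (Function.update (s.rarr a) i (Function.update (s.rarr a i) j v)) }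

end Memory

/-- The effect of an instruction. -/
noncomputable def Instr.effect (s : Memory) : Instr → Memory
  | .const x k => s.setReg x k
  | .copy x y => s.setReg x (s.reg y)
  | .inc x => s.setReg x (s.reg x + 1)
  | .dec x => s.setReg x (s.reg x - 1)
  | .load x a i j => s.setReg x (s.arr a (s.reg i) (s.reg j))
  | .store a i j x => s.setArr a (s.reg i) (s.reg j) (s.reg x)
  | .rzero x => s.setRreg x 0
  | .rone x => s.setRreg x 1
  | .rcopy x y => s.setRreg x (s.rreg y)
  | .radd x y z => s.setRreg x (s.rreg y + s.rreg z)
  | .rsub x y z => s.setRreg x (s.rreg y - s.rreg z)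
  | .rload x a i j => s.setRreg x (s.rarr a (s.reg i) (s.reg j))
  | .rstore a i j x => s.setRarr a (s.reg i) (s.reg j) (s.rreg x)

/-- Tests: comparisons of two index registers or of two real registers. -/
inductive Test where
  | eq (x y : ℕ)
  | lt (x y : ℕ)
  | rlt (x y : ℕ)
  | neg (b : Test)

def Test.Holds (s : Memory) : Test → Prop
  | .eq x y => s.reg x = s.reg y
  | .lt x y => s.reg x < s.reg y
  | .rlt x y => s.rreg x < s.rreg y
  | .neg b => ¬ b.Holds s

inductive Prog where
  | instr (a : Instr)
  | seq (f g : Prog)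
  | ite (b : Test) (f g : Prog)
  | loop (b : Test) (f : Prog)

/-- `Exec f s t s'`: started in memory `s`, the program `f` halts after exactly `t` steps in
memory `s'`. Every instruction and every evaluation of a test is one step. -/
inductive Exec : Prog → Memory → ℕ → Memory → Prop
  | instr (a : Instr) (s : Memory) : Exec (.instr a) s 1 (a.effect s)
  | seq {f g : Prog} {s s' s'' : Memory} {t t' : ℕ} :
      Exec f s t s' → Exec g s' t' s'' → Exec (.seq f g) s (t + t') s''
  | ite_true {b : Test} {f g : Prog} {s s' : Memory} {t : ℕ} :
      b.Holds s → Exec f s t s' → Exec (.ite b f g) s (t + 1) s'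
  | ite_false {b : Test} {f g : Prog} {s s' : Memory} {t : ℕ} :
      ¬ b.Holds s → Exec g s t s' → Exec (.ite b f g) s (t + 1) s'
  | loop_true {b : Test} {f : Prog} {s s' s'' : Memory} {t t' : ℕ} :
      b.Holds s → Exec f s t s' → Exec (.loop b f) s' t' s'' →
      Exec (.loop b f) s (t + t' + 1) s''
  | loop_false {b : Test} {f : Prog} {s : Memory} :
      ¬ b.Holds s → Exec (.loop b f) s 1 s

/-! ## Layout of the memory -/

/-- A matrix as an array, extended by `d` outside the matrix. -/
def tabulate {α β : Type} {r c : ℕ} (d : β) (f : α → β) (Q : Matrix (Fin r) (Fin c) α)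
    (i j : ℕ) : β :=
  if h : i < r ∧ j < c then f (Q ⟨i, h.1⟩ ⟨j, h.2⟩) else d

/-- The input: registers `0, 1, 2` hold `n`, `m`, `p`; the arrays `0, 1, 2` hold the patterns
`A`, `B`, `C`; array `3` marks the forbidden entries of the cost matrix, and the real array `0`
holds the others. Everything else is zero. -/
def inputMemory {n m p : ℕ} (S : StructuredSystem n m p) (P : CostMatrix m p) : Memory where
  reg
    | 0 => n
    | 1 => m
    | 2 => p
    | _ => 0
  arr
    | 0 => tabulate 0 Bool.toNat S.A
    | 1 => tabulate 0 Bool.toNat S.B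
    | 2 => tabulate 0 Bool.toNat S.C
    | 3 => tabulate 0 (fun v => match v with | ⊤ => 1 | (_ : ℝ) => 0) P
    | _ => fun _ _ => 0
  rreg _ := 0
  rarr
    | 0 => tabulate 0 (WithTop.untopD 0) P
    | _ => fun _ _ => 0

/-- The memory holds a feedback pattern in array `a`. -/
def HoldsFeedback {m p : ℕ} (s : Memory) (a : ℕ) (K : FeedbackMatrix m p) : Prop :=
  ∀ (i : Fin m) (j : Fin p), s.arr a i j = (K i j).toNat

/-- The memory holds the variables of a run of the dynamic programming algorithm: register `4`
holds `ℓ`; array `4` the number of the component of each state; the arrays `5, 6, 7, 8` the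
sets `U k`, `Y k` and their unions; array `9` marks the `k` with infinite `W([k])`, the real
array `1` holds the other `W([k])`; the arrays `10, 11` hold the `i`, `j` of the edge `(y_j, u_i)`
selected in stage `k`, and array `12` the `z` with `sel k = {(y_j, u_i)} ∪ sel z`; array `13` holds
the output. -/
structure HoldsDPRun {n m p : ℕ} {S : StructuredSystem n m p} {P : CostMatrix m p}
    (s : Memory) (r : DPRun S P) : Prop where
  ell : s.reg 4 = r.ℓ
  comp : ∀ k ∈ Set.Icc 1 r.ℓ, ∀ x : Fin n, s.arr 4 x 0 = k ↔ x ∈ r.𝒞 k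
  U : ∀ k ∈ Set.Icc 1 r.ℓ, ∀ i : Fin m, s.arr 5 k i = 1 ↔ i ∈ S.U r.𝒞 k
  Y : ∀ k ∈ Set.Icc 1 r.ℓ, ∀ j : Fin p, s.arr 6 k j = 1 ↔ j ∈ S.Y r.𝒞 k
  cumU : ∀ k ∈ Set.Icc 1 r.ℓ, ∀ i : Fin m, s.arr 7 k i = 1 ↔ i ∈ S.cumU r.𝒞 k
  cumY : ∀ k ∈ Set.Icc 1 r.ℓ, ∀ j : Fin p, s.arr 8 k j = 1 ↔ j ∈ S.cumY r.ℓ r.𝒞 k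
  W : ∀ k ≤ r.ℓ, (s.arr 9 k 0 = 1 ∧ r.W k = ⊤) ∨
    (s.arr 9 k 0 = 0 ∧ r.W k = (s.rarr 1 k 0 : ℝ))
  sel : ∀ k ∈ Set.Icc 1 r.ℓ, ∃ (i : Fin m) (j : Fin p),
    s.arr 10 k 0 = i ∧ s.arr 11 k 0 = j ∧ s.arr 12 k 0 = S.first r.𝒞 i - 1 ∧
    (j, i) ∈ S.coverEdges r.ℓ r.𝒞 k ∧ r.W k = P i j + r.W (s.arr 12 k 0) ∧
    r.sel k = insert (j, i) (r.sel (s.arr 12 k 0))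
  Ka : HoldsFeedback s 13 r.Ka

/-- The numbers of the vertices on either side of the bipartite graph: first the states, then
the inputs, then the outputs. -/
def vertexNumber {n m p : ℕ} : Vertex n m p → ℕ
  | .inl i => i
  | .inr (.inl i) => n + i
  | .inr (.inr j) => n + m + j

/-- The memory holds the variables of a run of the two-stage algorithm: those of the dynamic
programming algorithm, in array `14` the partner of each left vertex in the matching, and in the
arrays `15, 16` the second feedback pattern and the output. -/
structure HoldsTwoStageRun {n m p : ℕ} {S : StructuredSystem n m p} {P : CostMatrix m p}
    (s : Memory) (r : TwoStageRun S P) : Prop where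
  dp : HoldsDPRun s r.dp
  M : ∀ e ∈ r.M, s.arr 14 (vertexNumber e.1) 0 = vertexNumber e.2
  Kb : HoldsFeedback s 15 r.Kb
  KA : HoldsFeedback s 16 r.KA

/-- In the final memory, register `3` tells whether the dynamic programming algorithm can be
carried out; if so, the memory holds a run of it. -/
def DPDone {n m p : ℕ} (S : StructuredSystem n m p) (P : CostMatrix m p) (s : Memory) : Prop :=
  (s.reg 3 = 1 ∧ ∃ r : DPRun S P, HoldsDPRun s r) ∨ (s.reg 3 = 0 ∧ IsEmpty (DPRun S P))

/-- In the final memory, register `3` tells whether the two-stage algorithm can be carried out;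
if so, the memory holds a run of it. -/
def TwoStageDone {n m p : ℕ} (S : StructuredSystem n m p) (P : CostMatrix m p) (s : Memory) :
    Prop :=
  (s.reg 3 = 1 ∧ ∃ r : TwoStageRun S P, HoldsTwoStageRun s r) ∨
    (s.reg 3 = 0 ∧ IsEmpty (TwoStageRun S P))

end FeedbackSelection

namespace FeedbackSelection

section

/-! ## A calculus for the machine -/

-- Both algorithms are written as explicit programs of the machine. Their loops range over at most
-- `M = n + m + p + 1` values, and each phase takes at most a constant times `M ^ 3` steps. Since `M
-- ≤ (2 * c + 2) * n` for `n ≥ 1` (`cube_le`), this gives `O(n ^ 3)`. Programs are analysed in a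
-- logic of total correctness with running times (`wp`). `wp_loop` and its variants for counted
-- loops bound times and carry invariants, and a syntactic frame property (`Exec.frame`) takes care
-- of everything that a program does not write to.
--
-- Components: Warshall's algorithm computes reachability. On a line graph of components, `x`
-- reaches `y` iff the position of `x` is at most that of `y`. So the position of `x` is the number
-- of components that reach `x`, and this is found by counting least vertices
-- (`IsPosition.card_reach`). In particular the digraph determines the positions
-- (`IsPosition.unique`), which is why an empty `A_k` found by the program rules out every run, not
-- only the one attempted.
--
-- Dynamic program: for each input `i` the number `t(i) - 1` is tabulated as the last `k` with `i`
-- outside the `k`-th union. Then each pair `(i, j)` is handled in constant time in each stage, and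
-- there are at most `n` stages with `m * p` pairs each. An edge that covers component `k` has `t(i)
-- - 1 < k`, so the value of `W` that it needs is already final. The selected edges are found by
-- following links from `ℓ` down to `0`.
--
-- Matching: with `N = n + m + p`, the problem is turned into an assignment problem on all `N * N`
-- pairs of vertices. If `b ≥ 1` bounds the absolute values of the finite costs, infinite costs are
-- replaced by `q = (2 * N + 1) * b`, and pairs that are not edges get the cost `h = (2 * N + 1) *
-- q`. One large term outweighs everything that the smaller ones can contribute
-- (`lt_of_sum_le_sum`). Hence an optimal assignment avoids non-edges if a perfect matching exists,
-- and then avoids infinite costs if some perfect matching has finite cost (`adj_of_optimal`,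
-- `isMinCostPerfectMatching_of_optimal`).
--
-- The assignment problem is solved by the Hungarian method with potentials. Rows are added one at a
-- time. For each row a tree of tight pairs grows until it reaches a free column
-- (`SearchTree.step`), and then the assignment is shifted along the path back to the root
-- (`Augmenting.step`). The tree gains one column per round at linear cost, so a row costs `O(N ^
-- 2)`. The final potentials are a dual solution certifying optimality (`sum_le_sum_of_dual`).

infixr:60 " ;; " => Prog.seq

/-- Started in `s`, the program `f` halts; its running time and final memory satisfy `Q`. -/
def wp (f : Prog) (s : Memory) (Q : ℕ → Memory → Prop) : Prop :=
  ∃ t s', Exec f s t s' ∧ Q t s'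

theorem wp_mono {f : Prog} {s : Memory} {Q Q' : ℕ → Memory → Prop} (h : wp f s Q)
    (hQ : ∀ t s', Q t s' → Q' t s') : wp f s Q' := by
  obtain ⟨t, s', h1, h2⟩ := h
  exact ⟨t, s', h1, hQ _ _ h2⟩

/-- A sequence of instructions (followed by one instruction without effect). -/
def block : List Instr → Prog
  -- There is no empty program, so a copy of a register onto itself takes its place. No other
  -- instruction refers to register 99, but syntactically every block writes to it.
  | [] => .instr (.copy 99 99)
  | a :: l => .instr a ;; block l

theorem wp_instr {a : Instr} {s : Memory} {Q : ℕ → Memory → Prop} (h : Q 1 (a.effect s)) :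
    wp (.instr a) s Q := ⟨1, _, .instr a s, h⟩

theorem wp_seq {f g : Prog} {s : Memory} {Q : ℕ → Memory → Prop}
    (h : wp f s fun t s' => wp g s' fun t' s'' => Q (t + t') s'') : wp (f ;; g) s Q := by
  obtain ⟨t, s', h1, t', s'', h2, h3⟩ := h
  exact ⟨_, _, .seq h1 h2, h3⟩

theorem wp_ite {b : Test} {f g : Prog} {s : Memory} {Q : ℕ → Memory → Prop}
    (h1 : b.Holds s → wp f s fun t s' => Q (t + 1) s')
    (h2 : ¬ b.Holds s → wp g s fun t s' => Q (t + 1) s') : wp (.ite b f g) s Q := by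
  by_cases hb : b.Holds s
  · obtain ⟨t, s', h3, h4⟩ := h1 hb
    exact ⟨_, _, .ite_true hb h3, h4⟩
  · obtain ⟨t, s', h3, h4⟩ := h2 hb
    exact ⟨_, _, .ite_false hb h3, h4⟩

theorem wp_block {l : List Instr} {s : Memory} {Q : ℕ → Memory → Prop}
    (h : Q (l.length + 1) (l.foldl Instr.effect s)) : wp (block l) s Q := by
  induction l generalizing s Q with
  | nil =>
    refine wp_instr ?_
    have : (Instr.copy 99 99).effect s = s := by
      simp [Instr.effect, Memory.setReg]
    rw [this]
    simpa using h
  | cons a l ih =>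
    refine wp_seq (wp_instr (ih ?_))
    simpa [Nat.add_comm, Nat.add_left_comm] using h

namespace Memory

variable (s : Memory) (x y a b i j k l v : ℕ) (r : ℝ)

@[simp] theorem reg_setReg : (s.setReg x v).reg y = if y = x then v else s.reg y := by
  simp [setReg, Function.update_apply]

@[simp] theorem arr_setReg : (s.setReg x v).arr = s.arr := rfl

@[simp] theorem rreg_setReg : (s.setReg x v).rreg = s.rreg := rfl

@[simp] theorem rarr_setReg : (s.setReg x v).rarr = s.rarr := rfl

@[simp] theorem reg_setArr : (s.setArr a i j v).reg = s.reg := rfl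

theorem arr_setArr : (s.setArr a i j v).arr b =
    if b = a then fun k l => if k = i ∧ l = j then v else s.arr a k l else s.arr b := by
  funext k l
  by_cases hb : b = a
  · subst hb
    by_cases hk : k = i
    · subst hk; simp [setArr, Function.update_apply]
    · simp [setArr, hk]
  · simp [setArr, hb]

@[simp] theorem arr_setArr_apply : (s.setArr a i j v).arr b k l =
    if b = a ∧ k = i ∧ l = j then v else s.arr b k l := by
  rw [arr_setArr]
  by_cases hb : b = a
  · subst hb; simp
  · simp [hb]

@[simp] theorem rreg_setArr : (s.setArr a i j v).rreg = s.rreg := rfl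

@[simp] theorem rarr_setArr : (s.setArr a i j v).rarr = s.rarr := rfl

@[simp] theorem reg_setRreg : (s.setRreg x r).reg = s.reg := rfl

@[simp] theorem arr_setRreg : (s.setRreg x r).arr = s.arr := rfl

@[simp] theorem rreg_setRreg : (s.setRreg x r).rreg y = if y = x then r else s.rreg y := by
  simp [setRreg, Function.update_apply]

@[simp] theorem rarr_setRreg : (s.setRreg x r).rarr = s.rarr := rfl

@[simp] theorem reg_setRarr : (s.setRarr a i j r).reg = s.reg := rfl

@[simp] theorem arr_setRarr : (s.setRarr a i j r).arr = s.arr := rfl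

@[simp] theorem rreg_setRarr : (s.setRarr a i j r).rreg = s.rreg := rfl

theorem rarr_setRarr : (s.setRarr a i j r).rarr b =
    if b = a then fun k l => if k = i ∧ l = j then r else s.rarr a k l else s.rarr b := by
  funext k l
  by_cases hb : b = a
  · subst hb
    by_cases hk : k = i
    · subst hk; simp [setRarr, Function.update_apply]
    · simp [setRarr, hk]
  · simp [setRarr, hb]

@[simp] theorem rarr_setRarr_apply : (s.setRarr a i j r).rarr b k l =
    if b = a ∧ k = i ∧ l = j then r else s.rarr b k l := by
  rw [rarr_setRarr]
  by_cases hb : b = a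
  · subst hb; simp
  · simp [hb]

end Memory

/-! ### What a program leaves unchanged -/

/-- Written as Boolean functions, so that for a concrete program the claim that a given cell is left
alone is settled by evaluation (`rfl`). -/
def Instr.modReg (y : ℕ) : Instr → Bool
  | .const x _ | .copy x _ | .inc x | .dec x | .load x _ _ _ => y == x
  | _ => false

def Instr.modArr (b : ℕ) : Instr → Bool
  | .store a _ _ _ => b == a
  | _ => false

def Instr.modRreg (y : ℕ) : Instr → Bool
  | .rzero x | .rone x | .rcopy x _ | .radd x _ _ | .rsub x _ _ | .rload x _ _ _ => y == x
  | _ => false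

def Instr.modRarr (b : ℕ) : Instr → Bool
  | .rstore a _ _ _ => b == a
  | _ => false

/-- Some instruction of the program satisfies `q`. -/
def Prog.any (q : Instr → Bool) : Prog → Bool
  | .instr a => q a
  | .seq f g => f.any q || g.any q
  | .ite _ f g => f.any q || g.any q
  | .loop _ f => f.any q

/-- The memories `s` and `s'` agree, except for registers and arrays that `f` writes to. -/
structure Frame (f : Prog) (s s' : Memory) : Prop where
  reg : ∀ x, f.any (Instr.modReg x) = false → s'.reg x = s.reg x
  arr : ∀ a, f.any (Instr.modArr a) = false → s'.arr a = s.arr a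
  rreg : ∀ x, f.any (Instr.modRreg x) = false → s'.rreg x = s.rreg x
  rarr : ∀ a, f.any (Instr.modRarr a) = false → s'.rarr a = s.rarr a

theorem Frame.refl (f : Prog) (s : Memory) : Frame f s s :=
  ⟨fun _ _ => rfl, fun _ _ => rfl, fun _ _ => rfl, fun _ _ => rfl⟩

theorem Frame.trans {f : Prog} {s s' s'' : Memory} (h : Frame f s s') (h' : Frame f s' s'') :
    Frame f s s'' :=
  ⟨fun x hx => (h'.reg x hx).trans (h.reg x hx), fun x hx => (h'.arr x hx).trans (h.arr x hx),
    fun x hx => (h'.rreg x hx).trans (h.rreg x hx), fun x hx => (h'.rarr x hx).trans (h.rarr x hx)⟩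

theorem Frame.mono {f g : Prog} {s s' : Memory} (h : Frame f s s')
    (hfg : ∀ q, g.any q = false → f.any q = false) : Frame g s s' :=
  ⟨fun x hx => h.reg x (hfg _ hx), fun x hx => h.arr x (hfg _ hx),
    fun x hx => h.rreg x (hfg _ hx), fun x hx => h.rarr x (hfg _ hx)⟩

theorem Frame.of_instr (a : Instr) (s : Memory) : Frame (.instr a) s (a.effect s) := by
  constructor <;> intro x hx <;>
    cases a <;> simp_all [Prog.any, Instr.modReg, Instr.modArr, Instr.modRreg, Instr.modRarr,
      Instr.effect, Memory.arr_setArr, Memory.rarr_setRarr]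

/-- This is what keeps loop invariants short: they mention only what the loop changes, and all other
facts about the initial memory are recovered from the frame. -/
theorem Exec.frame {f : Prog} {s s' : Memory} {t : ℕ} (h : Exec f s t s') : Frame f s s' := by
  induction h with
  | instr a s => exact Frame.of_instr a s
  | seq _ _ h1 h2 =>
    exact (h1.mono fun q hq => by simp_all [Prog.any]).trans
      (h2.mono fun q hq => by simp_all [Prog.any])
  | ite_true _ _ h1 => exact h1.mono fun q hq => by simp_all [Prog.any]
  | ite_false _ _ h1 => exact h1.mono fun q hq => by simp_all [Prog.any]
  | loop_true _ _ _ h1 h2 => exact (h1.mono fun q hq => by simp_all [Prog.any]).trans h2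
  | loop_false => exact Frame.refl _ _

theorem wp_frame {f : Prog} {s : Memory} {Q Q' : ℕ → Memory → Prop} (h : wp f s Q)
    (hQ : ∀ t s', Frame f s s' → Q t s' → Q' t s') : wp f s Q' := by
  obtain ⟨t, s', h1, h2⟩ := h
  exact ⟨t, s', h1, hQ _ _ h1.frame h2⟩

/-! ### Loops -/

/-- A loop whose body decreases `μ`, takes at most `T` steps and preserves `I`. -/
theorem wp_loop {b : Test} {f : Prog} {s : Memory} {Q : ℕ → Memory → Prop}
    (I : Memory → Prop) (μ : Memory → ℕ) (T : ℕ) (h0 : I s)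
    (hf : ∀ s', Frame f s s' → I s' → b.Holds s' →
      wp f s' fun t s'' => t ≤ T ∧ I s'' ∧ μ s'' < μ s')
    (hQ : ∀ t s', Frame f s s' → t ≤ μ s * (T + 1) + 1 → I s' → ¬ b.Holds s' → Q t s') :
    wp (.loop b f) s Q := by
  -- Strong induction on the measure, for all memories that the loop may have reached. A round costs
  -- at most `T` steps and one test; the final `+ 1` is the test that fails.
  suffices h : ∀ N s', μ s' = N → Frame f s s' → I s' →
      wp (.loop b f) s' fun t s'' => Frame f s s'' ∧ t ≤ N * (T + 1) + 1 ∧ I s'' ∧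
        ¬ b.Holds s'' from
    wp_mono (h _ s rfl (Frame.refl _ _) h0) fun t s' ⟨h1, h2, h3, h4⟩ => hQ t s' h1 h2 h3 h4
  intro N
  induction N using Nat.strong_induction_on with
  | _ N ih =>
    intro s' hN hs hI
    by_cases hb : b.Holds s'
    · obtain ⟨t, s'', h1, h2, h3, h4⟩ := hf s' hs hI hb
      obtain ⟨t', s3, h5, h6, h7, h8⟩ :=
        ih _ (hN ▸ h4) s'' rfl (hs.trans h1.frame) h3
      refine ⟨_, _, .loop_true hb h1 h5, h6, ?_, h8⟩
      have : (μ s'' + 1) * (T + 1) ≤ N * (T + 1) := Nat.mul_le_mul_right _ (by omega)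
      rw [Nat.add_mul] at this
      omega
    · exact ⟨1, s', .loop_false hb, hs, by omega, hI, hb⟩

/-- `for k = a, …, n - 1`, where `n` is the content of a register. -/
def forLoop (k a n : ℕ) (f : Prog) : Prog :=
  .instr (.const k a) ;; .loop (.lt k n) (f ;; .instr (.inc k))

/-- All running times have the form `K * M ^ d` with one common bound `M` for the loop ranges, so
that a loop raises `d` by one and `K` by 4. The 4 pays for increment and test in each round, for the
initialization and for the last test. The invariant is required after the counter has been
incremented. -/
theorem wp_forLoop {k a n : ℕ} {f : Prog} {s : Memory} {Q : ℕ → Memory → Prop}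
    (I : ℕ → Memory → Prop) (K d M : ℕ) (hM : s.reg n ≤ M) (hM1 : 1 ≤ M) (ha : a ≤ s.reg n)
    (hmod : (n == k || f.any (Instr.modReg k) || f.any (Instr.modReg n)) = false)
    (h0 : I a (s.setReg k a))
    (hf : ∀ i s', a ≤ i → i < s.reg n → Frame (forLoop k a n f) s s' → s'.reg k = i → I i s' →
      wp f s' fun t s'' => t ≤ K * M ^ d ∧ I (i + 1) (s''.setReg k (i + 1)))
    (hQ : ∀ t s', Frame (forLoop k a n f) s s' → t ≤ (K + 4) * M ^ (d + 1) →
      I (s.reg n) s' → Q t s') :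
    wp (forLoop k a n f) s Q := by
  simp only [Bool.or_eq_false_iff, beq_eq_false_iff_ne, ne_eq] at hmod
  obtain ⟨⟨hnk, hk⟩, hn⟩ := hmod
  have hfr0 : Frame (forLoop k a n f) s (s.setReg k a) :=
    (Frame.of_instr (.const k a) s).mono fun q hq => by simp_all [forLoop, Prog.any]
  have hmono : ∀ q, (forLoop k a n f).any q = false →
      (f ;; .instr (.inc k)).any q = false := fun q hq => by simp_all [forLoop, Prog.any]
  have hfn : (f ;; Prog.instr (.inc k)).any (Instr.modReg n) = false := by
    simp [Prog.any, hn, Instr.modReg, hnk]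
  refine wp_seq (wp_instr ?_)
  refine wp_loop (fun s' => ∃ i, a ≤ i ∧ i ≤ s.reg n ∧ s'.reg k = i ∧ s'.reg n = s.reg n ∧ I i s')
    (fun s' => s'.reg n - s'.reg k) (K * M ^ d + 1) ?_ ?_ ?_
  · exact ⟨a, le_rfl, ha, by simp [Instr.effect], by simp [Instr.effect, hnk], h0⟩
  · rintro s' hfr ⟨i, hai, hi, hki, hni, hI⟩ hb
    simp only [Test.Holds, hki, hni] at hb
    refine wp_seq (wp_frame (hf i s' hai hb (hfr0.trans (hfr.mono hmono)) hki hI) ?_)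
    rintro t s'' hfr' ⟨ht, hI'⟩
    have e1 := hfr'.reg k hk
    have e2 := hfr'.reg n hn
    refine wp_instr ⟨by omega, ⟨i + 1, by omega, by omega, ?_, ?_, ?_⟩, ?_⟩
    · simp [Instr.effect, e1, hki]
    · simp [Instr.effect, hnk, e2, hni]
    · simpa only [Instr.effect, e1, hki] using hI'
    · simp only [Instr.effect, Memory.reg_setReg, hnk, if_false, if_true, e1, e2, hki, hni]
      omega
  · rintro t s' hfr ht ⟨i, hai, hi, hki, hni, hI⟩ hb
    simp only [Test.Holds, hki, hni] at hb
    obtain rfl : i = s.reg n := by omega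
    refine hQ _ _ (hfr0.trans (hfr.mono hmono)) ?_ hI
    have h1 : M ≤ M ^ (d + 1) := Nat.le_self_pow (by omega) M
    have h2 : ((Instr.const k a).effect s).reg n - ((Instr.const k a).effect s).reg k ≤ M := by
      simp [Instr.effect, hnk]; omega
    have h3 := Nat.mul_le_mul_right (K * M ^ d + 1 + 1) h2
    have h4 : M * (K * M ^ d + 1 + 1) = K * M ^ (d + 1) + 2 * M := by ring
    have h5 : (K + 4) * M ^ (d + 1) = K * M ^ (d + 1) + 4 * M ^ (d + 1) := by ring
    omega

/-- A loop over `i < n` in which the order of the indices does not matter: the invariant depends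
on the set of indices that have been treated. -/
theorem wp_forSet {k n : ℕ} {f : Prog} {s : Memory} {Q : ℕ → Memory → Prop}
    (I : Set ℕ → Memory → Prop) (K d M : ℕ) (hM : s.reg n ≤ M) (hM1 : 1 ≤ M)
    (hmod : (n == k || f.any (Instr.modReg k) || f.any (Instr.modReg n)) = false)
    (hI : ∀ D s v, I D s → I D (s.setReg k v)) (h0 : I ∅ s)
    (hf : ∀ i D s', i < s.reg n → i ∉ D → Frame (forLoop k 0 n f) s s' → s'.reg k = i → I D s' →
      wp f s' fun t s'' => t ≤ K * M ^ d ∧ I (insert i D) s'')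
    (hQ : ∀ t s', Frame (forLoop k 0 n f) s s' → t ≤ (K + 4) * M ^ (d + 1) →
      I {i | i < s.reg n} s' → Q t s') :
    wp (forLoop k 0 n f) s Q := by
  refine wp_forLoop (fun i => I {j | j < i}) K d M hM hM1 (Nat.zero_le _) hmod ?_ ?_ hQ
  · simpa using hI _ _ 0 h0
  · intro i s' _ hi hfr hk hi'
    refine wp_mono (hf i _ s' hi (by simp) hfr hk hi') fun t s'' ⟨h1, h2⟩ => ⟨h1, hI _ _ _ ?_⟩
    convert h2 using 1
    ext j
    simp [Order.lt_add_one_iff, le_iff_eq_or_lt]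

/-- Two nested loops in which the order of the pairs does not matter. -/
theorem wp_forSet₂ {k l n m : ℕ} {f : Prog} {s : Memory} {Q : ℕ → Memory → Prop}
    (I : Set (ℕ × ℕ) → Memory → Prop) (K d M : ℕ)
    (hn : s.reg n ≤ M) (hm : s.reg m ≤ M) (hM1 : 1 ≤ M)
    (hmod : (n == k || n == l || m == l || m == k || k == l ||
      f.any (Instr.modReg k) || f.any (Instr.modReg l) || f.any (Instr.modReg n) ||
      f.any (Instr.modReg m)) = false)
    (hI : ∀ D s v, I D s → I D (s.setReg k v)) (hI' : ∀ D s v, I D s → I D (s.setReg l v))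
    (h0 : I ∅ s)
    (hf : ∀ i j D s', i < s.reg n → j < s.reg m → (i, j) ∉ D →
      Frame (forLoop k 0 n (forLoop l 0 m f)) s s' → s'.reg k = i → s'.reg l = j → I D s' →
      wp f s' fun t s'' => t ≤ K * M ^ d ∧ I (insert (i, j) D) s'')
    (hQ : ∀ t s', Frame (forLoop k 0 n (forLoop l 0 m f)) s s' → t ≤ (K + 8) * M ^ (d + 2) →
      I {e | e.1 < s.reg n ∧ e.2 < s.reg m} s' → Q t s') :
    wp (forLoop k 0 n (forLoop l 0 m f)) s Q := by
  simp only [Bool.or_eq_false_iff, beq_eq_false_iff_ne, ne_eq] at hmod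
  obtain ⟨⟨⟨⟨⟨⟨⟨⟨h1, h2⟩, h3⟩, h4⟩, h5⟩, h6⟩, h7⟩, h8⟩, h9⟩ := hmod
  have hmono : ∀ q, (forLoop k 0 n (forLoop l 0 m f)).any q = false →
      (forLoop l 0 m f).any q = false := fun q hq => by
    simp only [forLoop, Prog.any] at hq ⊢; simp_all
  -- Between rounds of the outer loop the treated pairs form full rows; the inner loop adds the
  -- treated part of row `i` to them.
  refine wp_forSet (fun D => I {e | e.1 ∈ D ∧ e.2 < s.reg m}) (K + 4) (d + 1) M hn hM1 ?_
    (fun D s v => hI _ s v) (by simpa using h0) ?_ ?_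
  · simp_all [forLoop, Prog.any, Instr.modReg]
  · intro i D s' hi hiD hfr hki hI1
    have em : s'.reg m = s.reg m := hfr.reg m (by simp_all [forLoop, Prog.any, Instr.modReg])
    refine wp_forSet (fun D' => I ({e | e.1 ∈ D ∧ e.2 < s.reg m} ∪ {e | e.1 = i ∧ e.2 ∈ D'}))
      K d M (em ▸ hm) hM1 ?_ (fun D s v => hI' _ s v) (by simpa using hI1) ?_ ?_
    · simp_all
    · intro j D' s'' hj hjD hfr' hlj hI2
      have ek : s''.reg k = s'.reg k := hfr'.reg k (by simp_all [forLoop, Prog.any, Instr.modReg])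
      refine wp_mono (hf i j _ s'' hi (em ▸ hj) ?_ (hfr.trans (hfr'.mono hmono)) (ek.trans hki) hlj
        hI2) fun t s3 ⟨h1, h2⟩ => ⟨h1, ?_⟩
      · simp [hiD, hjD]
      · convert h2 using 1
        ext ⟨a, b⟩
        simp only [Set.mem_union, Set.mem_ofPred_eq, Set.mem_insert_iff, Prod.mk.injEq]
        tauto
    · intro t s'' hfr' ht hI2
      refine ⟨ht, ?_⟩
      convert hI2 using 1
      ext ⟨a, b⟩
      simp only [Set.mem_union, Set.mem_ofPred_eq, Set.mem_insert_iff, em]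
      tauto
  · intro t s' hfr ht hI1
    exact hQ t s' hfr (by simpa [Nat.add_assoc] using ht) (by simpa using hI1)

theorem le_mul_pow {t K M d : ℕ} (e : ℕ) (hM : 1 ≤ M) (he : e ≤ d) (h : t ≤ K * M ^ e) :
    t ≤ K * M ^ d :=
  h.trans (Nat.mul_le_mul_left _ (Nat.pow_le_pow_right hM he))

end

/-! ### Symbolic execution of loop-free programs -/

section

/-- Inversion of `Exec` turns the rules for instructions, sequences, branches and blocks into
equivalences. Used as rewrite rules, they let `simp` execute loop-free code, leaving one case for
each outcome of the tests. -/
theorem wp_instr_iff {a : Instr} {s : Memory} {Q : ℕ → Memory → Prop} :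
    wp (.instr a) s Q ↔ Q 1 (a.effect s) := by
  refine ⟨?_, wp_instr⟩
  rintro ⟨t, s', h, hQ⟩
  cases h
  exact hQ

theorem wp_seq_iff {f g : Prog} {s : Memory} {Q : ℕ → Memory → Prop} :
    wp (f ;; g) s Q ↔ wp f s fun t s' => wp g s' fun t' s'' => Q (t + t') s'' := by
  refine ⟨?_, wp_seq⟩
  rintro ⟨t, s', h, hQ⟩
  cases h with
  | seq h1 h2 => exact ⟨_, _, h1, _, _, h2, hQ⟩

theorem wp_ite_iff {b : Test} {f g : Prog} {s : Memory} {Q : ℕ → Memory → Prop} :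
    wp (.ite b f g) s Q ↔ (b.Holds s → wp f s fun t s' => Q (t + 1) s') ∧
      (¬ b.Holds s → wp g s fun t s' => Q (t + 1) s') := by
  refine ⟨?_, fun h => wp_ite h.1 h.2⟩
  rintro ⟨t, s', h, hQ⟩
  cases h with
  | ite_true hb h => exact ⟨fun _ => ⟨_, _, h, hQ⟩, fun h' => absurd hb h'⟩
  | ite_false hb h => exact ⟨fun h' => absurd h' hb, fun _ => ⟨_, _, h, hQ⟩⟩

theorem wp_block_nil {s : Memory} {Q : ℕ → Memory → Prop} : wp (block []) s Q ↔ Q 1 s := by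
  rw [block, wp_instr_iff]
  have : (Instr.copy 99 99).effect s = s := by simp [Instr.effect, Memory.setReg]
  rw [this]

theorem wp_block_cons {a : Instr} {l : List Instr} {s : Memory} {Q : ℕ → Memory → Prop} :
    wp (block (a :: l)) s Q ↔ wp (block l) (a.effect s) fun t s' => Q (1 + t) s' := by
  rw [block, wp_seq_iff, wp_instr_iff]

/-! ## Reachability -/

/-- Reachability by walks with intermediate vertices below `k`. -/
def warshall (R : ℕ → ℕ → Prop) : ℕ → ℕ → ℕ → Prop
  | 0 => R
  | k + 1 => fun i j => warshall R k i j ∨ warshall R k i k ∧ warshall R k k j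

/-- Two walks may be joined at an intermediate vertex that is allowed. If it is the largest allowed
vertex, this is the recursion itself; otherwise the induction hypothesis joins the pieces, including
those that make a detour through the largest vertex. -/
theorem warshall_trans (R : ℕ → ℕ → Prop) (k a i j : ℕ) (ha : a < k)
    (h1 : warshall R k i a) (h2 : warshall R k a j) : warshall R k i j := by
  induction k generalizing a i j with
  | zero => omega
  | succ k ih =>
    simp only [warshall] at h1 h2 ⊢
    rcases Nat.lt_succ_iff_lt_or_eq.mp ha with h | rfl
    · have := ih a
      grind
    · grind

theorem warshall_mono (R : ℕ → ℕ → Prop) (k i j : ℕ) (h : R i j) : warshall R k i j := by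
  induction k with
  | zero => exact h
  | succ k ih => exact Or.inl ih

theorem warshall_reach {R : ℕ → ℕ → Prop} {k i j : ℕ} (h : warshall R k i j) :
    Relation.ReflTransGen R i j := by
  induction k generalizing i j with
  | zero => exact .single h
  | succ k ih =>
    rcases h with h | ⟨h, h'⟩
    · exact ih h
    · exact (ih h).trans (ih h')

/-- Reflexivity is needed because `warshall` describes walks with at least one edge and has to
account for the empty walk. -/
theorem warshall_iff {R : ℕ → ℕ → Prop} {n : ℕ} (hR : ∀ i j, R i j → i < n ∧ j < n)
    (hrefl : ∀ i < n, R i i) {i j : ℕ} (hi : i < n) :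
    warshall R n i j ↔ Relation.ReflTransGen R i j := by
  refine ⟨warshall_reach, fun h => ?_⟩
  induction h with
  | refl => exact warshall_mono _ _ _ _ (hrefl _ hi)
  | tail _ h' ih => exact warshall_trans _ _ _ _ _ (hR _ _ h').1 ih (warshall_mono _ _ _ _ h')

def reachInitBody : Prog :=
  block [.load 11 0 9 8] ;; .ite (.eq 8 9) (block [.store 17 8 9 6]) (block [.store 17 8 9 11])

def reachBody : Prog :=
  block [.load 11 17 8 10, .load 12 17 10 9] ;;
    .ite (.eq 11 6) (.ite (.eq 12 6) (block [.store 17 8 9 6]) (block [])) (block [])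

/-- Warshall's algorithm: array `17` becomes the reachability relation of the digraph whose
edges `x → y` are the nonzero entries `y, x` of array `0`. -/
def reachProg : Prog :=
  forLoop 8 0 0 (forLoop 9 0 0 reachInitBody) ;;
    forLoop 10 0 0 (forLoop 8 0 0 (forLoop 9 0 0 reachBody))

/-- The bound is written `12 * 1` because `1` unfolds from `M ^ 0`, the form in which the rules for
loops want the time of a body of constant cost. -/
theorem wp_reachBody {s : Memory} (h1 : s.reg 6 = 1) :
    wp reachBody s fun t s' => t ≤ 12 * 1 ∧ ∀ x y, s'.arr 17 x y = 1 ↔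
      s.arr 17 x y = 1 ∨ (x = s.reg 8 ∧ y = s.reg 9) ∧
        s.arr 17 (s.reg 8) (s.reg 10) = 1 ∧ s.arr 17 (s.reg 10) (s.reg 9) = 1 := by
  simp [reachBody, wp_seq_iff, wp_ite_iff, wp_block_cons, wp_block_nil, Instr.effect,
    Test.Holds, h1]
  grind

open Classical in
theorem wp_reachProg {s : Memory} {M : ℕ} (hM : 1 ≤ M) (hn : s.reg 0 ≤ M) (h1 : s.reg 6 = 1)
    (hbd : ∀ x y, s.arr 0 x y = 1 → x < s.reg 0 ∧ y < s.reg 0) :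
    wp reachProg s fun t s' => t ≤ 50 * M ^ 3 ∧ Frame reachProg s s' ∧
      ∀ x < s.reg 0, ∀ y < s.reg 0, s'.arr 17 x y = 1 ↔
        Relation.ReflTransGen (fun a b => s.arr 0 b a = 1) x y := by
  set n := s.reg 0 with hnn
  -- A loop at every vertex provides the reflexivity that `warshall_iff` needs; it does not change
  -- reachability.
  set R : ℕ → ℕ → Prop := fun x y => x < n ∧ y < n ∧ (x = y ∨ s.arr 0 y x = 1) with hR
  have hRR : ∀ x < n, ∀ y, Relation.ReflTransGen R x y ↔
      Relation.ReflTransGen (fun a b => s.arr 0 b a = 1) x y := by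
    intro x hx y
    constructor
    · intro h
      induction h with
      | refl => exact .refl
      | tail _ h' ih =>
        rcases h'.2.2 with rfl | h'
        · exact ih
        · exact ih.tail h'
    · intro h
      refine Relation.ReflTransGen.mono (p := R) ?_ _ _ h
      intro a b hab
      have := hbd _ _ hab
      exact ⟨this.2, this.1, Or.inr hab⟩
  refine wp_frame (Q := fun t s' => t ≤ 50 * M ^ 3 ∧ ∀ x < n, ∀ y < n, s'.arr 17 x y = 1 ↔
        warshall R n x y) ?_ ?_
  swap
  · rintro t s' hfr ⟨h, h'⟩
    refine ⟨h, hfr, fun x hx y hy => ?_⟩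
    rw [h' x hx y hy, ← hRR x hx, warshall_iff (n := n) (fun i j h => ⟨h.1, h.2.1⟩) _ hx]
    exact fun i hi => ⟨hi, hi, Or.inl rfl⟩
  refine wp_seq (wp_forSet₂
    (fun D s' => ∀ x y, (x, y) ∈ D → x < n → y < n → (s'.arr 17 x y = 1 ↔ R x y)) 12 0 M hn hn hM
    rfl (fun _ _ _ h => h) (fun _ _ _ h => h) (by simp) ?_ ?_)
  · intro i j D s' hi hj hD hfr hki hlj hI
    have e6 : s'.reg 6 = 1 := (hfr.reg 6 rfl).trans h1
    have ea : s'.arr 0 = s.arr 0 := hfr.arr 0 rfl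
    simp [reachInitBody, wp_seq_iff, wp_ite_iff, wp_block_cons, wp_block_nil, Instr.effect,
      Test.Holds, e6, hki, hlj, ea]
    constructor
    · rintro rfl x y hxy hx hy
      grind
    · intro hij x y hxy hx hy
      grind
  · intro t s1 hfr ht hI
    have en : s1.reg 0 = n := hfr.reg 0 rfl
    have e6 : s1.reg 6 = 1 := (hfr.reg 6 rfl).trans h1
    refine wp_forLoop (fun k s' => ∀ x < n, ∀ y < n, s'.arr 17 x y = 1 ↔ warshall R k x y)
      20 2 M (en.trans_le hn) hM (Nat.zero_le _) rfl ?_ ?_ ?_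
    · intro x hx y hy
      simpa [warshall] using hI x y ⟨hx, hy⟩ hx hy
    · intro k s2 _ hk hfr2 hkk hI2
      have en2 : s2.reg 0 = n := (hfr2.reg 0 rfl).trans en
      have e62 : s2.reg 6 = 1 := (hfr2.reg 6 rfl).trans e6
      rw [en] at hk
      refine wp_forSet₂ (fun D s' => ∀ x < n, ∀ y < n, s'.arr 17 x y = 1 ↔
          if (x, y) ∈ D then warshall R (k + 1) x y else warshall R k x y) 12 0 M
          (en2.trans_le hn) (en2.trans_le hn) hM
        rfl (fun _ _ _ h => h) (fun _ _ _ h => h) (by simpa using hI2) ?_ ?_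
      · intro i j D s' hi hj hD hfr3 hki hlj hI3
        have e63 : s'.reg 6 = 1 := (hfr3.reg 6 rfl).trans e62
        have ek : s'.reg 10 = k := (hfr3.reg 10 rfl).trans hkk
        rw [en2] at hi hj
        refine wp_mono (wp_reachBody e63) fun t s3 ⟨ht, h3⟩ => ⟨ht, fun x hx y hy => ?_⟩
        rw [hki, hlj, ek] at h3
        have a1 := hI3 i hi k hk
        have a2 := hI3 k hk j hj
        rw [h3, hI3 x hx y hy]
        clear hI3 hI2 hI h3
        -- The table is updated in place, so the two entries read may belong to stage `k` or to
        -- stage `k + 1`. This is harmless: row `k` and column `k` are the same in both stages.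
        have b1 : warshall R (k + 1) i k ↔ warshall R k i k := by simp only [warshall]; tauto
        have b2 : warshall R (k + 1) k j ↔ warshall R k k j := by simp only [warshall]; tauto
        simp only [b1, b2, ite_self] at a1 a2
        rw [a1, a2]
        by_cases hxy : x = i ∧ y = j
        · obtain ⟨rfl, rfl⟩ := hxy
          simp [hD, warshall]
        · simp [hxy]
      · intro t s' hfr3 ht3 hI3
        refine ⟨ht3, fun x hx y hy => ?_⟩
        have := hI3 x hx y hy
        simpa [en2, hx, hy] using this
    · intro t' s2 hfr2 ht2 hI2
      refine ⟨?_, by simpa [en] using hI2⟩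
      have := le_mul_pow (d := 3) _ hM (by norm_num) ht
      simp only [Nat.reduceAdd] at *
      omega

end

section

/-! ## Numbering the components -/

def repBody : Prog :=
  block [.load 11 17 8 9, .load 12 17 9 8] ;;
    .ite (.lt 9 8) (.ite (.eq 11 6) (.ite (.eq 12 6) (block [.store 18 8 5 6]) (block []))
      (block [])) (block [])

def ellBody : Prog := block [.load 11 18 8 5] ;; .ite (.eq 11 6) (block []) (block [.inc 4])

def compInner : Prog :=
  block [.load 11 18 9 5, .load 13 17 9 8] ;;
    .ite (.eq 11 6) (block []) (.ite (.eq 13 6) (block [.inc 12]) (block []))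

def compBody : Prog := block [.const 12 0] ;; forLoop 9 0 0 compInner ;; block [.store 4 8 5 12]

/-- From the reachability relation in array `17`, mark in array `18` the vertices that are not the
least of their component, count the components in register `4`, and number the component of `x` in
array `4` by the number of components from which `x` can be reached. -/
def compProg : Prog :=
  block [.const 4 0] ;; forLoop 8 0 0 (forLoop 9 0 0 repBody) ;; forLoop 8 0 0 ellBody ;;
    forLoop 8 0 0 compBody

theorem wp_repBody {s : Memory} (h0 : s.reg 5 = 0) (h1 : s.reg 6 = 1) :
    wp repBody s fun t s' => t ≤ 12 * 1 ∧ ∀ x, s'.arr 18 x 0 = 1 ↔ s.arr 18 x 0 = 1 ∨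
      x = s.reg 8 ∧ s.reg 9 < x ∧ s.arr 17 x (s.reg 9) = 1 ∧ s.arr 17 (s.reg 9) x = 1 := by
  simp [repBody, wp_seq_iff, wp_ite_iff, wp_block_cons, wp_block_nil, Instr.effect,
    Test.Holds, h0, h1]
  grind

theorem wp_ellBody {s : Memory} (h0 : s.reg 5 = 0) (h1 : s.reg 6 = 1) :
    wp ellBody s fun t s' => t ≤ 12 * 1 ∧ s'.reg 4 = s.reg 4 +
      if ¬ s.arr 18 (s.reg 8) 0 = 1 then 1 else 0 := by
  simp [ellBody, wp_seq_iff, wp_ite_iff, wp_block_cons, wp_block_nil, Instr.effect,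
    Test.Holds, h0, h1]

theorem wp_compInner {s : Memory} (h0 : s.reg 5 = 0) (h1 : s.reg 6 = 1) :
    wp compInner s fun t s' => t ≤ 12 * 1 ∧ s'.reg 12 = s.reg 12 +
      if ¬ s.arr 18 (s.reg 9) 0 = 1 ∧ s.arr 17 (s.reg 9) (s.reg 8) = 1 then 1 else 0 := by
  simp [compInner, wp_seq_iff, wp_ite_iff, wp_block_cons, wp_block_nil, Instr.effect,
    Test.Holds, h0, h1]
  grind

open Classical in
theorem wp_compBody {s : Memory} {M : ℕ} (hM : 1 ≤ M) (hn : s.reg 0 ≤ M) (h0 : s.reg 5 = 0)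
    (h1 : s.reg 6 = 1) :
    wp compBody s fun t s' => t ≤ 25 * M ^ 1 ∧ ∀ x, s'.arr 4 x 0 = if x = s.reg 8 then
      Nat.count (fun y => ¬ s.arr 18 y 0 = 1 ∧ s.arr 17 y x = 1) (s.reg 0) else s.arr 4 x 0 := by
  refine wp_seq (wp_block (wp_seq ?_))
  refine wp_forLoop (fun i s' => s'.reg 12 =
    Nat.count (fun y => ¬ s.arr 18 y 0 = 1 ∧ s.arr 17 y (s.reg 8) = 1) i) 12 0 M hn hM
    (Nat.zero_le _) rfl ?_ ?_ ?_
  · simp [Instr.effect]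
  · intro i s' _ hi hfr hki hI
    have e5 : s'.reg 5 = 0 := (hfr.reg 5 rfl).trans h0
    have e6 : s'.reg 6 = 1 := (hfr.reg 6 rfl).trans h1
    have e8 : s'.reg 8 = s.reg 8 := hfr.reg 8 rfl
    have a18 : s'.arr 18 = s.arr 18 := hfr.arr 18 rfl
    have a17 : s'.arr 17 = s.arr 17 := hfr.arr 17 rfl
    refine wp_mono (wp_compInner e5 e6) fun t s'' ⟨h1, h2⟩ => ⟨h1, ?_⟩
    simp only [Memory.reg_setReg, Nat.reduceEqDiff, if_false]
    rw [h2, hI, Nat.count_succ, hki, e8, a18, a17]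
  · intro t s' hfr ht hI
    have e5 : s'.reg 5 = 0 := (hfr.reg 5 rfl).trans h0
    have e8 : s'.reg 8 = s.reg 8 := hfr.reg 8 rfl
    have e4 : s'.arr 4 = s.arr 4 := hfr.arr 4 rfl
    simp [wp_block_cons, wp_block_nil, Instr.effect, e5, e8, e4]
    refine ⟨?_, fun x => ?_⟩
    · simp at ht; omega
    · split_ifs with hx
      · subst hx; exact hI
      · rfl

open Classical in
theorem wp_compProg {s : Memory} {M : ℕ} (hM : 1 ≤ M) (hn : s.reg 0 ≤ M) (h0 : s.reg 5 = 0)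
    (h1 : s.reg 6 = 1) (h18 : ∀ x, s.arr 18 x 0 = 0) :
    wp compProg s fun t s' => t ≤ 80 * M ^ 3 ∧ Frame compProg s s' ∧
      s'.reg 4 = Nat.count (fun x => ¬ ∃ y < x, s.arr 17 x y = 1 ∧ s.arr 17 y x = 1) (s.reg 0) ∧
      ∀ x < s.reg 0, s'.arr 4 x 0 = Nat.count (fun z => (¬ ∃ y < z, s.arr 17 z y = 1 ∧
        s.arr 17 y z = 1) ∧ s.arr 17 z x = 1) (s.reg 0) := by
  refine wp_frame (Q := fun t s' => t ≤ 80 * M ^ 3 ∧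
      s'.reg 4 = Nat.count (fun x => ¬ ∃ y < x, s.arr 17 x y = 1 ∧ s.arr 17 y x = 1) (s.reg 0) ∧
      ∀ x < s.reg 0, s'.arr 4 x 0 = Nat.count (fun z => (¬ ∃ y < z, s.arr 17 z y = 1 ∧
        s.arr 17 y z = 1) ∧ s.arr 17 z x = 1) (s.reg 0)) ?_
    (fun t s' h1 h2 => ⟨h2.1, h1, h2.2⟩)
  set n := s.reg 0 with hnn
  have count_congr : ∀ (p q : ℕ → Prop) [DecidablePred p] [DecidablePred q] (m : ℕ),
      (∀ i < m, p i ↔ q i) → Nat.count p m = Nat.count q m := by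
    intro p q _ _ m h
    rw [Nat.count_eq_card_filter_range, Nat.count_eq_card_filter_range]
    congr 1
    exact Finset.filter_congr fun i hi => h i (Finset.mem_range.mp hi)
  refine wp_seq (wp_block (wp_seq ?_))
  refine wp_forSet₂ (fun D s' => ∀ x, s'.arr 18 x 0 = 1 ↔ ∃ y, (x, y) ∈ D ∧ y < x ∧
    s.arr 17 x y = 1 ∧ s.arr 17 y x = 1) 12 0 M hn hn hM rfl (fun _ _ _ h => h)
    (fun _ _ _ h => h) ?_ ?_ ?_
  · simp [Instr.effect, h18]
  · intro i j D s' hi hj hD hfr hki hlj hI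
    have e5 : s'.reg 5 = 0 := (hfr.reg 5 rfl).trans h0
    have e6 : s'.reg 6 = 1 := (hfr.reg 6 rfl).trans h1
    have a17 : s'.arr 17 = s.arr 17 := hfr.arr 17 rfl
    refine wp_mono (wp_repBody e5 e6) fun t s'' ⟨h1, h2⟩ => ⟨h1, fun x => ?_⟩
    rw [h2, hI, hki, hlj, a17]
    simp only [Set.mem_insert_iff, Prod.mk.injEq]
    constructor
    · rintro (⟨y, h3, h4⟩ | ⟨rfl, h3⟩)
      · exact ⟨y, Or.inr h3, h4⟩
      · exact ⟨j, Or.inl ⟨rfl, rfl⟩, h3⟩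
    · rintro ⟨y, ⟨rfl, rfl⟩ | h3, h4⟩
      · exact Or.inr ⟨rfl, h4⟩
      · exact Or.inl ⟨y, h3, h4⟩
  · intro t1 s1 hfr1 ht1 hI1
    have e0 : s1.reg 0 = n := hfr1.reg 0 rfl
    have e4 : s1.reg 4 = 0 := hfr1.reg 4 rfl
    have e5 : s1.reg 5 = 0 := (hfr1.reg 5 rfl).trans h0
    have e6 : s1.reg 6 = 1 := (hfr1.reg 6 rfl).trans h1
    have a17 : s1.arr 17 = s.arr 17 := hfr1.arr 17 rfl
    have hrep : ∀ x < n, s1.arr 18 x 0 = 1 ↔ ∃ y < x, s.arr 17 x y = 1 ∧ s.arr 17 y x = 1 := by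
      intro x hx
      rw [hI1]
      constructor
      · rintro ⟨y, _, h⟩; exact ⟨y, h⟩
      · rintro ⟨y, hy, h⟩; exact ⟨y, ⟨hx, hy.trans hx⟩, hy, h⟩
    refine wp_seq ?_
    refine wp_forLoop (fun i s' => s'.reg 4 = Nat.count (fun x => ¬ s1.arr 18 x 0 = 1) i) 12 0 M
      (e0.trans_le hn) hM (Nat.zero_le _) rfl (by simp [e4]) ?_ ?_
    · intro i s' _ hi hfr hki hI
      have e5 : s'.reg 5 = 0 := (hfr.reg 5 rfl).trans e5
      have e6 : s'.reg 6 = 1 := (hfr.reg 6 rfl).trans e6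
      have a18 : s'.arr 18 = s1.arr 18 := hfr.arr 18 rfl
      refine wp_mono (wp_ellBody e5 e6) fun t s'' ⟨h1, h2⟩ => ⟨h1, ?_⟩
      simp only [Memory.reg_setReg, Nat.reduceEqDiff, if_false]
      rw [h2, hI, Nat.count_succ, hki, a18]
    · intro t2 s2 hfr2 ht2 hI2
      have f0 : s2.reg 0 = n := (hfr2.reg 0 rfl).trans e0
      have f5 : s2.reg 5 = 0 := (hfr2.reg 5 rfl).trans e5
      have f6 : s2.reg 6 = 1 := (hfr2.reg 6 rfl).trans e6
      have b17 : s2.arr 17 = s.arr 17 := (hfr2.arr 17 rfl).trans a17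
      have b18 : s2.arr 18 = s1.arr 18 := hfr2.arr 18 rfl
      refine wp_forLoop (fun i s' => ∀ x < i, s'.arr 4 x 0 = Nat.count
        (fun y => ¬ s1.arr 18 y 0 = 1 ∧ s.arr 17 y x = 1) n) 25 1 M
        (f0.trans_le hn) hM (Nat.zero_le _) rfl (by simp) ?_ ?_
      · intro i s' _ hi hfr hki hI
        have g0 : s'.reg 0 = n := (hfr.reg 0 rfl).trans f0
        have g5 : s'.reg 5 = 0 := (hfr.reg 5 rfl).trans f5
        have g6 : s'.reg 6 = 1 := (hfr.reg 6 rfl).trans f6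
        have c17 : s'.arr 17 = s.arr 17 := (hfr.arr 17 rfl).trans b17
        have c18 : s'.arr 18 = s1.arr 18 := (hfr.arr 18 rfl).trans b18
        refine wp_mono (wp_compBody hM (g0.trans_le hn) g5 g6) fun t s'' ⟨h1, h2⟩ =>
          ⟨h1, fun x hx => ?_⟩
        rw [Memory.arr_setReg, h2, hki, g0, c17, c18]
        split_ifs with hxi
        · rfl
        · exact hI x (by omega)
      · intro t3 s3 hfr3 ht3 hI3
        refine ⟨?_, ?_, fun x hx => ?_⟩
        · have := le_mul_pow (d := 3) _ hM (by norm_num) ht1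
          have := le_mul_pow (d := 3) _ hM (by norm_num) ht2
          have := le_mul_pow (d := 3) _ hM (by norm_num) ht3
          have : 1 ≤ M ^ 3 := Nat.one_le_pow _ _ hM
          simp only [List.length_cons, List.length_nil]
          omega
        · rw [hfr3.reg 4 rfl, hI2, e0]
          exact count_congr _ _ _ fun i hi => by rw [hrep i hi]
        · rw [hI3 x (f0 ▸ hx)]
          exact count_congr _ _ _ fun i hi => by rw [hrep i hi]

/-! ### The numbers of the components of a line graph -/

namespace StructuredSystem

variable {n m p : ℕ} (S : StructuredSystem n m p)

/-- `x` is the least vertex of its component. -/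
def IsRep (x : Fin n) : Prop :=
  ¬ ∃ y < x, Relation.ReflTransGen S.Edge x y ∧ Relation.ReflTransGen S.Edge y x

/-- The position in the line graph of the component of each vertex. -/
structure IsPosition (ℓ : ℕ) (f : Fin n → ℕ) : Prop where
  mem : ∀ x, f x ∈ Set.Icc 1 ℓ
  surj : ∀ k ∈ Set.Icc 1 ℓ, ∃ x, f x = k
  reach : ∀ x y, Relation.ReflTransGen S.Edge x y ↔ f x ≤ f y

variable {S}

/-- An edge between different components raises the position by exactly one, so reachability cannot
decrease the position. Conversely, consecutive components are joined by an edge and each component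
is strongly connected. -/
theorem IsLineOrder.exists_position {ℓ : ℕ} {𝒞 : ℕ → Set (Fin n)} (h : S.IsLineOrder ℓ 𝒞) :
    ∃ f, S.IsPosition ℓ f ∧ ∀ k ∈ Set.Icc 1 ℓ, ∀ x, x ∈ 𝒞 k ↔ f x = k := by
  have hmem : ∀ x, ∃ k ∈ Set.Icc 1 ℓ, x ∈ 𝒞 k := fun x => by
    obtain ⟨k, hk, e⟩ := h.surj _ ⟨x, rfl⟩
    exact ⟨k, hk, by rw [e]; exact ⟨.refl, .refl⟩⟩
  choose f hf hfx using hmem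
  have hstrong : ∀ k ∈ Set.Icc 1 ℓ, ∀ x ∈ 𝒞 k, ∀ y ∈ 𝒞 k, Relation.ReflTransGen S.Edge x y := by
    intro k hk x hx y hy
    obtain ⟨z, hz⟩ := h.scc k hk
    rw [hz] at hx hy
    exact hx.2.trans hy.1
  have huniq : ∀ k ∈ Set.Icc 1 ℓ, ∀ x ∈ 𝒞 k, f x = k := by
    intro k hk x hx
    refine h.inj (hf x) hk ?_
    ext y
    obtain ⟨z, hz⟩ := h.scc k hk
    obtain ⟨w, hw⟩ := h.scc _ (hf x)
    have h1 := hfx x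
    rw [hw] at h1 ⊢
    rw [hz] at hx ⊢
    exact ⟨fun h2 => ⟨(hx.1.trans h1.2).trans h2.1, (h2.2.trans h1.1).trans hx.2⟩,
      fun h2 => ⟨(h1.1.trans hx.2).trans h2.1, (h2.2.trans hx.1).trans h1.2⟩⟩
  have hiff : ∀ k ∈ Set.Icc 1 ℓ, ∀ x, x ∈ 𝒞 k ↔ f x = k :=
    fun k hk x => ⟨huniq k hk x, fun e => e ▸ hfx x⟩
  have hsurj : ∀ k ∈ Set.Icc 1 ℓ, ∃ x, f x = k := by
    intro k hk
    obtain ⟨z, hz⟩ := h.scc k hk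
    exact ⟨z, huniq k hk z (by rw [hz]; exact ⟨.refl, .refl⟩)⟩
  refine ⟨f, ⟨hf, hsurj, fun x y => ⟨fun hxy => ?_, fun hxy => ?_⟩⟩, hiff⟩
  · induction hxy with
    | refl => exact le_rfl
    | tail _ he ih =>
      rename_i a b _
      by_cases hab : f a = f b
      · omega
      · have := (h.path _ (hf a) _ (hf b) hab).mp ⟨a, hfx a, b, hfx b, he⟩
        omega
  · obtain ⟨d, hd⟩ := Nat.exists_eq_add_of_le hxy
    induction d generalizing x with
    | zero => exact hstrong _ (hf x) _ (hfx x) _ ((hiff _ (hf x) y).mpr hd)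
    | succ d ih =>
      have hk : f x + 1 ∈ Set.Icc 1 ℓ := ⟨by omega, by have := (hf y).2; omega⟩
      obtain ⟨a, ha, b, hb, he⟩ := (h.path _ (hf x) _ hk (by omega)).mpr rfl
      have hb' := huniq _ hk b hb
      exact (hstrong _ (hf x) _ (hfx x) _ ha).trans
        ((Relation.ReflTransGen.single he).trans (ih b (by omega) (by omega)))

theorem IsPosition.eq_iff {ℓ : ℕ} {f : Fin n → ℕ} (h : S.IsPosition ℓ f) (x y : Fin n) :
    f x = f y ↔ Relation.ReflTransGen S.Edge x y ∧ Relation.ReflTransGen S.Edge y x := by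
  rw [h.reach, h.reach]; omega

open Classical in
-- The position maps the representatives counted here bijectively onto `1, …, k`: every component
-- has exactly one least vertex.
theorem IsPosition.card_le {ℓ : ℕ} {f : Fin n → ℕ} (h : S.IsPosition ℓ f) {k : ℕ} (hk : k ≤ ℓ) :
    (Finset.univ.filter fun y => S.IsRep y ∧ f y ≤ k).card = k := by
  conv_rhs => rw [← Nat.add_sub_cancel k 1, ← Nat.card_Icc]
  refine Finset.card_bij (fun y _ => f y) ?_ ?_ ?_
  · intro y hy
    simp only [Finset.mem_filter, Finset.mem_univ, true_and] at hy
    exact Finset.mem_Icc.mpr ⟨(h.mem y).1, hy.2⟩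
  · intro x hx y hy e
    simp only [Finset.mem_filter, Finset.mem_univ, true_and] at hx hy
    rw [h.eq_iff] at e
    rcases lt_trichotomy x y with h1 | h1 | h1
    · exact absurd ⟨x, h1, e.2, e.1⟩ hy.1
    · exact h1
    · exact absurd ⟨y, h1, e.1, e.2⟩ hx.1
  · intro j hj
    rw [Finset.mem_Icc] at hj
    have hne : (Finset.univ.filter fun y => f y = j).Nonempty := by
      obtain ⟨x, hx⟩ := h.surj j ⟨hj.1, hj.2.trans hk⟩
      exact ⟨x, by simpa using hx⟩
    refine ⟨_, ?_, (Finset.mem_filter.mp (Finset.min'_mem _ hne)).2⟩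
    have hfj := (Finset.mem_filter.mp (Finset.min'_mem _ hne)).2
    simp only [Finset.mem_filter, Finset.mem_univ, true_and]
    refine ⟨?_, hfj.trans_le hj.2⟩
    rintro ⟨y, hy, h1⟩
    rw [← h.eq_iff] at h1
    exact absurd (Finset.min'_le _ y (by simp [← h1, hfj])) (not_le.mpr hy)

open Classical in
theorem IsPosition.card_eq {ℓ : ℕ} {f : Fin n → ℕ} (h : S.IsPosition ℓ f) :
    (Finset.univ.filter fun y => S.IsRep y).card = ℓ := by
  rw [← h.card_le le_rfl]
  congr 1
  exact Finset.filter_congr fun y _ => by simp [(h.mem y).2]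

open Classical in
-- The components that reach `x` are those at positions up to `f x`. This formula expresses the
-- position through reachability alone, and it is what the program evaluates.
theorem IsPosition.card_reach {ℓ : ℕ} {f : Fin n → ℕ} (h : S.IsPosition ℓ f) (x : Fin n) :
    (Finset.univ.filter fun y => S.IsRep y ∧ Relation.ReflTransGen S.Edge y x).card = f x := by
  rw [← h.card_le (h.mem x).2]
  congr 1
  exact Finset.filter_congr fun y _ => by rw [h.reach]

theorem IsPosition.le {ℓ : ℕ} {f : Fin n → ℕ} (h : S.IsPosition ℓ f) : ℓ ≤ n := by
  classical
  rw [← h.card_eq]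
  exact (Finset.card_filter_le _ _).trans (by simp)

/-- The line graph determines the positions. -/
theorem IsPosition.unique {ℓ ℓ' : ℕ} {f f' : Fin n → ℕ} (h : S.IsPosition ℓ f)
    (h' : S.IsPosition ℓ' f') : ℓ' = ℓ ∧ f' = f := by
  classical
  refine ⟨?_, ?_⟩
  · rw [← h.card_eq, ← h'.card_eq]
  · funext x
    rw [← h.card_reach, ← h'.card_reach]

end StructuredSystem

theorem count_eq_card_fin (n : ℕ) (q : ℕ → Prop) (q' : Fin n → Prop) [DecidablePred q]
    [DecidablePred q'] (h : ∀ x : Fin n, q x ↔ q' x) :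
    Nat.count q n = (Finset.univ.filter q').card := by
  rw [Nat.count_eq_card_filter_range]
  symm
  refine Finset.card_bij (fun x _ => (x : ℕ)) ?_ ?_ ?_
  · intro x hx; simpa [h] using hx
  · intro x _ y _ e; exact Fin.ext e
  · intro i hi
    simp only [Finset.mem_filter, Finset.mem_range] at hi
    exact ⟨⟨i, hi.1⟩, by simpa [← h] using hi.2, rfl⟩

end

/-! ## The sets of inputs and outputs of the components -/

/-- For all `k ≤ ℓ`, `r < n` and `i` below the content of a register. -/
def sweep (bd : ℕ) (f : Prog) : Prog := forLoop 10 0 14 (forLoop 8 0 0 (forLoop 9 0 bd f))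

/-- Common analysis of the four tables: `C k r i` says that state `r` puts `i` into the `k`-th set.
Marks are only ever added, so the order of the triples is irrelevant. -/
theorem wp_sweep {f : Prog} {dst bd : ℕ} {s : Memory} {M : ℕ} (hM : 1 ≤ M) (hn : s.reg 0 ≤ M)
    (hb : s.reg bd ≤ M) (hl : s.reg 14 ≤ M)
    (hmod : (bd == 8 || bd == 9 || bd == 10 || f.any (Instr.modReg 8) || f.any (Instr.modReg 9) ||
      f.any (Instr.modReg 10) || f.any (Instr.modReg 14) || f.any (Instr.modReg 0) ||
      f.any (Instr.modReg bd)) = false)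
    (h0 : ∀ k i, s.arr dst k i = 0) (C : ℕ → ℕ → ℕ → Prop)
    (hf : ∀ s', Frame (sweep bd f) s s' → wp f s' fun t s'' => t ≤ 12 * 1 ∧ ∀ k i,
      s''.arr dst k i = 1 ↔ s'.arr dst k i = 1 ∨ (k = s'.reg 10 ∧ i = s'.reg 9) ∧
        C (s'.reg 10) (s'.reg 8) (s'.reg 9)) :
    wp (sweep bd f) s fun t s' => t ≤ 24 * M ^ 3 ∧ ∀ k < s.reg 14, ∀ i < s.reg bd,
      s'.arr dst k i = 1 ↔ ∃ r < s.reg 0, C k r i := by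
  simp only [Bool.or_eq_false_iff, beq_eq_false_iff_ne, ne_eq] at hmod
  obtain ⟨⟨⟨⟨⟨⟨⟨⟨m1, m2⟩, m3⟩, m4⟩, m5⟩, m6⟩, m7⟩, m8⟩, m9⟩ := hmod
  have hb8 : (8 == bd) = false := by simpa using fun h => m1 h.symm
  have hb9 : (9 == bd) = false := by simpa using fun h => m2 h.symm
  refine wp_forSet (fun D s' => ∀ k i, s'.arr dst k i = 1 ↔ k ∈ D ∧ i < s.reg bd ∧
    ∃ r < s.reg 0, C k r i) 20 2 M hl hM ?_ (fun _ _ _ h => h) (by simp [h0]) ?_ ?_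
  · simp [forLoop, Prog.any, Instr.modReg, m7, m6]
  · intro k D s1 hk hkD hfr hk10 hI
    have e0 : s1.reg 0 = s.reg 0 := hfr.reg 0 (by simp [forLoop, Prog.any, Instr.modReg, m8])
    have eb : s1.reg bd = s.reg bd :=
      hfr.reg bd (by simp [forLoop, Prog.any, Instr.modReg, m1, m2, m3, m9])
    refine wp_forSet₂ (fun D' s' => ∀ k' i, s'.arr dst k' i = 1 ↔ (k' ∈ D ∧ i < s.reg bd ∧
      ∃ r < s.reg 0, C k' r i) ∨ k' = k ∧ ∃ r, (r, i) ∈ D' ∧ C k' r i) 12 0 M (e0.trans_le hn)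
      (eb.trans_le hb) hM ?_ (fun _ _ _ h => h) (fun _ _ _ h => h) (by simpa using hI) ?_ ?_
    · simp [m1, m2, m4, m5, m8, m9]
    · intro r i D' s2 hr hi hD' hfr2 hr8 hi9 hI2
      have hfr' : Frame (sweep bd f) s s2 := hfr.trans (hfr2.mono fun q hq => by
        simp only [forLoop, Prog.any] at hq ⊢; simp_all)
      have e10 : s2.reg 10 = k := (hfr2.reg 10 (by
        simp [forLoop, Prog.any, Instr.modReg, m6])).trans hk10
      refine wp_mono (hf s2 hfr') fun t s3 ⟨h1, h2⟩ => ⟨h1, fun k' i' => ?_⟩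
      rw [h2, hI2, e10, hr8, hi9]
      simp only [Set.mem_insert_iff, Prod.mk.injEq]
      constructor
      · rintro ((h | ⟨h3, r', h4, h5⟩) | ⟨⟨rfl, rfl⟩, h4⟩)
        · exact Or.inl h
        · exact Or.inr ⟨h3, r', Or.inr h4, h5⟩
        · exact Or.inr ⟨rfl, r, Or.inl ⟨rfl, rfl⟩, h4⟩
      · rintro (h | ⟨h3, r', ⟨rfl, rfl⟩ | h4, h5⟩)
        · exact Or.inl (Or.inl h)
        · exact Or.inr ⟨⟨h3, rfl⟩, h3 ▸ h5⟩
        · exact Or.inl (Or.inr ⟨h3, r', h4, h5⟩)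
    · intro t s2 _ ht hI2
      refine ⟨ht, fun k' i => ?_⟩
      rw [hI2, e0, eb]
      simp only [Set.mem_insert_iff, Set.mem_ofPred_eq]
      constructor
      · rintro (⟨h1, h2⟩ | ⟨rfl, r, ⟨h1, h2⟩, h3⟩)
        · exact ⟨Or.inr h1, h2⟩
        · exact ⟨Or.inl rfl, h2, r, h1, h3⟩
      · rintro ⟨rfl | h1, h2, r, h3, h4⟩
        · exact Or.inr ⟨rfl, r, ⟨h3, h2⟩, h4⟩
        · exact Or.inl ⟨h1, h2, r, h3, h4⟩
  · intro t s' _ ht hI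
    refine ⟨ht, fun k hk i hi => ?_⟩
    rw [hI]
    exact ⟨fun h => h.2.2, fun h => ⟨hk, hi, h⟩⟩

def inputBody (b : Test) (dst : ℕ) : Prog :=
  block [.load 11 1 8 9, .load 12 4 8 5] ;;
    .ite b (.ite (.eq 11 6) (block [.store dst 10 9 6]) (block [])) (block [])

def outputBody (b : Test) (dst : ℕ) : Prog :=
  block [.load 11 2 9 8, .load 12 4 8 5] ;;
    .ite b (.ite (.eq 11 6) (block [.store dst 10 9 6]) (block [])) (block [])

/-- The sets `U k`, `Y k`, their unions, and for each input `i` the last `k` such that `i` is not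
in `U 1 ∪ ⋯ ∪ U k`. -/
def setsProg : Prog :=
  block [.copy 14 4, .inc 14] ;;
  sweep 1 (inputBody (.eq 12 10) 5) ;;
  sweep 2 (outputBody (.eq 12 10) 6) ;;
  sweep 1 (inputBody (.neg (.lt 10 12)) 7) ;;
  sweep 2 (outputBody (.neg (.lt 12 10)) 8) ;;
  -- The unions increase with `k`, so the last `k` at which membership fails is `t(i) - 1` whenever
  -- `t(i)` is defined. Tabulating it gives the dynamic program constant-time access to `W([t(i) -
  -- 1])`.
  forLoop 9 0 1 (block [.const 12 0] ;;
    forLoop 10 0 14 (block [.load 11 7 10 9] ;; .ite (.eq 11 6) (block []) (block [.copy 12 10])) ;;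
    block [.store 19 9 5 12])

/-- The result of `setsProg`. -/
structure HoldsSets (s : Memory) (n m p ℓ : ℕ) : Prop where
  U : ∀ k ≤ ℓ, ∀ i < m, s.arr 5 k i = 1 ↔ ∃ r < n, s.arr 4 r 0 = k ∧ s.arr 1 r i = 1
  Y : ∀ k ≤ ℓ, ∀ j < p, s.arr 6 k j = 1 ↔ ∃ r < n, s.arr 4 r 0 = k ∧ s.arr 2 j r = 1
  cumU : ∀ k ≤ ℓ, ∀ i < m, s.arr 7 k i = 1 ↔ ∃ r < n, s.arr 4 r 0 ≤ k ∧ s.arr 1 r i = 1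
  cumY : ∀ k ≤ ℓ, ∀ j < p, s.arr 8 k j = 1 ↔ ∃ r < n, k ≤ s.arr 4 r 0 ∧ s.arr 2 j r = 1
  last : ∀ i < m, s.arr 19 i 0 ≤ ℓ ∧ (s.arr 19 i 0 = 0 ∨ s.arr 7 (s.arr 19 i 0) i ≠ 1) ∧
    ∀ q ≤ ℓ, s.arr 19 i 0 < q → s.arr 7 q i = 1

theorem wp_setsProg {s : Memory} {M : ℕ} (hn : s.reg 0 ≤ M) (hm : s.reg 1 ≤ M)
    (hp : s.reg 2 ≤ M) (hl : s.reg 4 + 1 ≤ M) (h0 : s.reg 5 = 0) (h1 : s.reg 6 = 1)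
    (hz : ∀ a ∈ [5, 6, 7, 8], ∀ k i, s.arr a k i = 0) :
    wp setsProg s fun t s' => t ≤ 150 * M ^ 3 ∧ Frame setsProg s s' ∧ s'.reg 14 = s.reg 4 + 1 ∧
      HoldsSets s' (s.reg 0) (s.reg 1) (s.reg 2) (s.reg 4) := by
  have hM : 1 ≤ M := by omega
  refine wp_frame (Q := fun t s' => t ≤ 150 * M ^ 3 ∧ s'.reg 14 = s.reg 4 + 1 ∧
      HoldsSets s' (s.reg 0) (s.reg 1) (s.reg 2) (s.reg 4)) ?_
    (fun t s' h1 h2 => ⟨h2.1, h1, h2.2⟩)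
  refine wp_seq (wp_block (wp_seq ?_))
  set s0 := List.foldl Instr.effect s [.copy 14 4, .inc 14] with hs0
  have hr : ∀ x, x ≠ 14 → s0.reg x = s.reg x := fun x hx => by simp [hs0, Instr.effect, hx]
  have ha : s0.arr = s.arr := rfl
  have h14 : s0.reg 14 = s.reg 4 + 1 := by simp [hs0, Instr.effect]
  clear_value s0
  refine wp_frame (wp_sweep hM ((hr 0 (by simp)).trans_le hn) ((hr 1 (by simp)).trans_le hm)
    (h14.trans_le hl) rfl (dst := 5) (by simpa [ha] using hz 5 (by simp))
    (fun k r i => s.arr 4 r 0 = k ∧ s.arr 1 r i = 1) ?_) ?_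
  · intro s' hfr
    have e5 : s'.reg 5 = 0 := (hfr.reg 5 rfl).trans ((hr 5 (by simp)).trans h0)
    have e6 : s'.reg 6 = 1 := (hfr.reg 6 rfl).trans ((hr 6 (by simp)).trans h1)
    have a1 : s'.arr 1 = s.arr 1 := (hfr.arr 1 rfl).trans (by rw [ha])
    have a4 : s'.arr 4 = s.arr 4 := (hfr.arr 4 rfl).trans (by rw [ha])
    simp [inputBody, wp_seq_iff, wp_ite_iff, wp_block_cons, wp_block_nil, Instr.effect,
      Test.Holds, e5, e6, a1, a4]
    grind
  intro t1 s1 hfr1 ⟨ht1, hS1⟩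
  simp only [hr 0 (by simp), hr 1 (by simp), h14] at hS1
  have r1 : ∀ x, (sweep 1 (inputBody (.eq 12 10) 5)).any (Instr.modReg x) = false → x ≠ 14 →
      s1.reg x = s.reg x := fun x h h' => (hfr1.reg x h).trans (hr x h')
  have c1 : ∀ x, (sweep 1 (inputBody (.eq 12 10) 5)).any (Instr.modArr x) = false →
      s1.arr x = s.arr x := fun x h => (hfr1.arr x h).trans (by rw [ha])
  have b1 : s1.reg 14 = s.reg 4 + 1 := (hfr1.reg 14 rfl).trans h14
  refine wp_seq (wp_frame (wp_sweep hM ((r1 0 rfl (by simp)).trans_le hn)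
    ((r1 2 rfl (by simp)).trans_le hp)
    (b1.trans_le hl) rfl (dst := 6) (by simpa [c1 6 rfl] using hz 6 (by simp))
    (fun k r j => s.arr 4 r 0 = k ∧ s.arr 2 j r = 1) ?_) ?_)
  · intro s' hfr
    have e5 : s'.reg 5 = 0 := (hfr.reg 5 rfl).trans ((r1 5 rfl (by simp)).trans h0)
    have e6 : s'.reg 6 = 1 := (hfr.reg 6 rfl).trans ((r1 6 rfl (by simp)).trans h1)
    have a1 : s'.arr 2 = s.arr 2 := (hfr.arr 2 rfl).trans (c1 2 rfl)
    have a4 : s'.arr 4 = s.arr 4 := (hfr.arr 4 rfl).trans (c1 4 rfl)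
    simp [outputBody, wp_seq_iff, wp_ite_iff, wp_block_cons, wp_block_nil, Instr.effect,
      Test.Holds, e5, e6, a1, a4]
    grind
  intro t2 s2 hfr2 ⟨ht2, hS2⟩
  simp only [r1 0 rfl (by simp), r1 2 rfl (by simp), b1] at hS2
  have b2 : s2.reg 14 = s.reg 4 + 1 := (hfr2.reg 14 rfl).trans b1
  refine wp_seq (wp_frame (wp_sweep hM
    (((hfr2.reg 0 rfl).trans (r1 0 rfl (by simp))).trans_le hn)
    (((hfr2.reg 1 rfl).trans (r1 1 rfl (by simp))).trans_le hm)
    (b2.trans_le hl) rfl (dst := 7)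
    (by simpa [hfr2.arr 7 rfl, c1 7 rfl] using hz 7 (by simp))
    (fun k r i => s.arr 4 r 0 ≤ k ∧ s.arr 1 r i = 1) ?_) ?_)
  · intro s' hfr
    have e5 : s'.reg 5 = 0 :=
      (hfr.reg 5 rfl).trans ((hfr2.reg 5 rfl).trans ((r1 5 rfl (by simp)).trans h0))
    have e6 : s'.reg 6 = 1 :=
      (hfr.reg 6 rfl).trans ((hfr2.reg 6 rfl).trans ((r1 6 rfl (by simp)).trans h1))
    have a1 : s'.arr 1 = s.arr 1 := (hfr.arr 1 rfl).trans ((hfr2.arr 1 rfl).trans (c1 1 rfl))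
    have a4 : s'.arr 4 = s.arr 4 := (hfr.arr 4 rfl).trans ((hfr2.arr 4 rfl).trans (c1 4 rfl))
    simp [inputBody, wp_seq_iff, wp_ite_iff, wp_block_cons, wp_block_nil, Instr.effect,
      Test.Holds, e5, e6, a1, a4]
    grind
  intro t3 s3 hfr3 ⟨ht3, hS3⟩
  have r3 : ∀ x ∈ [0, 1, 2, 5, 6], s3.reg x = s.reg x := by
    intro x hx
    fin_cases hx <;> exact (hfr3.reg _ rfl).trans ((hfr2.reg _ rfl).trans (r1 _ rfl (by simp)))
  have c3 : ∀ x ∈ [1, 2, 4, 8], s3.arr x = s.arr x := by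
    intro x hx
    fin_cases hx <;> exact (hfr3.arr _ rfl).trans ((hfr2.arr _ rfl).trans (c1 _ rfl))
  have b3 : s3.reg 14 = s.reg 4 + 1 := (hfr3.reg 14 rfl).trans b2
  simp only [(hfr2.reg 0 rfl).trans (r1 0 rfl (by simp)),
    (hfr2.reg 1 rfl).trans (r1 1 rfl (by simp)), b2] at hS3
  refine wp_seq (wp_frame (wp_sweep hM ((r3 0 (by simp)).trans_le hn)
    ((r3 2 (by simp)).trans_le hp) (b3.trans_le hl) rfl (dst := 8)
    (by simpa [c3 8 (by simp)] using hz 8 (by simp))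
    (fun k r j => k ≤ s.arr 4 r 0 ∧ s.arr 2 j r = 1) ?_) ?_)
  · intro s' hfr
    have e5 : s'.reg 5 = 0 := (hfr.reg 5 rfl).trans ((r3 5 (by simp)).trans h0)
    have e6 : s'.reg 6 = 1 := (hfr.reg 6 rfl).trans ((r3 6 (by simp)).trans h1)
    have a1 : s'.arr 2 = s.arr 2 := (hfr.arr 2 rfl).trans (c3 2 (by simp))
    have a4 : s'.arr 4 = s.arr 4 := (hfr.arr 4 rfl).trans (c3 4 (by simp))
    simp [outputBody, wp_seq_iff, wp_ite_iff, wp_block_cons, wp_block_nil, Instr.effect,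
      Test.Holds, e5, e6, a1, a4]
    grind
  intro t4 s4 hfr4 ⟨ht4, hS4⟩
  simp only [r3 0 (by simp), r3 2 (by simp), b3] at hS4
  have r4 : ∀ x ∈ [0, 1, 2, 5, 6], s4.reg x = s.reg x := by
    intro x hx
    rw [← r3 x hx]
    fin_cases hx <;> exact (hfr4.reg _ rfl)
  have c4 : ∀ x ∈ [1, 2, 4], s4.arr x = s.arr x := by
    intro x hx
    rw [← c3 x (by simp at hx ⊢; omega)]
    fin_cases hx <;> exact (hfr4.arr _ rfl)
  have b4 : s4.reg 14 = s.reg 4 + 1 := (hfr4.reg 14 rfl).trans b3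
  have m4 : s4.reg 1 = s.reg 1 := r4 1 (by simp)
  refine wp_forLoop (fun i s' => ∀ x < i, s'.arr 19 x 0 ≤ s.reg 4 ∧
    (s'.arr 19 x 0 = 0 ∨ s4.arr 7 (s'.arr 19 x 0) x ≠ 1) ∧
    ∀ q ≤ s.reg 4, s'.arr 19 x 0 < q → s4.arr 7 q x = 1) 25 1 M (m4.trans_le hm) hM
    (Nat.zero_le _) rfl (by simp) ?_ ?_
  · intro i s' _ hi hfr hi9 hI
    have b5 : s'.reg 14 = s.reg 4 + 1 := (hfr.reg 14 rfl).trans b4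
    have a7 : s'.arr 7 = s4.arr 7 := hfr.arr 7 rfl
    have e5 : s'.reg 5 = 0 := (hfr.reg 5 rfl).trans ((r4 5 (by simp)).trans h0)
    have e6 : s'.reg 6 = 1 := (hfr.reg 6 rfl).trans ((r4 6 (by simp)).trans h1)
    refine wp_seq (wp_block (wp_seq ?_))
    -- The truncated subtraction makes the first clause correct for `k = 0` as well. The value `0`
    -- is allowed without a failed membership, since register 12 starts with it.
    refine wp_forLoop (fun k s'' => s''.reg 12 ≤ k - 1 ∧
      (s''.reg 12 = 0 ∨ s4.arr 7 (s''.reg 12) i ≠ 1) ∧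
      ∀ q < k, s''.reg 12 < q → s4.arr 7 q i = 1) 12 0 M (b5.trans_le hl) hM (Nat.zero_le _) rfl
      (by simp [Instr.effect]) ?_ ?_
    · intro k s'' _ hk hfr' hk10 hI'
      have e6' : s''.reg 6 = 1 := (hfr'.reg 6 rfl).trans e6
      have e9 : s''.reg 9 = i := (hfr'.reg 9 rfl).trans hi9
      have a7' : s''.arr 7 = s4.arr 7 := (hfr'.arr 7 rfl).trans a7
      simp [wp_seq_iff, wp_ite_iff, wp_block_cons, wp_block_nil, Instr.effect,
        Test.Holds, e6', a7', e9, hk10]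
      obtain ⟨g1, g2, g3⟩ := hI'
      constructor
      · intro h
        refine ⟨by omega, g2, fun q hq hq' => ?_⟩
        rcases Nat.lt_or_eq_of_le hq with h' | rfl
        · exact g3 q h' hq'
        · exact h
      · intro h
        exact ⟨Or.inr h, fun q hq hq' => absurd hq (by omega)⟩
    · intro t s'' hfr' ht hI'
      have e5' : s''.reg 5 = 0 := (hfr'.reg 5 rfl).trans e5
      have e9 : s''.reg 9 = i := (hfr'.reg 9 rfl).trans hi9
      have a19 : s''.arr 19 = s'.arr 19 := hfr'.arr 19 rfl
      have b6 : ((List.foldl Instr.effect s' [Instr.const 12 0]).reg 14) = s.reg 4 + 1 := b5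
      rw [b6] at hI'
      simp [wp_block_cons, wp_block_nil, Instr.effect, e5', e9, a19]
      simp at ht
      refine ⟨by omega, fun x hx => ?_⟩
      obtain ⟨g1, g2, g3⟩ := hI'
      split_ifs with hxi
      · subst hxi
        exact ⟨g1, g2, fun q hq hq' => g3 q (by omega) hq'⟩
      · exact hI x (by omega)
  · intro t5 s5 hfr5 ht5 hI5
    have a7 : s5.arr 7 = s4.arr 7 := hfr5.arr 7 rfl
    refine ⟨?_, (hfr5.reg 14 rfl).trans b4, ?_, ?_, ?_, ?_, ?_⟩
    · have := le_mul_pow (d := 3) _ hM (by norm_num) ht5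
      have : 1 ≤ M ^ 3 := Nat.one_le_pow _ _ hM
      simp only [List.length_cons, List.length_nil]
      omega
    · intro k hk i hi
      rw [hfr5.arr 5 rfl, hfr5.arr 4 rfl, hfr5.arr 1 rfl, c4 4 (by simp), c4 1 (by simp),
        hfr4.arr 5 rfl, hfr3.arr 5 rfl, hfr2.arr 5 rfl]
      exact hS1 k (by omega) i hi
    · intro k hk i hi
      rw [hfr5.arr 6 rfl, hfr5.arr 4 rfl, hfr5.arr 2 rfl, c4 4 (by simp), c4 2 (by simp),
        hfr4.arr 6 rfl, hfr3.arr 6 rfl]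
      exact hS2 k (by omega) i hi
    · intro k hk i hi
      rw [hfr5.arr 7 rfl, hfr5.arr 4 rfl, hfr5.arr 1 rfl, c4 4 (by simp), c4 1 (by simp),
        hfr4.arr 7 rfl]
      exact hS3 k (by omega) i hi
    · intro k hk i hi
      rw [hfr5.arr 8 rfl, hfr5.arr 4 rfl, hfr5.arr 2 rfl, c4 4 (by simp), c4 2 (by simp)]
      exact hS4 k (by omega) i hi
    · rw [m4] at hI5
      simpa only [a7] using hI5

/-! ## The stages of the dynamic program -/

/-- The cost represented by a flag for `⊤` and a real number. -/
noncomputable def flagged (f : ℕ) (r : ℝ) : WithTop ℝ := if f = 1 then ⊤ else (r : WithTop ℝ)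

namespace Memory

/-- The contents of the cost matrix. -/
noncomputable def cost (s : Memory) (i j : ℕ) : WithTop ℝ := flagged (s.arr 3 i j) (s.rarr 0 i j)

/-- The computed value of `W([k])`. -/
noncomputable def W (s : Memory) (k : ℕ) : WithTop ℝ := flagged (s.arr 9 k 0) (s.rarr 1 k 0)

/-- The value of the feedback edge `(y_j, u_i)` in the minimization. -/
noncomputable def cand (s : Memory) (i j : ℕ) : WithTop ℝ := s.cost i j + s.W (s.arr 19 i 0)

/-- The feedback edge `(y_j, u_i)` covers component `k`. -/
def Cover (s : Memory) (k i j : ℕ) : Prop := s.arr 7 k i = 1 ∧ s.arr 8 k j = 1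

/-- The best of the edges in `D`, if there is any, is stored in registers. -/
def Best (s : Memory) (k : ℕ) (D : Set (ℕ × ℕ)) : Prop :=
  (s.reg 16 = 0 ∧ ∀ i j, (i, j) ∈ D → ¬ s.Cover k i j) ∨
  (s.reg 16 = 1 ∧ s.reg 17 ≤ 1 ∧ (s.reg 18, s.reg 19) ∈ D ∧ s.Cover k (s.reg 18) (s.reg 19) ∧
    s.reg 20 = s.arr 19 (s.reg 18) 0 ∧ flagged (s.reg 17) (s.rreg 1) = s.cand (s.reg 18) (s.reg 19) ∧
    ∀ i j, (i, j) ∈ D → s.Cover k i j → flagged (s.reg 17) (s.rreg 1) ≤ s.cand i j)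

/-- Stage `k` has been carried out. -/
structure Stage (s : Memory) (m p k : ℕ) : Prop where
  lt_i : s.arr 10 k 0 < m
  lt_j : s.arr 11 k 0 < p
  cover : s.Cover k (s.arr 10 k 0) (s.arr 11 k 0)
  next : s.arr 12 k 0 = s.arr 19 (s.arr 10 k 0) 0
  flag : s.arr 9 k 0 ≤ 1
  eq : s.W k = s.cand (s.arr 10 k 0) (s.arr 11 k 0)
  min : ∀ i < m, ∀ j < p, s.Cover k i j → s.W k ≤ s.cand i j

/-- Stage `k` is unaffected by later stages: the candidates that matter refer to values of `W` at
indices below `k` (hypothesis `hlt`), and later stages write only above `k`. -/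
theorem Stage.congr {s s' : Memory} {m p k : ℕ} (h : s.Stage m p k)
    (hlt : ∀ i < m, ∀ j < p, s.Cover k i j → s.arr 19 i 0 < k)
    (ha : ∀ a ∈ [3, 7, 8, 19], s'.arr a = s.arr a) (hr : s'.rarr 0 = s.rarr 0)
    (hw : ∀ q ≤ k, ∀ a ∈ [9, 10, 11, 12], s'.arr a q 0 = s.arr a q 0)
    (hv : ∀ q ≤ k, s'.rarr 1 q 0 = s.rarr 1 q 0) : s'.Stage m p k := by
  have hW : ∀ q ≤ k, s'.W q = s.W q := fun q hq => by
    rw [W, W, hw q hq 9 (by simp), hv q hq]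
  have hc : ∀ i j, s'.Cover k i j ↔ s.Cover k i j := fun i j => by
    rw [Cover, Cover, ha 7 (by simp), ha 8 (by simp)]
  have hcand : ∀ i < m, ∀ j < p, s.Cover k i j → s'.cand i j = s.cand i j := by
    intro i hi j hj hcov
    rw [cand, cand, cost, cost, ha 3 (by simp), ha 19 (by simp), hr, hW _ (hlt i hi j hj hcov).le]
  have e10 := hw k le_rfl 10 (by simp)
  have e11 := hw k le_rfl 11 (by simp)
  refine ⟨?_, ?_, ?_, ?_, ?_, ?_, ?_⟩
  · rw [e10]; exact h.lt_i
  · rw [e11]; exact h.lt_j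
  · rw [hc, e10, e11]; exact h.cover
  · rw [e10, hw k le_rfl 12 (by simp), ha 19 (by simp)]; exact h.next
  · rw [hw k le_rfl 9 (by simp)]; exact h.flag
  · rw [hW k le_rfl, e10, e11, hcand _ h.lt_i _ h.lt_j h.cover]; exact h.eq
  · intro i hi j hj hcov
    rw [hc] at hcov
    rw [hW k le_rfl, hcand i hi j hj hcov]
    exact h.min i hi j hj hcov

end Memory

/-- The value of the edge in register `24` (flag) and real register `2`. -/
def candProg : Prog :=
  block [.load 21 3 8 9, .load 22 19 8 5, .load 23 9 22 5, .rload 2 0 8 9, .rload 3 1 22 5,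
    .radd 2 2 3, .const 24 0] ;;
  .ite (.eq 21 6) (block [.const 24 1]) (.ite (.eq 23 6) (block [.const 24 1]) (block []))

def takeProg : Prog :=
  block [.const 16 1, .copy 17 24, .rcopy 1 2, .copy 18 8, .copy 19 9, .copy 20 22]

def compareProg : Prog :=
  .ite (.eq 16 6)
    (.ite (.eq 24 6) (block []) (.ite (.eq 17 6) takeProg (.ite (.rlt 2 1) takeProg (block []))))
    takeProg

def dpBody : Prog :=
  block [.load 11 7 15 8, .load 12 8 15 9] ;;
  .ite (.eq 11 6) (.ite (.eq 12 6) (candProg ;; compareProg) (block [])) (block [])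

def stageEnd : Prog :=
  .ite (.eq 16 6) (block []) (block [.const 3 0]) ;;
  block [.store 9 15 5 17, .rstore 1 15 5 1, .store 10 15 5 18, .store 11 15 5 19,
    .store 12 15 5 20]

def stageProg : Prog := block [.const 16 0] ;; forLoop 8 0 1 (forLoop 9 0 2 dpBody) ;; stageEnd

def dpProg : Prog := block [.const 3 1] ;; forLoop 15 1 14 stageProg

theorem wp_candProg {s : Memory} (h0 : s.reg 5 = 0) (h1 : s.reg 6 = 1) :
    wp candProg s fun t s' => t ≤ 15 ∧ flagged (s'.reg 24) (s'.rreg 2) =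
      s.cand (s.reg 8) (s.reg 9) ∧ s'.reg 24 ≤ 1 ∧ s'.reg 22 = s.arr 19 (s.reg 8) 0 := by
  simp [candProg, wp_seq_iff, wp_ite_iff, wp_block_cons, wp_block_nil, Instr.effect,
    Test.Holds, h0, h1, flagged, Memory.cand, Memory.cost, Memory.W]
  split_ifs <;> simp_all

theorem wp_takeProg {s : Memory} :
    wp takeProg s fun t s' => t ≤ 7 ∧ s'.reg 16 = 1 ∧ s'.reg 17 = s.reg 24 ∧ s'.rreg 1 = s.rreg 2 ∧
      s'.reg 18 = s.reg 8 ∧ s'.reg 19 = s.reg 9 ∧ s'.reg 20 = s.reg 22 := by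
  simp [takeProg, wp_block_cons, wp_block_nil, Instr.effect]

/-- The flags are consulted before the reals: an infinite candidate never replaces an incumbent, and
a finite one always replaces an infinite incumbent. On ties the incumbent stays. -/
theorem wp_compareProg {s : Memory} (h1 : s.reg 6 = 1) :
    wp compareProg s fun t s' => t ≤ 15 ∧
      (((s.reg 16 ≠ 1 ∨ flagged (s.reg 24) (s.rreg 2) < flagged (s.reg 17) (s.rreg 1)) ∧
        s'.reg 16 = 1 ∧ s'.reg 17 = s.reg 24 ∧ s'.rreg 1 = s.rreg 2 ∧
        s'.reg 18 = s.reg 8 ∧ s'.reg 19 = s.reg 9 ∧ s'.reg 20 = s.reg 22) ∨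
      (s.reg 16 = 1 ∧ flagged (s.reg 17) (s.rreg 1) ≤ flagged (s.reg 24) (s.rreg 2) ∧
        s'.reg = s.reg ∧ s'.rreg = s.rreg)) := by
  refine wp_ite (fun hf => wp_ite (fun ht => ?_) (fun ht => wp_ite (fun hu => ?_)
    (fun hu => wp_ite (fun hv => ?_) (fun hv => ?_)))) (fun hf => ?_)
  all_goals simp only [Test.Holds, h1] at *
  · rw [wp_block_nil]
    exact ⟨by omega, Or.inr ⟨hf, by simp [flagged, ht], rfl, rfl⟩⟩
  · refine wp_mono wp_takeProg fun t s' ⟨h, h'⟩ => ⟨by omega, Or.inl ⟨Or.inr ?_, h'⟩⟩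
    simp [flagged, ht, hu]
  · refine wp_mono wp_takeProg fun t s' ⟨h, h'⟩ => ⟨by omega, Or.inl ⟨Or.inr ?_, h'⟩⟩
    simp [flagged, ht, hu, hv]
  · rw [wp_block_nil]
    refine ⟨by omega, Or.inr ⟨hf, ?_, rfl, rfl⟩⟩
    simp [flagged, ht, hu, not_lt.mp hv]
  · exact wp_mono wp_takeProg fun t s' ⟨h, h'⟩ => ⟨by omega, Or.inl ⟨Or.inl hf, h'⟩⟩

theorem wp_dpBody {s : Memory} (h0 : s.reg 5 = 0) (h1 : s.reg 6 = 1) {D : Set (ℕ × ℕ)}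
    (hB : s.Best (s.reg 15) D) (h17 : s.reg 17 ≤ 1) :
    wp dpBody s fun t s' => t ≤ 40 * 1 ∧ s'.Best (s.reg 15) (insert (s.reg 8, s.reg 9) D) ∧
      s'.reg 17 ≤ 1 := by
  -- There are three outcomes: the pair does not cover the component, it becomes the new best edge,
  -- or it loses against the present one.
  refine wp_frame (Q := fun t s' => t ≤ 40 ∧ s'.reg 17 ≤ 1 ∧
    ((¬ s.Cover (s.reg 15) (s.reg 8) (s.reg 9) ∧ (∀ x ∈ [16, 17, 18, 19, 20], s'.reg x = s.reg x) ∧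
        s'.rreg 1 = s.rreg 1) ∨
      (s.Cover (s.reg 15) (s.reg 8) (s.reg 9) ∧
        (s.reg 16 ≠ 1 ∨ s.cand (s.reg 8) (s.reg 9) < flagged (s.reg 17) (s.rreg 1)) ∧
        s'.reg 16 = 1 ∧ flagged (s'.reg 17) (s'.rreg 1) = s.cand (s.reg 8) (s.reg 9) ∧
        s'.reg 18 = s.reg 8 ∧ s'.reg 19 = s.reg 9 ∧ s'.reg 20 = s.arr 19 (s.reg 8) 0) ∨
      (s.Cover (s.reg 15) (s.reg 8) (s.reg 9) ∧ s.reg 16 = 1 ∧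
        flagged (s.reg 17) (s.rreg 1) ≤ s.cand (s.reg 8) (s.reg 9) ∧
        (∀ x ∈ [16, 17, 18, 19, 20], s'.reg x = s.reg x) ∧ s'.rreg 1 = s.rreg 1))) ?_ ?_
  · simp only [dpBody, wp_seq_iff, wp_block_cons, wp_block_nil]
    set s1 := Instr.effect (Instr.effect s (.load 11 7 15 8)) (.load 12 8 15 9) with hs1
    have hr : ∀ x, x ≠ 11 → x ≠ 12 → s1.reg x = s.reg x := fun x h h' => by
      simp [hs1, Instr.effect, h, h']
    have ha : s1.arr = s.arr := rfl
    have hra : s1.rarr = s.rarr := rfl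
    have hrr : s1.rreg = s.rreg := rfl
    have e11 : s1.reg 11 = s.arr 7 (s.reg 15) (s.reg 8) := by simp [hs1, Instr.effect]
    have e12 : s1.reg 12 = s.arr 8 (s.reg 15) (s.reg 9) := by simp [hs1, Instr.effect]
    have e6 : s1.reg 6 = 1 := by simp [hr, h1]
    have e5 : s1.reg 5 = 0 := by simp [hr, h0]
    have ecand : s1.cand = s.cand := by
      funext i j
      simp [Memory.cand, Memory.cost, Memory.W, ha, hra]
    clear_value s1
    refine wp_ite (fun g1 => wp_ite (fun g2 => ?_) (fun g2 => ?_)) (fun g1 => ?_)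
    all_goals simp only [Test.Holds, e6, e11] at g1
    all_goals try simp only [Test.Holds, e6, e12] at g2
    · refine wp_seq (wp_frame (wp_candProg e5 e6) fun t2 s2 hfr ⟨k1, k2, k3, k4⟩ => ?_)
      have k17 : s2.reg 17 = s.reg 17 := (hfr.reg 17 rfl).trans (by simp [hr])
      have k16 : s2.reg 16 = s.reg 16 := (hfr.reg 16 rfl).trans (by simp [hr])
      have kr : s2.rreg 1 = s.rreg 1 := (hfr.rreg 1 rfl).trans (by rw [hrr])
      refine wp_mono (wp_compareProg ((hfr.reg 6 rfl).trans e6))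
        fun t3 s3 ⟨k5, k6⟩ => ⟨by omega, ?_⟩
      rw [k16, k2, k17, kr, ecand, hr 8 (by simp) (by simp), hr 9 (by simp) (by simp)] at k6
      rcases k6 with ⟨c0, c1, c2, c3, c4, c5, c6⟩ | ⟨c0, c1, c2, c3⟩
      · refine ⟨by omega, Or.inr (Or.inl ⟨⟨g1, g2⟩, c0, c1, ?_, ?_, ?_, ?_⟩)⟩
        · rw [c2, c3, k2, ecand, hr 8 (by simp) (by simp), hr 9 (by simp) (by simp)]
        · rw [c4, hfr.reg 8 rfl, hr 8 (by simp) (by simp)]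
        · rw [c5, hfr.reg 9 rfl, hr 9 (by simp) (by simp)]
        · rw [c6, k4, ha, hr 8 (by simp) (by simp)]
      · refine ⟨by rw [c2]; omega, Or.inr (Or.inr ⟨⟨g1, g2⟩, c0, c1, fun x hx => ?_, ?_⟩)⟩
        · rw [c2]
          fin_cases hx <;> exact (hfr.reg _ rfl).trans (hr _ (by simp) (by simp))
        · rw [c3, kr]
    · rw [wp_block_nil]
      refine ⟨by omega, by simpa [hr] using h17, Or.inl ⟨fun h => g2 h.2, fun x hx => ?_, by rw [hrr]⟩⟩
      fin_cases hx <;> exact hr _ (by simp) (by simp)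
    · rw [wp_block_nil]
      refine ⟨by omega, by simpa [hr] using h17, Or.inl ⟨fun h => g1 h.1, fun x hx => ?_, by rw [hrr]⟩⟩
      fin_cases hx <;> exact hr _ (by simp) (by simp)
  · rintro t s' hfr ⟨ht, h17', h⟩
    refine ⟨by omega, ?_, h17'⟩
    have hc : s'.Cover = s.Cover := by
      funext k i j
      simp only [Memory.Cover, hfr.arr 7 rfl, hfr.arr 8 rfl]
    have hcand : s'.cand = s.cand := by
      funext i j
      simp only [Memory.cand, Memory.cost, Memory.W, hfr.arr 19 rfl, hfr.arr 9 rfl, hfr.rarr 0 rfl,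
        hfr.rarr 1 rfl, hfr.arr 3 rfl]
    have h19 : s'.arr 19 = s.arr 19 := hfr.arr 19 rfl
    simp only [Memory.Best, hc, hcand, h19] at hB ⊢
    simp only [Set.mem_insert_iff, Prod.mk.injEq]
    rcases h with ⟨hn, hr, hrr⟩ | ⟨hy, hlt, k1, k2, k3, k4, k5⟩ | ⟨hy, k1, k2, hr, hrr⟩
    · rw [hr 16 (by simp), hr 17 (by simp), hr 18 (by simp), hr 19 (by simp), hr 20 (by simp), hrr]
      rcases hB with ⟨b1, b2⟩ | ⟨b1, b2, b3, b4, b5, b6, b7⟩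
      · refine Or.inl ⟨b1, ?_⟩
        rintro i j (⟨rfl, rfl⟩ | h)
        · exact hn
        · exact b2 i j h
      · refine Or.inr ⟨b1, b2, Or.inr b3, b4, b5, b6, ?_⟩
        rintro i j (⟨rfl, rfl⟩ | h) hc
        · exact absurd hc hn
        · exact b7 i j h hc
    · rw [k1, k2, k3, k4, k5]
      refine Or.inr ⟨rfl, h17', Or.inl ⟨rfl, rfl⟩, hy, rfl, rfl, ?_⟩
      rintro i j (⟨rfl, rfl⟩ | h) hc
      · exact le_rfl
      · rcases hB with ⟨b1, b2⟩ | ⟨b1, b2, b3, b4, b5, b6, b7⟩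
        · exact absurd hc (b2 i j h)
        · exact (hlt.resolve_left (by simp [b1])).le.trans (b7 i j h hc)
    · rw [hr 16 (by simp), hr 17 (by simp), hr 18 (by simp), hr 19 (by simp), hr 20 (by simp), hrr]
      rcases hB with ⟨b1, b2⟩ | ⟨b1, b2, b3, b4, b5, b6, b7⟩
      · omega
      · refine Or.inr ⟨b1, b2, Or.inr b3, b4, b5, b6, ?_⟩
        rintro i j (⟨rfl, rfl⟩ | h) hc
        · exact k2
        · exact b7 i j h hc

theorem wp_stageEnd {s : Memory} (h0 : s.reg 5 = 0) (h1 : s.reg 6 = 1) :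
    wp stageEnd s fun t s' => t ≤ 12 ∧ s'.reg 3 = (if s.reg 16 = 1 then s.reg 3 else 0) ∧
      (∀ q, s'.arr 9 q 0 = if q = s.reg 15 then s.reg 17 else s.arr 9 q 0) ∧
      (∀ q, s'.arr 10 q 0 = if q = s.reg 15 then s.reg 18 else s.arr 10 q 0) ∧
      (∀ q, s'.arr 11 q 0 = if q = s.reg 15 then s.reg 19 else s.arr 11 q 0) ∧
      (∀ q, s'.arr 12 q 0 = if q = s.reg 15 then s.reg 20 else s.arr 12 q 0) ∧
      (∀ q, s'.rarr 1 q 0 = if q = s.reg 15 then s.rreg 1 else s.rarr 1 q 0) := by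
  simp [stageEnd, wp_seq_iff, wp_ite_iff, wp_block_cons, wp_block_nil, Instr.effect,
    Test.Holds, h0, h1]
  constructor <;> intro h <;> simp [h]

/-- If nothing covers the component, the stage still stores what the registers happen to contain,
but it clears register 3. The flag in register 17 may thus be left over from an earlier stage, and
so its bound is passed along. -/
theorem wp_stageProg {s : Memory} {M : ℕ} (hM : 1 ≤ M) (hm : s.reg 1 ≤ M) (hp : s.reg 2 ≤ M)
    (h0 : s.reg 5 = 0) (h1 : s.reg 6 = 1) (h17 : s.reg 17 ≤ 1)
    (hlt : ∀ i < s.reg 1, ∀ j < s.reg 2, s.Cover (s.reg 15) i j → s.arr 19 i 0 < s.reg 15) :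
    wp stageProg s fun t s' => t ≤ 65 * M ^ 2 ∧ s'.reg 17 ≤ 1 ∧
      (∀ q < s.reg 15, (∀ a ∈ [9, 10, 11, 12], s'.arr a q 0 = s.arr a q 0) ∧
        s'.rarr 1 q 0 = s.rarr 1 q 0) ∧
      ((s'.reg 3 = s.reg 3 ∧ s'.Stage (s.reg 1) (s.reg 2) (s.reg 15)) ∨
        (s'.reg 3 = 0 ∧ ∀ i < s.reg 1, ∀ j < s.reg 2, ¬ s.Cover (s.reg 15) i j)) := by
  refine wp_seq (wp_block (wp_seq ?_))
  refine wp_forSet₂ (fun D s' => s'.Best (s.reg 15) D ∧ s'.reg 17 ≤ 1) 40 0 M hm hp hM rfl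
    (fun _ _ _ h => h) (fun _ _ _ h => h) ?_ ?_ ?_
  · refine ⟨Or.inl ⟨by simp [Instr.effect], by simp⟩, by simpa [Instr.effect] using h17⟩
  · intro i j D s' hi hj hD hfr hk hl hI
    have e15 : s'.reg 15 = s.reg 15 := hfr.reg 15 rfl
    have := wp_dpBody ((hfr.reg 5 rfl).trans h0) ((hfr.reg 6 rfl).trans h1) (e15 ▸ hI.1) hI.2
    rw [hk, hl, e15] at this
    exact this
  · rintro t1 s1 hfr ht ⟨hB, h17'⟩
    have e15 : s1.reg 15 = s.reg 15 := hfr.reg 15 rfl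
    have e3 : s1.reg 3 = s.reg 3 := hfr.reg 3 rfl
    refine wp_frame (wp_stageEnd ((hfr.reg 5 rfl).trans h0) ((hfr.reg 6 rfl).trans h1)) ?_
    rintro t2 s2 hfr2 ⟨ht2, f3, f9, f10, f11, f12, fr1⟩
    rw [e15] at f9 f10 f11 f12 fr1
    have hM2 : 1 ≤ M ^ 2 := Nat.one_le_pow _ _ hM
    refine ⟨?_, (hfr2.reg 17 rfl).trans_le h17', fun q hq => ⟨fun a ha => ?_, ?_⟩, ?_⟩
    · simp at ht ⊢; omega
    · fin_cases ha
      · rw [f9, if_neg hq.ne, hfr.arr 9 rfl]; rfl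
      · rw [f10, if_neg hq.ne, hfr.arr 10 rfl]; rfl
      · rw [f11, if_neg hq.ne, hfr.arr 11 rfl]; rfl
      · rw [f12, if_neg hq.ne, hfr.arr 12 rfl]; rfl
    · rw [fr1, if_neg hq.ne, hfr.rarr 1 rfl]; rfl
    · have hc1 : s1.Cover = s.Cover := by
        funext k i j
        simp only [Memory.Cover, hfr.arr 7 rfl, hfr.arr 8 rfl]
        rfl
      have hc2 : s2.Cover = s.Cover := by
        rw [← hc1]
        funext k i j
        simp only [Memory.Cover, hfr2.arr 7 rfl, hfr2.arr 8 rfl]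
      have a19 : s1.arr 19 = s.arr 19 := hfr.arr 19 rfl
      have b19 : s2.arr 19 = s1.arr 19 := hfr2.arr 19 rfl
      have hW2 : ∀ q < s.reg 15, s2.W q = s1.W q := fun q hq => by
        simp only [Memory.W, f9, fr1, if_neg hq.ne]
      have hcand : ∀ i < s.reg 1, ∀ j < s.reg 2, s.Cover (s.reg 15) i j →
          s2.cand i j = s1.cand i j := by
        intro i hi j hj hc
        rw [Memory.cand, Memory.cand, Memory.cost, Memory.cost, hfr2.arr 3 rfl, hfr2.rarr 0 rfl,
          b19, hW2 _ (by rw [a19]; exact hlt i hi j hj hc)]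
      rcases hB with ⟨b1, b2⟩ | ⟨b1, b2, b3, b4, b5, b6, b7⟩
      · refine Or.inr ⟨by rw [f3, b1]; rfl, fun i hi j hj => ?_⟩
        rw [← hc1]
        exact b2 i j ⟨hi, hj⟩
      · rw [hc1] at b4 b7
        refine Or.inl ⟨by rw [f3, b1, if_pos rfl, e3], ⟨?_, ?_, ?_, ?_, ?_, ?_, ?_⟩⟩
        · rw [f10, if_pos rfl]; exact b3.1
        · rw [f11, if_pos rfl]; exact b3.2
        · rw [f10, f11, if_pos rfl, if_pos rfl, hc2]; exact b4
        · rw [f10, f12, if_pos rfl, if_pos rfl, b19]; exact b5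
        · rw [f9, if_pos rfl]; exact h17'
        · rw [f10, f11, if_pos rfl, if_pos rfl, hcand _ b3.1 _ b3.2 b4, ← b6, Memory.W, f9, fr1,
            if_pos rfl, if_pos rfl]
        · intro i hi j hj hc
          rw [hc2] at hc
          rw [hcand i hi j hj hc, Memory.W, f9, fr1, if_pos rfl, if_pos rfl]
          exact b7 i j ⟨hi, hj⟩ hc

/-- Register 3 is never set again once it has been cleared, so a single component without covering
edges decides the outcome; the program nevertheless runs through all stages. Index `0` is not
written to, which preserves the initial value of `W`. -/
theorem wp_dpProg {s : Memory} {M ℓ : ℕ} (hl : s.reg 14 = ℓ + 1) (hlM : ℓ + 1 ≤ M)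
    (hm : s.reg 1 ≤ M) (hp : s.reg 2 ≤ M) (h0 : s.reg 5 = 0) (h1 : s.reg 6 = 1)
    (h17 : s.reg 17 ≤ 1) (hlt : ∀ k ∈ Set.Icc 1 ℓ, ∀ i < s.reg 1, ∀ j < s.reg 2,
      s.Cover k i j → s.arr 19 i 0 < k) :
    wp dpProg s fun t s' => t ≤ 75 * M ^ 3 ∧ Frame dpProg s s' ∧
      s'.arr 9 0 0 = s.arr 9 0 0 ∧ s'.arr 12 0 0 = s.arr 12 0 0 ∧ s'.rarr 1 0 0 = s.rarr 1 0 0 ∧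
      ((s'.reg 3 = 1 ∧ ∀ k ∈ Set.Icc 1 ℓ, s'.Stage (s.reg 1) (s.reg 2) k) ∨
        (s'.reg 3 = 0 ∧ ∃ k ∈ Set.Icc 1 ℓ, ∀ i < s.reg 1, ∀ j < s.reg 2, ¬ s.Cover k i j)) := by
  have hM : 1 ≤ M := by omega
  have hM3 : 1 ≤ M ^ 3 := Nat.one_le_pow _ _ hM
  refine wp_seq (wp_block ?_)
  refine wp_forLoop (fun k s' => s'.reg 17 ≤ 1 ∧
      s'.arr 9 0 0 = s.arr 9 0 0 ∧ s'.arr 12 0 0 = s.arr 12 0 0 ∧ s'.rarr 1 0 0 = s.rarr 1 0 0 ∧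
      ((s'.reg 3 = 1 ∧ ∀ q, 1 ≤ q → q < k → s'.Stage (s.reg 1) (s.reg 2) q) ∨
        (s'.reg 3 = 0 ∧ ∃ k ∈ Set.Icc 1 ℓ, ∀ i < s.reg 1, ∀ j < s.reg 2, ¬ s.Cover k i j)))
    65 2 M (hl.trans_le hlM) hM (by simp [Instr.effect, hl]) rfl ?_ ?_ ?_
  · refine ⟨h17, rfl, rfl, rfl, Or.inl ⟨by simp [Instr.effect], fun q h h' => by omega⟩⟩
  · rintro k s1 hk hkl hfr hk15 ⟨g17, g9, g12, gr, hI⟩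
    replace hkl : k < ℓ + 1 := by rw [← hl]; exact hkl
    have hkI : k ∈ Set.Icc 1 ℓ := ⟨hk, by omega⟩
    have e1 : s1.reg 1 = s.reg 1 := hfr.reg 1 rfl
    have e2 : s1.reg 2 = s.reg 2 := hfr.reg 2 rfl
    have a7 : s1.arr 7 = s.arr 7 := hfr.arr 7 rfl
    have a8 : s1.arr 8 = s.arr 8 := hfr.arr 8 rfl
    have a19 : s1.arr 19 = s.arr 19 := hfr.arr 19 rfl
    have hc : s1.Cover = s.Cover := by
      funext k i j
      simp only [Memory.Cover, a7, a8]
    refine wp_frame (wp_stageProg hM (e1.trans_le hm) (e2.trans_le hp)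
      ((hfr.reg 5 rfl).trans h0) ((hfr.reg 6 rfl).trans h1) g17 ?_) ?_
    · rw [hk15, hc, a19, e1, e2]
      exact hlt k hkI
    · rintro t s2 hfr2 ⟨ht, c17, c2, c3⟩
      rw [hk15, hc, e1, e2] at c3
      rw [hk15] at c2
      have c0 := c2 0 (by omega)
      refine ⟨ht, c17, (c0.1 9 (by simp)).trans g9, (c0.1 12 (by simp)).trans g12,
        c0.2.trans gr, ?_⟩
      have hS : ∀ {q}, s2.Stage (s.reg 1) (s.reg 2) q →
          (s2.setReg 15 (k + 1)).Stage (s.reg 1) (s.reg 2) q :=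
        fun h => ⟨h.1, h.2, h.3, h.4, h.5, h.6, h.7⟩
      rcases c3 with ⟨d1, d2⟩ | ⟨d1, d2⟩
      · rcases hI with ⟨i1, i2⟩ | ⟨i1, i2⟩
        · refine Or.inl ⟨d1.trans i1, fun q hq hq' => ?_⟩
          rcases Nat.lt_or_eq_of_le (Nat.lt_succ_iff.mp hq') with h | rfl
          · refine hS ((i2 q hq h).congr ?_ ?_ (hfr2.rarr 0 rfl)
              (fun q' hq' => (c2 q' (by omega)).1) (fun q' hq' => (c2 q' (by omega)).2))
            · rw [hc, a19]
              exact hlt q ⟨hq, by omega⟩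
            · intro a ha
              fin_cases ha <;> exact hfr2.arr _ rfl
          · exact hS d2
        · exact Or.inr ⟨d1.trans i1, i2⟩
      · exact Or.inr ⟨d1, k, hkI, d2⟩
  · rintro t s1 hfr ht ⟨_, g9, g12, gr, hI⟩
    have e14 : ((List.foldl Instr.effect s [Instr.const 3 1]).reg 14) = ℓ + 1 := hl
    rw [e14] at hI
    refine ⟨?_, ?_, g9, g12, gr, ?_⟩
    · simp at ht ⊢; omega
    · refine Frame.trans (f := dpProg) ?_ (hfr.mono fun q hq => by
        simp only [dpProg, Prog.any] at hq; simp_all)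
      exact (Frame.of_instr (.const 3 1) s).mono fun q hq => by
        simp only [dpProg, Prog.any, block] at hq; simp_all [Prog.any]
    · rcases hI with ⟨i1, i2⟩ | h
      · exact Or.inl ⟨i1, fun k hk => i2 k hk.1 (by have := hk.2; omega)⟩
      · exact Or.inr h

/-! ## Reading off the selected edges -/

/-- The edges met on the way from `k` to `0` along the links in array `12`. -/
def Memory.selected (s : Memory) (k : ℕ) : Set (ℕ × ℕ) :=
  {e | ∃ t, (fun q => s.arr 12 q 0)^[t] k ≠ 0 ∧
    e.1 = s.arr 10 ((fun q => s.arr 12 q 0)^[t] k) 0 ∧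
    e.2 = s.arr 11 ((fun q => s.arr 12 q 0)^[t] k) 0}

theorem Memory.selected_zero {s : Memory} (h : s.arr 12 0 0 = 0) : s.selected 0 = ∅ := by
  ext e
  have : ∀ t, (fun q => s.arr 12 q 0)^[t] 0 = 0 := fun t =>
    Function.iterate_fixed (f := fun q => s.arr 12 q 0) h t
  simp [selected, this]

theorem Memory.selected_eq {s : Memory} {k : ℕ} (hk : k ≠ 0) :
    s.selected k = insert (s.arr 10 k 0, s.arr 11 k 0) (s.selected (s.arr 12 k 0)) := by
  ext ⟨i, j⟩
  simp only [selected, Set.mem_ofPred_eq, Set.mem_insert_iff, Prod.mk.injEq]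
  constructor
  · rintro ⟨t, h⟩
    cases t with
    | zero => exact Or.inl h.2
    | succ t => exact Or.inr ⟨t, h⟩
  · rintro (h | ⟨t, h⟩)
    · exact ⟨0, hk, h⟩
    · exact ⟨t + 1, h⟩

def chainBody : Prog :=
  block [.load 11 10 21 5, .load 12 11 21 5, .store 13 11 12 6, .load 21 12 21 5]

/-- Mark the selected edges in array `13`. -/
def chainProg : Prog := block [.copy 21 4] ;; .loop (.neg (.eq 21 5)) chainBody

/-- The links strictly decrease, so there are at most `ℓ` rounds. Throughout, the marked edges
together with those still to be met from the current link are the edges selected from `ℓ`. -/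
theorem wp_chainProg {s : Memory} {M ℓ : ℕ} (hl : s.reg 4 = ℓ) (hlM : ℓ + 1 ≤ M)
    (h0 : s.reg 5 = 0) (h1 : s.reg 6 = 1) (h13 : ∀ i j, s.arr 13 i j = 0)
    (h12 : s.arr 12 0 0 = 0) (hlt : ∀ k ∈ Set.Icc 1 ℓ, s.arr 12 k 0 < k) :
    wp chainProg s fun t s' => t ≤ 10 * M ^ 1 ∧ Frame chainProg s s' ∧
      ∀ i j, (s'.arr 13 i j = 1 ↔ (i, j) ∈ s.selected ℓ) ∧ s'.arr 13 i j ≤ 1 := by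
  refine wp_frame (Q := fun t s' => t ≤ 10 * M ^ 1 ∧
      ∀ i j, (s'.arr 13 i j = 1 ↔ (i, j) ∈ s.selected ℓ) ∧ s'.arr 13 i j ≤ 1) ?_
      fun t s' h h' => ⟨h'.1, h, h'.2⟩
  refine wp_seq (wp_block (wp_loop (fun s' => s'.reg 21 ≤ ℓ ∧ ∀ i j,
    (((i, j) ∈ s.selected ℓ) ↔ s'.arr 13 i j = 1 ∨ (i, j) ∈ s.selected (s'.reg 21)) ∧
      s'.arr 13 i j ≤ 1)
    (fun s' => s'.reg 21) 5 ?_ ?_ ?_))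
  · simp [Instr.effect, h13, hl]
  · rintro s' hfr ⟨hle, hI⟩ hb
    have e5 : s'.reg 5 = 0 := (hfr.reg 5 rfl).trans h0
    have e6 : s'.reg 6 = 1 := (hfr.reg 6 rfl).trans h1
    have a10 : s'.arr 10 = s.arr 10 := hfr.arr 10 rfl
    have a11 : s'.arr 11 = s.arr 11 := hfr.arr 11 rfl
    have a12 : s'.arr 12 = s.arr 12 := hfr.arr 12 rfl
    simp only [Test.Holds, e5] at hb
    have hk := hlt _ ⟨Nat.one_le_iff_ne_zero.mpr hb, hle⟩
    simp [chainBody, wp_block_cons, wp_block_nil, Instr.effect, e5, e6, a10, a11, a12]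
    refine ⟨⟨by omega, fun i j => ?_⟩, hk⟩
    rw [(hI i j).1, Memory.selected_eq hb]
    simp only [Set.mem_insert_iff, Prod.mk.injEq]
    have := (hI i j).2
    split_ifs with hij
    · simp [hij]
    · simp only [hij, false_or]
      exact ⟨by tauto, this⟩
  · rintro t s' hfr ht ⟨hle, hI⟩ hb
    have e5 : s'.reg 5 = 0 := (hfr.reg 5 rfl).trans h0
    simp only [Test.Holds, e5, not_not] at hb
    constructor
    · simp [Instr.effect, hl] at ht ⊢; omega
    · intro i j
      refine ⟨?_, (hI i j).2⟩
      rw [(hI i j).1, hb, Memory.selected_zero h12]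
      simp

/-! ### Reading the input memory -/

section

variable {n m p : ℕ}

theorem tabulate_apply {α β : Type} {r c : ℕ} (d : β) (f : α → β) (Q : Matrix (Fin r) (Fin c) α)
    (i : Fin r) (j : Fin c) : tabulate d f Q i j = f (Q i j) := by
  simp [tabulate]

theorem tabulate_toNat_eq_one {r c : ℕ} (Q : Matrix (Fin r) (Fin c) Bool) (i j : ℕ) :
    tabulate 0 Bool.toNat Q i j = 1 ↔ ∃ (hi : i < r) (hj : j < c), Q ⟨i, hi⟩ ⟨j, hj⟩ = true := by
  unfold tabulate
  split_ifs with h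
  · simp [h.1, h.2]
  · simp only [false_iff]
    rintro ⟨hi, hj, _⟩
    exact h ⟨hi, hj⟩

theorem cost_inputMemory (S : StructuredSystem n m p) (P : CostMatrix m p) (i : Fin m) (j : Fin p) :
    (inputMemory S P).cost i j = P i j := by
  simp only [Memory.cost, inputMemory, tabulate_apply, flagged]
  cases h : P i j with
  | top => simp
  | coe v => simp

/-! ## The dynamic programming algorithm -/

def dpAlgorithm : Prog :=
  block [.const 6 1] ;; reachProg ;; compProg ;; setsProg ;; dpProg ;;
    .ite (.eq 3 6) chainProg (block [])

/-- What is left in memory by the dynamic program, in terms of the positions of the components. -/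
structure HoldsStages (S : StructuredSystem n m p) (P : CostMatrix m p) (ℓ : ℕ) (f : Fin n → ℕ)
    (s : Memory) : Prop where
  ell : s.reg 4 = ℓ
  comp : ∀ x : Fin n, s.arr 4 x 0 = f x
  U : ∀ k ≤ ℓ, ∀ i : Fin m, s.arr 5 k i = 1 ↔ ∃ r, f r = k ∧ S.B r i = true
  Y : ∀ k ≤ ℓ, ∀ j : Fin p, s.arr 6 k j = 1 ↔ ∃ r, f r = k ∧ S.C j r = true
  cumU : ∀ k ≤ ℓ, ∀ i : Fin m, s.arr 7 k i = 1 ↔ ∃ r, f r ≤ k ∧ S.B r i = true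
  cumY : ∀ k ≤ ℓ, ∀ j : Fin p, s.arr 8 k j = 1 ↔ ∃ r, k ≤ f r ∧ S.C j r = true
  last : ∀ i : Fin m, s.arr 19 i 0 ≤ ℓ ∧ (s.arr 19 i 0 = 0 ∨ s.arr 7 (s.arr 19 i 0) i ≠ 1) ∧
    ∀ q ≤ ℓ, s.arr 19 i 0 < q → s.arr 7 q i = 1
  cost : ∀ (i : Fin m) (j : Fin p), s.cost i j = P i j
  W_zero : s.W 0 = 0
  next_zero : s.arr 12 0 0 = 0
  flag_zero : s.arr 9 0 0 = 0
  stages : (s.reg 3 = 1 ∧ (∀ k ∈ Set.Icc 1 ℓ, s.Stage m p k) ∧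
      ∀ i j, (s.arr 13 i j = 1 ↔ (i, j) ∈ s.selected ℓ) ∧ s.arr 13 i j ≤ 1) ∨
    (s.reg 3 = 0 ∧ ∃ k ∈ Set.Icc 1 ℓ, ∀ i < m, ∀ j < p, ¬ s.Cover k i j)

theorem exists_fin_iff {q : ℕ → Prop} : (∃ r < n, q r) ↔ ∃ r : Fin n, q r :=
  ⟨fun ⟨r, h, h'⟩ => ⟨⟨r, h⟩, h'⟩, fun ⟨r, h⟩ => ⟨r, r.2, h⟩⟩

/-- The table is zero outside the matrix, so a walk that starts at a valid index never leaves the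
valid indices. -/
theorem reach_tabulate_iff (A : Matrix (Fin n) (Fin n) Bool) (x y : Fin n) :
    Relation.ReflTransGen (fun a b => tabulate 0 Bool.toNat A b a = 1) (x : ℕ) y ↔
      Relation.ReflTransGen (fun a b => A b a = true) x y := by
  constructor
  · intro h
    suffices H : ∀ z : ℕ, Relation.ReflTransGen (fun a b => tabulate 0 Bool.toNat A b a = 1) (x : ℕ) z →
        ∃ hz : z < n, Relation.ReflTransGen (fun a b => A b a = true) x ⟨z, hz⟩ from
      (H y h).2
    intro z hz
    induction hz with
    | refl => exact ⟨x.2, .refl⟩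
    | tail _ he ih =>
      obtain ⟨h1, h2, h3⟩ := (tabulate_toNat_eq_one _ _ _).mp he
      obtain ⟨h4, h5⟩ := ih
      exact ⟨h1, h5.tail h3⟩
  · intro h
    induction h with
    | refl => exact .refl
    | tail _ he ih => exact ih.tail (by simpa [tabulate_apply] using he)

theorem wp_dpAlgorithm (hn : 0 < n) (S : StructuredSystem n m p) (P : CostMatrix m p) {ℓ : ℕ}
    {f : Fin n → ℕ} (hf : S.IsPosition ℓ f) :
    wp dpAlgorithm (inputMemory S P) fun t s => t ≤ 400 * (n + m + p + 1) ^ 3 ∧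
      Frame dpAlgorithm (inputMemory S P) s ∧ s.reg 5 = 0 ∧ s.reg 6 = 1 ∧ HoldsStages S P ℓ f s := by
  classical
  -- This bounds all loop ranges, including `ℓ + 1`, because `ℓ ≤ n`. The constant 400 covers `50 +
  -- 80 + 150 + 75 + 10` for the phases and a few single steps.
  set M := n + m + p + 1 with hMdef
  have hM : 1 ≤ M := by omega
  have hM3 : 1 ≤ M ^ 3 := Nat.one_le_pow _ _ hM
  refine wp_frame (Q := fun t s => t ≤ 400 * M ^ 3 ∧ s.reg 5 = 0 ∧ s.reg 6 = 1 ∧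
    HoldsStages S P ℓ f s) ?_ fun t s h h' => ⟨h'.1, h, h'.2⟩
  refine wp_seq (wp_block (wp_seq ?_))
  set s0 := List.foldl Instr.effect (inputMemory S P) [.const 6 1] with hs0
  have r0 : s0.reg 0 = n := rfl
  have r1 : s0.reg 1 = m := rfl
  have r2 : s0.reg 2 = p := rfl
  have r5 : s0.reg 5 = 0 := rfl
  have r6 : s0.reg 6 = 1 := rfl
  have r17 : s0.reg 17 = 0 := rfl
  have a0 : s0.arr 0 = tabulate 0 Bool.toNat S.A := rfl
  have a1 : s0.arr 1 = tabulate 0 Bool.toNat S.B := rfl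
  have a2 : s0.arr 2 = tabulate 0 Bool.toNat S.C := rfl
  have az : ∀ a, 4 ≤ a → ∀ i j, s0.arr a i j = 0 := by
    intro a ha i j
    match a, ha with
    | a + 4, _ => rfl
  have hc0 : s0.cost = (inputMemory S P).cost := rfl
  have hr1 : s0.rarr 1 0 0 = 0 := rfl
  clear_value s0
  have hA : ∀ x y, s0.arr 0 x y = 1 → x < s0.reg 0 ∧ y < s0.reg 0 := by
    intro x y h
    rw [a0, tabulate_toNat_eq_one] at h
    rw [r0]
    exact ⟨h.1, h.2.1⟩
  refine wp_mono (wp_reachProg hM (by omega) r6 hA) ?_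
  rintro t1 s1 ⟨ht1, hfr1, hR⟩
  have hR' : ∀ x y : Fin n, s1.arr 17 x y = 1 ↔ Relation.ReflTransGen S.Edge x y := by
    intro x y
    rw [hR x (by rw [r0]; exact x.2) y (by rw [r0]; exact y.2), a0, reach_tabulate_iff]
    rfl
  have r10 : s1.reg 0 = n := (hfr1.reg 0 rfl).trans r0
  refine wp_seq (wp_mono (wp_compProg hM (by omega) ((hfr1.reg 5 rfl).trans r5)
    ((hfr1.reg 6 rfl).trans r6) (fun x => by rw [hfr1.arr 18 rfl]; exact az 18 (by simp) _ _)) ?_)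
  rintro t2 s2 ⟨ht2, hfr2, hl, hcomp⟩
  have hrep : ∀ x : Fin n, (¬ ∃ y < (x : ℕ), s1.arr 17 x y = 1 ∧ s1.arr 17 y x = 1) ↔ S.IsRep x := by
    intro x
    rw [StructuredSystem.IsRep, not_iff_not]
    constructor
    · rintro ⟨y, hy, h⟩
      have := hR' x ⟨y, hy.trans x.2⟩
      have := hR' ⟨y, hy.trans x.2⟩ x
      exact ⟨⟨y, hy.trans x.2⟩, hy, by simp_all⟩
    · rintro ⟨y, hy, h⟩
      exact ⟨y, hy, by rw [hR', hR']; exact h⟩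
  have hl' : s2.reg 4 = ℓ := by
    rw [hl, r10, ← hf.card_eq]
    exact count_eq_card_fin _ _ _ hrep
  have hcomp' : ∀ x : Fin n, s2.arr 4 x 0 = f x := by
    intro x
    rw [hcomp x (by rw [r10]; exact x.2), r10, ← hf.card_reach]
    exact count_eq_card_fin _ _ _ fun y => and_congr (hrep y) (hR' y x)
  have hln : ℓ ≤ n := hf.le
  have q0 : s2.reg 0 = n := (hfr2.reg 0 rfl).trans r10
  have q1 : s2.reg 1 = m := (hfr2.reg 1 rfl).trans ((hfr1.reg 1 rfl).trans r1)
  have q2 : s2.reg 2 = p := (hfr2.reg 2 rfl).trans ((hfr1.reg 2 rfl).trans r2)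
  have q5 : s2.reg 5 = 0 := (hfr2.reg 5 rfl).trans ((hfr1.reg 5 rfl).trans r5)
  have q6 : s2.reg 6 = 1 := (hfr2.reg 6 rfl).trans ((hfr1.reg 6 rfl).trans r6)
  have e2 : ∀ a, reachProg.any (Instr.modArr a) = false → compProg.any (Instr.modArr a) = false →
      s2.arr a = s0.arr a := fun a h h' => (hfr2.arr a h').trans (hfr1.arr a h)
  refine wp_seq (wp_mono (wp_setsProg (M := M) (by omega) (by omega) (by omega) (by omega) q5 q6
    ?_) ?_)
  · intro a ha k i
    fin_cases ha <;> (rw [e2 _ rfl rfl]; exact az _ (by simp) _ _)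
  rintro t3 s3 ⟨ht3, hfr3, h14, hS⟩
  rw [q0, q1, q2, hl'] at hS
  rw [hl'] at h14
  have c4 : s3.arr 4 = s2.arr 4 := hfr3.arr 4 rfl
  have c1 : s3.arr 1 = tabulate 0 Bool.toNat S.B :=
    (hfr3.arr 1 rfl).trans ((e2 1 rfl rfl).trans a1)
  have c2 : s3.arr 2 = tabulate 0 Bool.toNat S.C :=
    (hfr3.arr 2 rfl).trans ((e2 2 rfl rfl).trans a2)
  have hU : ∀ k ≤ ℓ, ∀ i : Fin m, s3.arr 5 k i = 1 ↔ ∃ r, f r = k ∧ S.B r i = true := by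
    intro k hk i
    rw [hS.U k hk i i.2, exists_fin_iff]
    simp [c4, c1, hcomp', tabulate_apply]
  have hY : ∀ k ≤ ℓ, ∀ j : Fin p, s3.arr 6 k j = 1 ↔ ∃ r, f r = k ∧ S.C j r = true := by
    intro k hk i
    rw [hS.Y k hk i i.2, exists_fin_iff]
    simp [c4, c2, hcomp', tabulate_apply]
  have hcU : ∀ k ≤ ℓ, ∀ i : Fin m, s3.arr 7 k i = 1 ↔ ∃ r, f r ≤ k ∧ S.B r i = true := by
    intro k hk i
    rw [hS.cumU k hk i i.2, exists_fin_iff]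
    simp [c4, c1, hcomp', tabulate_apply]
  have hcY : ∀ k ≤ ℓ, ∀ j : Fin p, s3.arr 8 k j = 1 ↔ ∃ r, k ≤ f r ∧ S.C j r = true := by
    intro k hk i
    rw [hS.cumY k hk i i.2, exists_fin_iff]
    simp [c4, c2, hcomp', tabulate_apply]
  have hlt : ∀ k ∈ Set.Icc 1 ℓ, ∀ i < m, ∀ j < p, s3.Cover k i j → s3.arr 19 i 0 < k := by
    rintro k hk i hi j hj ⟨hcov, _⟩
    obtain ⟨z1, z2, z3⟩ := hS.last i hi
    -- Otherwise `i`, which lies in the `k`-th union, would also lie in the larger union at the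
    -- index stored in array 19, where membership fails.
    by_contra hcon
    rcases z2 with z2 | z2
    · have := hk.1; omega
    · refine z2 ?_
      have := (hcU k hk.2 ⟨i, hi⟩).mp hcov
      obtain ⟨r, hr, hB⟩ := this
      exact (hcU _ z1 ⟨i, hi⟩).mpr ⟨r, by omega, hB⟩
  have u1 : s3.reg 1 = m := (hfr3.reg 1 rfl).trans q1
  have u2 : s3.reg 2 = p := (hfr3.reg 2 rfl).trans q2
  have u5 : s3.reg 5 = 0 := (hfr3.reg 5 rfl).trans q5
  have u6 : s3.reg 6 = 1 := (hfr3.reg 6 rfl).trans q6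
  refine wp_seq (wp_mono (wp_dpProg (M := M) h14 (by omega) (by omega) (by omega) u5 u6 ?_ ?_) ?_)
  · rw [hfr3.reg 17 rfl, hfr2.reg 17 rfl, hfr1.reg 17 rfl, r17]
    exact Nat.zero_le _
  · rw [u1, u2]; exact hlt
  rintro t4 s4 ⟨ht4, hfr4, g9, g12, gr, hst⟩
  rw [u1, u2] at hst
  have w5 : s4.reg 5 = 0 := (hfr4.reg 5 rfl).trans u5
  have w6 : s4.reg 6 = 1 := (hfr4.reg 6 rfl).trans u6
  have w4 : s4.reg 4 = ℓ := (hfr4.reg 4 rfl).trans ((hfr3.reg 4 rfl).trans hl')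
  have z12 : s4.arr 12 0 0 = 0 := by
    rw [g12, hfr3.arr 12 rfl, e2 12 rfl rfl]; exact az _ (by simp) _ _
  have z9 : s4.arr 9 0 0 = 0 := by
    rw [g9, hfr3.arr 9 rfl, e2 9 rfl rfl]; exact az _ (by simp) _ _
  have zr : s4.rarr 1 0 0 = 0 := by
    rw [gr, hfr3.rarr 1 rfl, hfr2.rarr 1 rfl, hfr1.rarr 1 rfl]; exact hr1
  have z13 : ∀ i j, s4.arr 13 i j = 0 := fun i j => by
    rw [hfr4.arr 13 rfl, hfr3.arr 13 rfl, e2 13 rfl rfl]; exact az _ (by simp) _ _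
  have cost4 : s4.cost = (inputMemory S P).cost := by
    rw [← hc0]
    funext i j
    simp only [Memory.cost]
    rw [hfr4.arr 3 rfl, hfr3.arr 3 rfl, e2 3 rfl rfl, hfr4.rarr 0 rfl, hfr3.rarr 0 rfl,
      hfr2.rarr 0 rfl, hfr1.rarr 0 rfl]
  have cov4 : s4.Cover = s3.Cover := by
    funext k i j
    simp only [Memory.Cover, hfr4.arr 7 rfl, hfr4.arr 8 rfl]
  -- Serves both branches of the final test: marking the selected edges touches none of the tables,
  -- and if it is skipped the frame is trivial.
  have key : ∀ s, Frame chainProg s4 s → ((s.reg 3 = 1 ∧ (∀ k ∈ Set.Icc 1 ℓ, s.Stage m p k) ∧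
      ∀ i j, (s.arr 13 i j = 1 ↔ (i, j) ∈ s.selected ℓ) ∧ s.arr 13 i j ≤ 1) ∨
      (s.reg 3 = 0 ∧ ∃ k ∈ Set.Icc 1 ℓ, ∀ i < m, ∀ j < p, ¬ s.Cover k i j)) →
      s.reg 5 = 0 ∧ s.reg 6 = 1 ∧ HoldsStages S P ℓ f s := by
    intro s hfr5 hst5
    have v4 : s.arr 4 = s3.arr 4 := (hfr5.arr 4 rfl).trans (hfr4.arr 4 rfl)
    have v5 : s.arr 5 = s3.arr 5 := (hfr5.arr 5 rfl).trans (hfr4.arr 5 rfl)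
    have v6 : s.arr 6 = s3.arr 6 := (hfr5.arr 6 rfl).trans (hfr4.arr 6 rfl)
    have v7 : s.arr 7 = s3.arr 7 := (hfr5.arr 7 rfl).trans (hfr4.arr 7 rfl)
    have v8 : s.arr 8 = s3.arr 8 := (hfr5.arr 8 rfl).trans (hfr4.arr 8 rfl)
    have v19 : s.arr 19 = s3.arr 19 := (hfr5.arr 19 rfl).trans (hfr4.arr 19 rfl)
    refine ⟨(hfr5.reg 5 rfl).trans w5, (hfr5.reg 6 rfl).trans w6, (hfr5.reg 4 rfl).trans w4,
      ?_, ?_, ?_, ?_, ?_, ?_, ?_, ?_, ?_, ?_, hst5⟩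
    · rw [v4, c4]; exact hcomp'
    · rw [v5]; exact hU
    · rw [v6]; exact hY
    · rw [v7]; exact hcU
    · rw [v8]; exact hcY
    · rw [v19, v7]; exact fun i => hS.last i i.2
    · intro i j
      rw [← cost_inputMemory S P, ← cost4, Memory.cost, Memory.cost, hfr5.arr 3 rfl,
        hfr5.rarr 0 rfl]
    · rw [Memory.W, hfr5.arr 9 rfl, hfr5.rarr 1 rfl, z9, zr]
      simp [flagged]
    · rw [hfr5.arr 12 rfl]; exact z12
    · rw [hfr5.arr 9 rfl]; exact z9
  simp only [List.length_cons, List.length_nil]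
  rcases hst with ⟨h3, hst⟩ | ⟨h3, hst⟩
  · refine wp_ite (fun _ => ?_) (fun h => absurd (h3.trans w6.symm) h)
    refine wp_mono (wp_chainProg (M := M) w4 (by omega) w5 w6 z13 z12 ?_) ?_
    · intro k hk
      have hs := hst k hk
      have hcov := hs.cover
      rw [cov4] at hcov
      rw [hs.next, hfr4.arr 19 rfl]
      exact hlt k hk _ hs.lt_i _ hs.lt_j hcov
    · rintro t5 s5 ⟨ht5, hfr5, h13⟩
      refine ⟨?_, key s5 hfr5 (Or.inl ⟨(hfr5.reg 3 rfl).trans h3, fun k hk => ?_, ?_⟩)⟩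
      · have := le_mul_pow (d := 3) _ hM (by norm_num) ht5
        omega
      · refine (hst k hk).congr ?_ ?_ (hfr5.rarr 0 rfl) ?_ ?_
        · rw [cov4, hfr4.arr 19 rfl]
          exact hlt k hk
        · intro a ha
          fin_cases ha <;> exact hfr5.arr _ rfl
        · intro q _ a ha
          fin_cases ha <;> rw [hfr5.arr _ rfl]
        · intro q _
          rw [hfr5.rarr 1 rfl]
      · have : s5.selected = s4.selected := by
          funext k
          simp only [Memory.selected, hfr5.arr 10 rfl, hfr5.arr 11 rfl, hfr5.arr 12 rfl]
        rw [this]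
        exact h13
  · refine wp_ite (fun h => ?_) (fun _ => ?_)
    · simp only [Test.Holds] at h; omega
    · rw [wp_block_nil]
      refine ⟨by omega, key s4 (Frame.refl _ _) (Or.inr ⟨h3, ?_⟩)⟩
      rw [cov4]
      obtain ⟨k, hk, h⟩ := hst
      exact ⟨k, hk, by rw [cov4] at *; exact h⟩

end

/-! ### From the contents of the memory to runs of the dynamic program -/

section

variable {n m p : ℕ} {S : StructuredSystem n m p} {P : CostMatrix m p} {ℓ : ℕ} {f : Fin n → ℕ}
  {𝒞 : ℕ → Set (Fin n)} {s : Memory}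

namespace StructuredSystem

theorem mem_U_iff (h𝒞 : ∀ k ∈ Set.Icc 1 ℓ, ∀ x, x ∈ 𝒞 k ↔ f x = k) {k : ℕ} (hk : k ∈ Set.Icc 1 ℓ)
    (i : Fin m) : i ∈ S.U 𝒞 k ↔ ∃ r, f r = k ∧ S.B r i = true := by
  simp only [U, Set.mem_ofPred_eq, h𝒞 k hk]

theorem mem_Y_iff (h𝒞 : ∀ k ∈ Set.Icc 1 ℓ, ∀ x, x ∈ 𝒞 k ↔ f x = k) {k : ℕ} (hk : k ∈ Set.Icc 1 ℓ)
    (j : Fin p) : j ∈ S.Y 𝒞 k ↔ ∃ r, f r = k ∧ S.C j r = true := by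
  simp only [Y, Set.mem_ofPred_eq, h𝒞 k hk]

theorem IsPosition.mem_cumU_iff (hf : S.IsPosition ℓ f)
    (h𝒞 : ∀ k ∈ Set.Icc 1 ℓ, ∀ x, x ∈ 𝒞 k ↔ f x = k) {k : ℕ} (hk : k ≤ ℓ)
    (i : Fin m) : i ∈ S.cumU 𝒞 k ↔ ∃ r, f r ≤ k ∧ S.B r i = true := by
  simp only [cumU, Set.mem_iUnion, exists_prop]
  constructor
  · rintro ⟨q, hq, h⟩
    obtain ⟨r, rfl, hB⟩ := (mem_U_iff h𝒞 ⟨hq.1, hq.2.trans hk⟩ i).mp h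
    exact ⟨r, hq.2, hB⟩
  · rintro ⟨r, hr, hB⟩
    exact ⟨f r, ⟨(hf.mem r).1, hr⟩, (mem_U_iff h𝒞 (hf.mem r) i).mpr ⟨r, rfl, hB⟩⟩

theorem IsPosition.mem_cumY_iff (hf : S.IsPosition ℓ f)
    (h𝒞 : ∀ k ∈ Set.Icc 1 ℓ, ∀ x, x ∈ 𝒞 k ↔ f x = k) {k : ℕ} (hk : 1 ≤ k)
    (j : Fin p) : j ∈ S.cumY ℓ 𝒞 k ↔ ∃ r, k ≤ f r ∧ S.C j r = true := by
  simp only [cumY, Set.mem_iUnion, exists_prop]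
  constructor
  · rintro ⟨q, hq, h⟩
    obtain ⟨r, rfl, hB⟩ := (mem_Y_iff h𝒞 ⟨hk.trans hq.1, hq.2⟩ j).mp h
    exact ⟨r, hq.1, hB⟩
  · rintro ⟨r, hr, hB⟩
    exact ⟨f r, ⟨hr, (hf.mem r).2⟩, (mem_Y_iff h𝒞 (hf.mem r) j).mpr ⟨r, rfl, hB⟩⟩

theorem cumU_mono {q k : ℕ} (h : q ≤ k) : S.cumU 𝒞 q ⊆ S.cumU 𝒞 k :=
  Set.biUnion_mono (Set.Icc_subset_Icc_right h) fun _ _ => le_rfl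

end StructuredSystem

open StructuredSystem

theorem HoldsStages.cover_iff (h : HoldsStages S P ℓ f s) (hf : S.IsPosition ℓ f)
    (h𝒞 : ∀ k ∈ Set.Icc 1 ℓ, ∀ x, x ∈ 𝒞 k ↔ f x = k) {k : ℕ} (hk : k ∈ Set.Icc 1 ℓ)
    (i : Fin m) (j : Fin p) : (j, i) ∈ S.coverEdges ℓ 𝒞 k ↔ s.Cover k i j := by
  rw [Memory.Cover, h.cumU k hk.2, h.cumY k hk.2, ← hf.mem_cumU_iff h𝒞 hk.2,
    ← hf.mem_cumY_iff h𝒞 hk.1]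
  exact and_comm

/-- The unions increase, so the least index of membership directly follows the last index of
failure. The assumption that `i` occurs in some union guarantees that there is such a least index.
-/
theorem HoldsStages.first_eq (h : HoldsStages S P ℓ f s) (hf : S.IsPosition ℓ f)
    (h𝒞 : ∀ k ∈ Set.Icc 1 ℓ, ∀ x, x ∈ 𝒞 k ↔ f x = k) {k : ℕ} (hk : k ≤ ℓ)
    {i : Fin m} (hi : i ∈ S.cumU 𝒞 k) : S.first 𝒞 i = s.arr 19 i 0 + 1 := by
  obtain ⟨z1, z2, z3⟩ := h.last i
  have hnot : i ∉ S.cumU 𝒞 (s.arr 19 i 0) := by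
    rw [hf.mem_cumU_iff h𝒞 z1]
    rintro ⟨r, hr, hB⟩
    rcases z2 with z2 | z2
    · have := (hf.mem r).1; omega
    · exact z2 ((h.cumU _ z1 i).mpr ⟨r, hr, hB⟩)
  have hlt : s.arr 19 i 0 < k := by
    by_contra hcon
    exact hnot (cumU_mono (not_lt.mp hcon) hi)
  have hmem : i ∈ S.cumU 𝒞 (s.arr 19 i 0 + 1) := by
    rw [hf.mem_cumU_iff h𝒞 (by omega), ← h.cumU _ (by omega)]
    exact z3 _ (by omega) (by omega)
  refine le_antisymm (Nat.sInf_le hmem) (le_csInf ⟨_, hmem⟩ fun q hq => ?_)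
  by_contra hcon
  exact hnot (cumU_mono (by omega) hq)

/-- Everything is read off from the memory; the values of `W` and `sel` beyond `ℓ` are meaningless
but unconstrained. The links stored in array 12 are the `first - 1` of the selected inputs by
`HoldsStages.first_eq`. -/
theorem HoldsStages.exists_run (h : HoldsStages S P ℓ f s) (hf : S.IsPosition ℓ f)
    (hL : S.IsLineOrder ℓ 𝒞) (h𝒞 : ∀ k ∈ Set.Icc 1 ℓ, ∀ x, x ∈ 𝒞 k ↔ f x = k)
    (h3 : s.reg 3 = 1) : ∃ r : DPRun S P, HoldsDPRun s r := by
  obtain ⟨_, hst, h13⟩ : s.reg 3 = 1 ∧ (∀ k ∈ Set.Icc 1 ℓ, s.Stage m p k) ∧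
      ∀ i j, (s.arr 13 i j = 1 ↔ (i, j) ∈ s.selected ℓ) ∧ s.arr 13 i j ≤ 1 := by
    rcases h.stages with h' | h'
    · exact h'
    · omega
  have hcand : ∀ k ∈ Set.Icc 1 ℓ, ∀ (i : Fin m) (j : Fin p), (j, i) ∈ S.coverEdges ℓ 𝒞 k →
      s.cand i j = P i j + s.W (S.first 𝒞 i - 1) := by
    intro k hk i j hc
    rw [Memory.cand, h.cost, h.first_eq hf h𝒞 hk.2 hc.2, Nat.add_sub_cancel]
  have hex : ∀ k ∈ Set.Icc 1 ℓ, ∃ (i : Fin m) (j : Fin p), s.arr 10 k 0 = i ∧ s.arr 11 k 0 = j ∧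
      s.arr 12 k 0 = S.first 𝒞 i - 1 ∧ (j, i) ∈ S.coverEdges ℓ 𝒞 k ∧
      s.W k = P i j + s.W (s.arr 12 k 0) := by
    intro k hk
    have hs := hst k hk
    have hc := (h.cover_iff hf h𝒞 hk ⟨_, hs.lt_i⟩ ⟨_, hs.lt_j⟩).mpr hs.cover
    have hfst := h.first_eq hf h𝒞 hk.2 hc.2
    refine ⟨⟨_, hs.lt_i⟩, ⟨_, hs.lt_j⟩, rfl, rfl, ?_, hc, ?_⟩
    · rw [hs.next, hfst, Nat.add_sub_cancel]
    · rw [hs.eq, hs.next, ← h.cost]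
      rfl
  have hsel : ∀ k ∈ Set.Icc 1 ℓ, ∀ (i : Fin m) (j : Fin p), s.arr 10 k 0 = i → s.arr 11 k 0 = j →
      {e : Fin p × Fin m | ((e.2 : ℕ), (e.1 : ℕ)) ∈ s.selected k} =
        insert (j, i) {e | ((e.2 : ℕ), (e.1 : ℕ)) ∈ s.selected (s.arr 12 k 0)} := by
    intro k hk i j hi hj
    ext ⟨b, a⟩
    rw [Memory.selected_eq (by have := hk.1; omega)]
    simp only [hi, hj, Set.mem_insert_iff, Set.mem_ofPred_eq, Prod.mk.injEq, Fin.val_inj]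
    tauto
  refine ⟨{ ℓ := ℓ, 𝒞 := 𝒞, line := hL, W := s.W
            sel := fun k => {e | ((e.2 : ℕ), (e.1 : ℕ)) ∈ s.selected k}
            W_zero := h.W_zero
            sel_zero := by simp [Memory.selected_zero h.next_zero]
            W_stage := ?_, sel_stage := ?_
            Ka := fun i j => decide (s.arr 13 i j = 1)
            Ka_eq := fun i j => by simp [(h13 i j).1] }, ?_⟩
  · intro k hk
    refine ⟨?_, ?_⟩
    · obtain ⟨i, j, h1, h2, h4, h5, h6⟩ := hex k hk
      exact ⟨(j, i), h5, by rw [h6, h4]⟩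
    · rintro _ ⟨⟨j, i⟩, hc, rfl⟩
      dsimp only
      rw [← hcand k hk i j hc]
      exact (hst k hk).min i i.2 j j.2 ((h.cover_iff hf h𝒞 hk i j).mp hc)
  · intro k hk
    obtain ⟨i, j, h1, h2, h4, h5, h6⟩ := hex k hk
    refine ⟨(j, i), h5, by rw [h6, h4], ?_⟩
    rw [hsel k hk i j h1 h2, h4]
  · constructor
    · exact h.ell
    · intro k hk x
      rw [h.comp, h𝒞 k hk]
    · intro k hk i
      rw [h.U k hk.2, mem_U_iff h𝒞 hk]
    · intro k hk j
      rw [h.Y k hk.2, mem_Y_iff h𝒞 hk]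
    · intro k hk i
      rw [h.cumU k hk.2, hf.mem_cumU_iff h𝒞 hk.2]
    · intro k hk j
      rw [h.cumY k hk.2, hf.mem_cumY_iff h𝒞 hk.1]
    · intro k hk
      have hfl : s.arr 9 k 0 ≤ 1 := by
        rcases Nat.eq_zero_or_pos k with rfl | hk0
        · rw [h.flag_zero]; exact Nat.zero_le _
        · exact (hst k ⟨hk0, hk⟩).flag
      rcases Nat.le_one_iff_eq_zero_or_eq_one.mp hfl with h0 | h1
      · exact Or.inr ⟨h0, by simp [Memory.W, flagged, h0]⟩
      · exact Or.inl ⟨h1, by simp [Memory.W, flagged, h1]⟩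
    · intro k hk
      obtain ⟨i, j, h1, h2, h4, h5, h6⟩ := hex k hk
      exact ⟨i, j, h1, h2, h4, h5, h6, hsel k hk i j h1 h2⟩
    · intro i j
      have := (h13 i j).2
      rcases Nat.le_one_iff_eq_zero_or_eq_one.mp this with h0 | h1
      · simp [h0]
      · simp [h1]

/-- A run may list the components by itself, but by `IsPosition.unique` its positions are those
computed. So it would have to choose an edge from the set of covering edges that the program found
to be empty. -/
theorem HoldsStages.isEmpty_run (h : HoldsStages S P ℓ f s) (hf : S.IsPosition ℓ f)
    (h3 : s.reg 3 = 0) : IsEmpty (DPRun S P) := by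
  obtain ⟨k, hk, hcov⟩ : ∃ k ∈ Set.Icc 1 ℓ, ∀ i < m, ∀ j < p, ¬ s.Cover k i j := by
    rcases h.stages with h' | h'
    · omega
    · exact h'.2
  refine ⟨fun r => ?_⟩
  obtain ⟨f', hf', h𝒞'⟩ := r.line.exists_position
  obtain ⟨hl, rfl⟩ := hf.unique hf'
  obtain ⟨⟨j, i⟩, hc, _⟩ := r.sel_stage k (hl ▸ hk)
  rw [hl] at hc h𝒞'
  exact hcov i i.2 j j.2 ((h.cover_iff hf h𝒞' hk i j).mp hc)

theorem HoldsStages.dpDone (h : HoldsStages S P ℓ f s) (hf : S.IsPosition ℓ f)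
    (hL : S.IsLineOrder ℓ 𝒞) (h𝒞 : ∀ k ∈ Set.Icc 1 ℓ, ∀ x, x ∈ 𝒞 k ↔ f x = k) : DPDone S P s := by
  rcases h.stages with ⟨h3, _⟩ | ⟨h3, _⟩
  · exact Or.inl ⟨h3, h.exists_run hf hL h𝒞 h3⟩
  · exact Or.inr ⟨h3, h.isEmpty_run hf h3⟩

/-- The summand `1` is absorbed by one more `n`, which is where `n ≥ 1` enters. -/
theorem cube_le {n m p c : ℕ} (hn : 0 < n) (hm : m ≤ c * n) (hp : p ≤ c * n) (K : ℕ) :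
    K * (n + m + p + 1) ^ 3 ≤ K * (2 * c + 2) ^ 3 * n ^ 3 := by
  have : n + m + p + 1 ≤ (2 * c + 2) * n := by nlinarith
  calc K * (n + m + p + 1) ^ 3 ≤ K * ((2 * c + 2) * n) ^ 3 := by gcongr
    _ = _ := by ring

theorem dpAlgorithm_correct (c : ℕ) : ∃ D : ℕ, ∀ n m p : ℕ, 0 < n → m ≤ c * n → p ≤ c * n →
    ∀ (S : StructuredSystem n m p) (P : CostMatrix m p), S.IsLineGraph →
      ∃ (t : ℕ) (s : Memory), Exec dpAlgorithm (inputMemory S P) t s ∧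
        t ≤ D * n ^ 3 ∧ DPDone S P s := by
  refine ⟨400 * (2 * c + 2) ^ 3, fun n m p hn hm hp S P hS => ?_⟩
  obtain ⟨ℓ, 𝒞, hL⟩ := hS
  obtain ⟨f, hf, h𝒞⟩ := hL.exists_position
  obtain ⟨t, s, h1, h2, _, _, _, h3⟩ := wp_dpAlgorithm hn S P hf
  exact ⟨t, s, h1, h2.trans (cube_le hn hm hp _), h3.dpDone hf hL h𝒞⟩

end

section

/-! ## The cost matrix of the bipartite graph -/

/-- Append a block of vertices of a kind to the tables of kinds and indices. -/
def appendProg (ty bd : ℕ) : Prog :=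
  forLoop 8 0 bd (block [.store 20 7 5 ty, .store 21 7 5 8, .inc 7])

/-- The number `N` of vertices on either side in register `7`, their kinds in array `20`, and
their indices within their kind in array `21`. -/
def tableProg : Prog :=
  block [.const 7 0, .const 26 2] ;; appendProg 5 0 ;; appendProg 6 1 ;; appendProg 26 2

/-- The tables replace the arithmetic that would be needed to decode a vertex number. The conditions
on 99 are there because every block formally writes to that register. -/
theorem wp_appendProg {s : Memory} {ty bd M : ℕ} (hM : 1 ≤ M) (hb : s.reg bd ≤ M)
    (h5 : s.reg 5 = 0)
    (hmod : (bd == 8 || bd == 7 || ty == 8 || ty == 7 || bd == 99 || ty == 99) = false) :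
    wp (appendProg ty bd) s fun t s' => t ≤ 12 * M ^ 1 ∧ s'.reg 7 = s.reg 7 + s.reg bd ∧
      ∀ v, (s'.arr 20 v 0 = if s.reg 7 ≤ v ∧ v < s.reg 7 + s.reg bd then s.reg ty
          else s.arr 20 v 0) ∧
        (s'.arr 21 v 0 = if s.reg 7 ≤ v ∧ v < s.reg 7 + s.reg bd then v - s.reg 7
          else s.arr 21 v 0) := by
  simp only [Bool.or_eq_false_iff, beq_eq_false_iff_ne, ne_eq] at hmod
  obtain ⟨⟨⟨⟨⟨m1, m2⟩, m3⟩, m4⟩, m5⟩, m6⟩ := hmod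
  refine wp_forLoop (fun i s' => s'.reg 7 = s.reg 7 + i ∧
      ∀ v, (s'.arr 20 v 0 = if s.reg 7 ≤ v ∧ v < s.reg 7 + i then s.reg ty
          else s.arr 20 v 0) ∧
        (s'.arr 21 v 0 = if s.reg 7 ≤ v ∧ v < s.reg 7 + i then v - s.reg 7
          else s.arr 21 v 0)) 8 0 M hb hM (Nat.zero_le _) ?_ ?_ ?_ ?_
  · simp [Prog.any, block, Instr.modReg, m1, m2, m5]
  · refine ⟨by simp, fun v => ?_⟩
    have : ¬ (s.reg 7 ≤ v ∧ v < s.reg 7 + 0) := by omega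
    simp only [this, if_false]
    exact ⟨rfl, rfl⟩
  · rintro i s1 _ hi hfr h8 ⟨h7, hv⟩
    have e5 : s1.reg 5 = 0 := (hfr.reg 5 rfl).trans h5
    have ety : s1.reg ty = s.reg ty :=
      hfr.reg ty (by simp [forLoop, Prog.any, block, Instr.modReg, m3, m4, m6])
    simp [wp_block_cons, wp_block_nil, Instr.effect, e5, ety, h7, h8]
    refine ⟨by omega, fun v => ?_⟩
    obtain ⟨k1, k2⟩ := hv v
    rw [k1, k2]
    by_cases hvi : v = s.reg 7 + i
    · subst hvi
      simp
    · simp only [hvi, if_false]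
      by_cases hc : s.reg 7 ≤ v ∧ v < s.reg 7 + i
      · rw [if_pos hc, if_pos hc, if_pos ⟨hc.1, by omega⟩, if_pos ⟨hc.1, by omega⟩]
        simp
      · rw [if_neg hc, if_neg hc, if_neg (by omega), if_neg (by omega)]
        simp
  · rintro t s' hfr ht hI
    exact ⟨ht, hI⟩

/-- The kind of a vertex. -/
def vertexKind {n m p : ℕ} : Vertex n m p → ℕ
  | .inl _ => 0
  | .inr (.inl _) => 1
  | .inr (.inr _) => 2

/-- The index of a vertex within its kind. -/
def vertexIndex {n m p : ℕ} : Vertex n m p → ℕ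
  | .inl i => i
  | .inr (.inl i) => i
  | .inr (.inr j) => j

theorem wp_tableProg {s : Memory} {M n m p : ℕ} (hn : s.reg 0 = n) (hm : s.reg 1 = m)
    (hp : s.reg 2 = p) (hM : n + m + p + 1 ≤ M) (h5 : s.reg 5 = 0) (h6 : s.reg 6 = 1) :
    wp tableProg s fun t s' => t ≤ 40 * M ^ 1 ∧ Frame tableProg s s' ∧ s'.reg 7 = n + m + p ∧
      s'.reg 26 = 2 ∧ ∀ v : Vertex n m p, s'.arr 20 (vertexNumber v) 0 = vertexKind v ∧
        s'.arr 21 (vertexNumber v) 0 = vertexIndex v := by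
  have hM1 : 1 ≤ M := by omega
  refine wp_frame (Q := fun t s' => t ≤ 40 * M ^ 1 ∧ s'.reg 7 = n + m + p ∧
      s'.reg 26 = 2 ∧ ∀ v : Vertex n m p, s'.arr 20 (vertexNumber v) 0 = vertexKind v ∧
        s'.arr 21 (vertexNumber v) 0 = vertexIndex v) ?_ fun t s' h h' => ⟨h'.1, h, h'.2⟩
  refine wp_seq (wp_block (wp_seq ?_))
  set s0 := List.foldl Instr.effect s [.const 7 0, .const 26 2] with hs0
  have r7 : s0.reg 7 = 0 := by simp [hs0, Instr.effect]
  have r26 : s0.reg 26 = 2 := by simp [hs0, Instr.effect]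
  have r0 : s0.reg 0 = n := hn
  have r1 : s0.reg 1 = m := hm
  have r2 : s0.reg 2 = p := hp
  have r5 : s0.reg 5 = 0 := h5
  have r6 : s0.reg 6 = 1 := h6
  clear_value s0
  refine wp_frame (wp_appendProg (M := M) hM1 (by omega) r5 rfl) ?_
  rintro t1 s1 hf1 ⟨ht1, g1, hv1⟩
  rw [r7, r0] at g1 hv1
  rw [r5] at hv1
  refine wp_seq (wp_frame (wp_appendProg (M := M) hM1 ((hf1.reg 1 rfl).trans_le (by omega))
    ((hf1.reg 5 rfl).trans r5) rfl) ?_)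
  rintro t2 s2 hf2 ⟨ht2, g2, hv2⟩
  rw [g1, hf1.reg 1 rfl, r1] at g2 hv2
  rw [hf1.reg 6 rfl, r6] at hv2
  have q2 : s2.reg 2 = p := (hf2.reg 2 rfl).trans ((hf1.reg 2 rfl).trans r2)
  refine wp_frame (wp_appendProg (M := M) hM1 (by omega)
    ((hf2.reg 5 rfl).trans ((hf1.reg 5 rfl).trans r5)) rfl) ?_
  rintro t3 s3 hf3 ⟨ht3, g3, hv3⟩
  rw [g2, q2] at g3 hv3
  have q26 : s2.reg 26 = 2 := (hf2.reg 26 rfl).trans ((hf1.reg 26 rfl).trans r26)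
  rw [q26] at hv3
  refine ⟨?_, by omega, (hf3.reg 26 rfl).trans q26, ?_⟩
  · simp at ht1 ht2 ht3 ⊢; omega
  · rintro (i | i | j)
    · have := i.2
      change s3.arr 20 (i : ℕ) 0 = 0 ∧ s3.arr 21 (i : ℕ) 0 = i
      rw [(hv3 _).1, (hv3 _).2, (hv2 _).1, (hv2 _).2, (hv1 _).1, (hv1 _).2]
      constructor <;> (split_ifs <;> omega)
    · have := i.2
      change s3.arr 20 (n + i) 0 = 1 ∧ s3.arr 21 (n + i) 0 = i
      rw [(hv3 _).1, (hv3 _).2, (hv2 _).1, (hv2 _).2]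
      constructor <;> (split_ifs <;> omega)
    · have := j.2
      change s3.arr 20 (n + m + j) 0 = 2 ∧ s3.arr 21 (n + m + j) 0 = j
      rw [(hv3 _).1, (hv3 _).2]
      constructor <;> (split_ifs <;> omega)

def boundBody : Prog :=
  block [.load 11 3 8 9] ;;
  .ite (.eq 11 6) (block [])
    (block [.rload 2 0 8 9, .rsub 3 0 2] ;; .ite (.rlt 4 2) (block [.rcopy 4 2]) (block []) ;;
      .ite (.rlt 4 3) (block [.rcopy 4 3]) (block []))

/-- A bound on the finite costs in real register `4`. -/
def boundProg : Prog := block [.rone 4] ;; forLoop 8 0 1 (forLoop 9 0 2 boundBody)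

theorem wp_boundBody {s : Memory} (h6 : s.reg 6 = 1) (h0 : s.rreg 0 = 0) :
    wp boundBody s fun t s' => t ≤ 15 * 1 ∧ s.rreg 4 ≤ s'.rreg 4 ∧
      (s.arr 3 (s.reg 8) (s.reg 9) ≠ 1 → |s.rarr 0 (s.reg 8) (s.reg 9)| ≤ s'.rreg 4) := by
  simp [boundBody, wp_seq_iff, wp_ite_iff, wp_block_cons, wp_block_nil, Instr.effect,
    Test.Holds, h0, h6, abs_le]
  refine ⟨fun h h' => absurd h h', fun _ => ⟨fun h => ⟨fun h' => ⟨?_, fun _ => ?_⟩,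
    fun h' => ⟨?_, fun _ => ?_⟩⟩, fun h => ⟨fun h' => ⟨?_, fun _ => ?_⟩, fun h' => ?_⟩⟩⟩
  all_goals first | linarith | exact fun _ => ⟨by linarith, by linarith⟩

theorem wp_boundProg {s : Memory} {M : ℕ} (hM : 1 ≤ M) (hm : s.reg 1 ≤ M) (hp : s.reg 2 ≤ M)
    (h6 : s.reg 6 = 1) (h0 : s.rreg 0 = 0) :
    wp boundProg s fun t s' => t ≤ 25 * M ^ 2 ∧ Frame boundProg s s' ∧ 1 ≤ s'.rreg 4 ∧
      ∀ i < s.reg 1, ∀ j < s.reg 2, s.arr 3 i j ≠ 1 → |s.rarr 0 i j| ≤ s'.rreg 4 := by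
  refine wp_frame (Q := fun t s' => t ≤ 25 * M ^ 2 ∧ 1 ≤ s'.rreg 4 ∧
      ∀ i < s.reg 1, ∀ j < s.reg 2, s.arr 3 i j ≠ 1 → |s.rarr 0 i j| ≤ s'.rreg 4) ?_
    fun t s' h h' => ⟨h'.1, h, h'.2⟩
  have hM2 : 1 ≤ M ^ 2 := Nat.one_le_pow _ _ hM
  refine wp_seq (wp_block (wp_forSet₂ (fun D s' => 1 ≤ s'.rreg 4 ∧ ∀ i j, (i, j) ∈ D →
    s.arr 3 i j ≠ 1 → |s.rarr 0 i j| ≤ s'.rreg 4) 15 0 M hm hp hM rfl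
    (fun _ _ _ h => h) (fun _ _ _ h => h) ?_ ?_ ?_))
  · simp [Instr.effect]
  · rintro i j D s' hi hj hD hfr h8 h9 ⟨hI, hI'⟩
    have a3 : s'.arr 3 = s.arr 3 := hfr.arr 3 rfl
    have a0 : s'.rarr 0 = s.rarr 0 := hfr.rarr 0 rfl
    refine wp_mono (wp_boundBody ((hfr.reg 6 rfl).trans h6) ((hfr.rreg 0 rfl).trans h0))
      fun t s'' ⟨h1, h2, h3⟩ => ⟨h1, hI.trans h2, ?_⟩
    rw [h8, h9, a3, a0] at h3
    intro a b hab
    simp only [Set.mem_insert_iff, Prod.mk.injEq] at hab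
    rcases hab with ⟨rfl, rfl⟩ | hab
    · exact h3
    · exact fun h => (hI' a b hab h).trans h2
  · rintro t s' hfr ht ⟨hI, hI'⟩
    refine ⟨?_, hI, fun i hi j hj => hI' i j ⟨hi, hj⟩⟩
    simp at ht ⊢; omega

/-- Real registers `5` and `6` become `(2 N + 1)` and `(2 N + 1) ^ 2` times register `4`. -/
def scaleProg : Prog :=
  block [.rcopy 5 4] ;; forLoop 8 0 7 (block [.radd 5 5 4, .radd 5 5 4]) ;;
  block [.rcopy 6 5] ;; forLoop 8 0 7 (block [.radd 6 6 5, .radd 6 6 5])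

/-- Reals can only be added, so the factor `2 * N + 1` is produced by `N` double additions. It is
the factor that `lt_of_sum_le_sum` asks for, once for infinite costs and once more for missing
edges. -/
theorem wp_scaleProg {s : Memory} {M : ℕ} (hM : 1 ≤ M) (hN : s.reg 7 ≤ M) :
    wp scaleProg s fun t s' => t ≤ 25 * M ^ 1 ∧ Frame scaleProg s s' ∧
      s'.rreg 5 = (2 * s.reg 7 + 1) * s.rreg 4 ∧ s'.rreg 6 = (2 * s.reg 7 + 1) * s'.rreg 5 := by
  refine wp_frame (Q := fun t s' => t ≤ 25 * M ^ 1 ∧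
      s'.rreg 5 = (2 * s.reg 7 + 1) * s.rreg 4 ∧ s'.rreg 6 = (2 * s.reg 7 + 1) * s'.rreg 5) ?_
    fun t s' h h' => ⟨h'.1, h, h'.2⟩
  refine wp_seq (wp_block (wp_seq (wp_forLoop
    (fun i s' => s'.rreg 5 = (2 * i + 1) * s.rreg 4) 4 0 M hN hM (Nat.zero_le _) rfl
    ?_ ?_ ?_)))
  · simp [Instr.effect]
  · intro i s' _ hi hfr _ hI
    have e4 : s'.rreg 4 = s.rreg 4 := hfr.rreg 4 rfl
    simp [wp_block_cons, wp_block_nil, Instr.effect, hI, e4]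
    ring
  · intro t1 s1 hfr1 ht1 hI1
    have e7 : s1.reg 7 = s.reg 7 := hfr1.reg 7 rfl
    refine wp_seq (wp_block (wp_forLoop
      (fun i s' => s'.rreg 6 = (2 * i + 1) * s1.rreg 5) 4 0 M (e7.trans_le hN) hM
      (Nat.zero_le _) rfl ?_ ?_ ?_))
    · simp [Instr.effect]
    · intro i s' _ hi hfr _ hI
      have e4 : s'.rreg 5 = s1.rreg 5 := hfr.rreg 5 rfl
      simp [wp_block_cons, wp_block_nil, Instr.effect, hI, e4]
      ring
    · intro t2 s2 hfr2 ht2 hI2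
      have e5 : s2.rreg 5 = s1.rreg 5 := hfr2.rreg 5 rfl
      refine ⟨?_, e5.trans hI1, ?_⟩
      · simp at ht1 ht2 ⊢; omega
      · rw [e5, hI2, ← e7]; rfl

def edgeFromState : Prog :=
  .ite (.eq 12 5) (block [.load 30 0 21 22])
    (.ite (.eq 12 6) (block [.load 30 1 21 22]) (block [])) ;;
  .ite (.eq 30 6) (block [.rzero 7]) (block [])

def edgeFromInput : Prog :=
  .ite (.eq 12 6) (.ite (.eq 21 22) (block [.const 30 1, .rzero 7]) (block []))
    (.ite (.eq 12 26)
      (block [.const 30 1, .load 31 3 21 22] ;;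
        .ite (.eq 31 6) (block [.rcopy 7 5]) (block [.rload 7 0 21 22])) (block []))

def edgeFromOutput : Prog :=
  .ite (.eq 12 5) (block [.load 30 2 21 22] ;; .ite (.eq 30 6) (block [.rzero 7]) (block []))
    (.ite (.eq 12 26) (.ite (.eq 21 22) (block [.const 30 1, .rzero 7]) (block [])) (block []))

def fillBody : Prog :=
  block [.load 11 20 8 5, .load 12 20 9 5, .load 21 21 8 5, .load 22 21 9 5, .const 30 0,
    .rcopy 7 6] ;;
  .ite (.eq 11 5) edgeFromState (.ite (.eq 11 6) edgeFromInput edgeFromOutput) ;;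
  block [.store 22 8 9 30, .rstore 2 8 9 7]

/-- Mark the edges of the bipartite graph in array `22`, and store their costs in real array `2`,
replacing `⊤` by real register `5` and the cost of a missing edge by real register `6`. -/
def fillProg : Prog := forLoop 8 0 7 (forLoop 9 0 7 fillBody)

variable {n m p : ℕ}

/-- Pairs of vertices as edges of the complete bipartite graph: `q` replaces infinite costs, and
`h` is the cost of the pairs that are not edges. -/
noncomputable def pairCost (S : StructuredSystem n m p) (P : CostMatrix m p) (q h : ℝ)
    (v w : Vertex n m p) : ℝ :=
  open Classical in if BipAdj S (fun _ _ => true) v w then (bipCost P (v, w)).untopD q else h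

open Classical in
theorem wp_fillBody {s : Memory} {S : StructuredSystem n m p} {P : CostMatrix m p}
    (h5 : s.reg 5 = 0) (h6 : s.reg 6 = 1) (h26 : s.reg 26 = 2)
    (a0 : s.arr 0 = tabulate 0 Bool.toNat S.A) (a1 : s.arr 1 = tabulate 0 Bool.toNat S.B)
    (a2 : s.arr 2 = tabulate 0 Bool.toNat S.C) (hP : ∀ (i : Fin m) (j : Fin p), s.cost i j = P i j)
    (hv : ∀ v : Vertex n m p, s.arr 20 (vertexNumber v) 0 = vertexKind v ∧
        s.arr 21 (vertexNumber v) 0 = vertexIndex v)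
    (v w : Vertex n m p) (h8 : s.reg 8 = vertexNumber v) (h9 : s.reg 9 = vertexNumber w) :
    wp fillBody s fun t s' => t ≤ 40 * 1 ∧
      (∀ a b, s'.arr 22 a b = if a = vertexNumber v ∧ b = vertexNumber w then
        (if BipAdj S (fun _ _ => true) v w then 1 else 0) else s.arr 22 a b) ∧
      ∀ a b, s'.rarr 2 a b = if a = vertexNumber v ∧ b = vertexNumber w then
        pairCost S P (s.rreg 5) (s.rreg 6) v w else s.rarr 2 a b := by
  -- The stored flag and cost are made existential: symbolic execution then determines them by
  -- unification in each branch, and only afterwards are they compared with the intended values.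
  suffices H : wp fillBody s fun t s' => t ≤ 40 * 1 ∧
      ∃ e x, (e = if BipAdj S (fun _ _ => true) v w then 1 else 0) ∧
        x = pairCost S P (s.rreg 5) (s.rreg 6) v w ∧
      (∀ a b, s'.arr 22 a b = if a = vertexNumber v ∧ b = vertexNumber w then
        e else s.arr 22 a b) ∧
      ∀ a b, s'.rarr 2 a b = if a = vertexNumber v ∧ b = vertexNumber w then
        x else s.rarr 2 a b by
    refine wp_mono H ?_
    rintro t s' ⟨ht, e, x, rfl, rfl, h⟩
    exact ⟨ht, h⟩
  have hv1 := hv v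
  have hw1 := hv w
  have toNat_iff : ∀ b : Bool, b.toNat = if b = true then 1 else 0 := by decide
  rcases v with i | i | i <;> rcases w with j | j | j <;>
    simp only [vertexKind, vertexIndex] at hv1 hw1 <;>
    simp only [fillBody, edgeFromState, edgeFromInput, edgeFromOutput, wp_seq_iff, wp_ite_iff,
      wp_block_cons, wp_block_nil, Instr.effect, Test.Holds, Memory.reg_setReg, Memory.arr_setReg,
      Memory.rarr_setReg, Memory.rreg_setReg, Memory.reg_setRreg, Memory.rreg_setRreg,
      Memory.arr_setRreg, Memory.rarr_setRreg, Memory.arr_setArr_apply, Memory.rarr_setRarr_apply,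
      Memory.rarr_setArr, Memory.arr_setRarr, Memory.reg_setArr, Memory.rreg_setArr, h5, h6, h26,
      h8, h9, hv1, hw1, a0, a1, a2, Nat.reduceEqDiff, if_true, if_false, tabulate_apply,
      zero_ne_one, OfNat.ofNat_ne_zero, OfNat.ofNat_ne_one, OfNat.zero_ne_ofNat,
      OfNat.one_ne_ofNat, not_true, not_false_iff, true_imp_iff, false_imp_iff, and_true, true_and,
      one_ne_zero]
  all_goals try refine ⟨fun hb => ?_, fun hb => ?_⟩
  all_goals refine ⟨by norm_num, _, _, ?_, ?_, fun _ _ => rfl, fun _ _ => rfl⟩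
  all_goals simp_all [BipAdj, pairCost, bipCost, Fin.ext_iff, Memory.cost, flagged]
  all_goals rw [← hP]; simp [hb]

theorem vertexNumber_lt (v : Vertex n m p) : vertexNumber v < n + m + p := by
  rcases v with i | i | i <;> have := i.2 <;> simp only [vertexNumber] <;> omega

theorem vertexNumber_injective : Function.Injective (vertexNumber : Vertex n m p → ℕ) := by
  rintro (i | i | i) (j | j | j) h <;> have := i.2 <;> have := j.2 <;>
    simp only [vertexNumber] at h <;> first | omega | (congr; ext; omega)

theorem exists_vertexNumber {a : ℕ} (ha : a < n + m + p) : ∃ v : Vertex n m p, vertexNumber v = a := by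
  by_cases h1 : a < n
  · exact ⟨.inl ⟨a, h1⟩, rfl⟩
  by_cases h2 : a < n + m
  · exact ⟨.inr (.inl ⟨a - n, by omega⟩), by simp only [vertexNumber]; omega⟩
  · exact ⟨.inr (.inr ⟨a - (n + m), by omega⟩), by simp only [vertexNumber]; omega⟩

/-- The bipartite graph with its costs is stored in arrays `20`, `21`, `22` and real array `2`. -/
structure HoldsGraph (S : StructuredSystem n m p) (P : CostMatrix m p) (q h : ℝ) (s : Memory) :
    Prop where
  card : s.reg 7 = n + m + p
  two : s.reg 26 = 2
  kind : ∀ v : Vertex n m p, s.arr 20 (vertexNumber v) 0 = vertexKind v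
  index : ∀ v : Vertex n m p, s.arr 21 (vertexNumber v) 0 = vertexIndex v
  edge : ∀ v w : Vertex n m p, s.arr 22 (vertexNumber v) (vertexNumber w) = 1 ↔
    BipAdj S (fun _ _ => true) v w
  cost : ∀ v w : Vertex n m p, s.rarr 2 (vertexNumber v) (vertexNumber w) = pairCost S P q h v w

theorem wp_fillProg {s : Memory} {S : StructuredSystem n m p} {P : CostMatrix m p} {M : ℕ}
    (hM : 1 ≤ M) (hN : s.reg 7 = n + m + p) (hNM : n + m + p ≤ M)
    (h5 : s.reg 5 = 0) (h6 : s.reg 6 = 1) (h26 : s.reg 26 = 2)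
    (a0 : s.arr 0 = tabulate 0 Bool.toNat S.A) (a1 : s.arr 1 = tabulate 0 Bool.toNat S.B)
    (a2 : s.arr 2 = tabulate 0 Bool.toNat S.C) (hP : ∀ (i : Fin m) (j : Fin p), s.cost i j = P i j)
    (hv : ∀ v : Vertex n m p, s.arr 20 (vertexNumber v) 0 = vertexKind v ∧
        s.arr 21 (vertexNumber v) 0 = vertexIndex v) :
    wp fillProg s fun t s' => t ≤ 48 * M ^ 2 ∧ Frame fillProg s s' ∧
      HoldsGraph S P (s.rreg 5) (s.rreg 6) s' := by
  refine wp_forSet₂ (fun D s' => ∀ v w : Vertex n m p, (vertexNumber v, vertexNumber w) ∈ D →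
    (s'.arr 22 (vertexNumber v) (vertexNumber w) = 1 ↔ BipAdj S (fun _ _ => true) v w) ∧
    s'.rarr 2 (vertexNumber v) (vertexNumber w) = pairCost S P (s.rreg 5) (s.rreg 6) v w)
    40 0 M (hN.trans_le hNM) (hN.trans_le hNM) hM rfl (fun _ _ _ h => h) (fun _ _ _ h => h)
    (by simp) ?_ ?_
  · intro a b D s' ha hb hD hfr h8 h9 hI
    obtain ⟨v, rfl⟩ := exists_vertexNumber (hN ▸ ha)
    obtain ⟨w, rfl⟩ := exists_vertexNumber (hN ▸ hb)
    refine wp_mono (wp_fillBody (S := S) (P := P) ((hfr.reg 5 rfl).trans h5)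
      ((hfr.reg 6 rfl).trans h6) ((hfr.reg 26 rfl).trans h26) ((hfr.arr 0 rfl).trans a0)
      ((hfr.arr 1 rfl).trans a1) ((hfr.arr 2 rfl).trans a2) ?_ ?_ v w h8 h9) ?_
    · intro i j
      rw [← hP, Memory.cost, Memory.cost, hfr.arr 3 rfl, hfr.rarr 0 rfl]
    · rw [hfr.arr 20 rfl, hfr.arr 21 rfl]
      exact hv
    · rintro t s'' ⟨ht, k1, k2⟩
      refine ⟨ht, fun v' w' h => ?_⟩
      rw [k1, k2, hfr.rreg 5 rfl, hfr.rreg 6 rfl]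
      by_cases hvw : vertexNumber v' = vertexNumber v ∧ vertexNumber w' = vertexNumber w
      · obtain ⟨h1, h2⟩ := hvw
        obtain rfl := vertexNumber_injective h1
        obtain rfl := vertexNumber_injective h2
        simp
      · rw [if_neg hvw, if_neg hvw]
        exact hI v' w' (h.resolve_left fun e => hvw (Prod.ext_iff.mp e))
  · intro t s' hfr ht hI
    have hI' := fun v w => hI v w ⟨by rw [hN]; exact vertexNumber_lt v,
      by rw [hN]; exact vertexNumber_lt w⟩
    exact ⟨ht, hfr, (hfr.reg 7 rfl).trans hN, (hfr.reg 26 rfl).trans h26,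
      fun v => by rw [hfr.arr 20 rfl]; exact (hv v).1,
      fun v => by rw [hfr.arr 21 rfl]; exact (hv v).2,
      fun v w => (hI' v w).1, fun v w => (hI' v w).2⟩

def graphProg : Prog := tableProg ;; boundProg ;; scaleProg ;; fillProg

theorem wp_graphProg {s : Memory} {S : StructuredSystem n m p} {P : CostMatrix m p} {M : ℕ}
    (hn : s.reg 0 = n) (hm : s.reg 1 = m) (hp : s.reg 2 = p) (hM : n + m + p + 1 ≤ M)
    (h5 : s.reg 5 = 0) (h6 : s.reg 6 = 1) (hr : s.rreg 0 = 0)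
    (a0 : s.arr 0 = tabulate 0 Bool.toNat S.A) (a1 : s.arr 1 = tabulate 0 Bool.toNat S.B)
    (a2 : s.arr 2 = tabulate 0 Bool.toNat S.C)
    (hP : ∀ (i : Fin m) (j : Fin p), s.cost i j = P i j) :
    wp graphProg s fun t s' => t ≤ 138 * M ^ 3 ∧ Frame graphProg s s' ∧
      ∃ b q : ℝ, 1 ≤ b ∧ (∀ i j, ∀ x : ℝ, P i j = x → |x| ≤ b) ∧
        q = (2 * (n + m + p : ℕ) + 1) * b ∧ s'.rreg 6 = (2 * (n + m + p : ℕ) + 1) * q ∧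
        HoldsGraph S P q (s'.rreg 6) s' := by
  have hM1 : 1 ≤ M := by omega
  refine wp_frame (Q := fun t s' => t ≤ 138 * M ^ 3 ∧
      ∃ b q : ℝ, 1 ≤ b ∧ (∀ i j, ∀ x : ℝ, P i j = x → |x| ≤ b) ∧
        q = (2 * (n + m + p : ℕ) + 1) * b ∧ s'.rreg 6 = (2 * (n + m + p : ℕ) + 1) * q ∧
        HoldsGraph S P q (s'.rreg 6) s') ?_ fun t s' h h' => ⟨h'.1, h, h'.2⟩
  refine wp_seq (wp_mono (wp_tableProg hn hm hp hM h5 h6) ?_)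
  rintro t1 s1 ⟨ht1, hf1, e7, e26, hv⟩
  refine wp_seq (wp_mono (wp_boundProg (M := M) hM1 ((hf1.reg 1 rfl).trans_le (by omega))
    ((hf1.reg 2 rfl).trans_le (by omega)) ((hf1.reg 6 rfl).trans h6)
    ((hf1.rreg 0 rfl).trans hr)) ?_)
  rintro t2 s2 ⟨ht2, hf2, hb1, hb⟩
  refine wp_seq (wp_mono (wp_scaleProg (M := M) hM1 ((hf2.reg 7 rfl).trans_le (by omega))) ?_)
  rintro t3 s3 ⟨ht3, hf3, g5, g6⟩
  rw [hf2.reg 7 rfl, e7] at g5 g6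
  have ea : ∀ a ∈ [0, 1, 2, 3], s3.arr a = s.arr a := by
    intro a ha
    fin_cases ha <;> exact (hf3.arr _ rfl).trans ((hf2.arr _ rfl).trans (hf1.arr _ rfl))
  refine wp_mono (wp_fillProg (S := S) (P := P) (M := M) hM1
    ((hf3.reg 7 rfl).trans ((hf2.reg 7 rfl).trans e7)) (by omega)
    ((hf3.reg 5 rfl).trans ((hf2.reg 5 rfl).trans ((hf1.reg 5 rfl).trans h5)))
    ((hf3.reg 6 rfl).trans ((hf2.reg 6 rfl).trans ((hf1.reg 6 rfl).trans h6)))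
    ((hf3.reg 26 rfl).trans ((hf2.reg 26 rfl).trans e26))
    ((ea 0 (by simp)).trans a0) ((ea 1 (by simp)).trans a1) ((ea 2 (by simp)).trans a2) ?_ ?_) ?_
  · intro i j
    rw [← hP, Memory.cost, Memory.cost, ea 3 (by simp), hf3.rarr 0 rfl, hf2.rarr 0 rfl,
      hf1.rarr 0 rfl]
  · rw [hf3.arr 20 rfl, hf2.arr 20 rfl, hf3.arr 21 rfl, hf2.arr 21 rfl]
    exact hv
  · rintro t4 s4 ⟨ht4, hf4, hG⟩
    have k6 : s4.rreg 6 = s3.rreg 6 := hf4.rreg 6 rfl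
    refine ⟨?_, s2.rreg 4, s3.rreg 5, hb1, ?_, g5, k6.trans g6, k6 ▸ hG⟩
    · have := le_mul_pow (d := 3) _ hM1 (by norm_num) ht1
      have := le_mul_pow (d := 3) _ hM1 (by norm_num) ht2
      have := le_mul_pow (d := 3) _ hM1 (by norm_num) ht3
      have := le_mul_pow (d := 3) _ hM1 (by norm_num) ht4
      omega
    · intro i j x hx
      have h := hP i j
      have h3 : s.arr 3 i j ≠ 1 := fun h3 => by
        rw [hx, Memory.cost, flagged, if_pos h3] at h
        exact WithTop.top_ne_coe h
      rw [hx, Memory.cost, flagged, if_neg h3] at h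
      have := hb i (by rw [hf1.reg 1 rfl, hm]; exact i.2) j (by rw [hf1.reg 2 rfl, hp]; exact j.2)
      rw [hf1.arr 3 rfl, hf1.rarr 0 rfl] at this
      have hx' : s.rarr 0 i j = x := WithTop.coe_injective h
      rw [← hx']
      exact this h3

end

section

/-! ## The assignment problem

Rows and columns are numbered from `0` to `N - 1`. Column `N` is a dummy to which the row that is
being added is assigned; the value `N` of `p j` says that column `j` is free. -/

/-- The rows below `i` are assigned to columns by tight entries. -/
structure PartialAssignment (N i : ℕ) (c : ℕ → ℕ → ℝ) (u v : ℕ → ℝ) (p : ℕ → ℕ) : Prop where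
  feas : ∀ a < N, ∀ b < N, u a + v b ≤ c a b
  tight : ∀ j < N, p j ≠ N → c (p j) j = u (p j) + v j
  range : ∀ j < N, p j < i ∨ p j = N
  inj : ∀ j < N, ∀ k < N, p j = p k → p j ≠ N → j = k
  surj : ∀ a < i, ∃ j < N, p j = a

/-- The search for an augmenting path from row `i`. The columns marked by `used` form a tree with
parents `way` and depths at most `ρ`; `mv` holds the least slacks of the other columns with respect
to the rows of the tree. All columns of the tree but `cur` are assigned. -/
structure SearchTree (N i : ℕ) (c : ℕ → ℕ → ℝ) (u v mv : ℕ → ℝ) (p way used ρ : ℕ → ℕ) (cur U : ℕ) :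
    Prop where
  row_lt : i < N
  dummy : p N = i
  used_dummy : used N = 1
  feas : ∀ a < N, ∀ b < N, u a + v b ≤ c a b
  tight : ∀ j < N, p j ≠ N → c (p j) j = u (p j) + v j
  range : ∀ j ≤ N, p j ≤ i ∨ p j = N
  inj : ∀ j ≤ N, ∀ k ≤ N, p j = p k → p j ≠ N → j = k
  surj : ∀ a ≤ i, ∃ j ≤ N, p j = a
  min : ∀ j < N, used j ≠ 1 → ∀ k ≤ N, used k = 1 → p k ≠ N → mv j ≤ c (p k) j - u (p k) - v j
  parent : ∀ j < N, used j ≠ 1 → way j ≤ N ∧ used (way j) = 1 ∧ p (way j) ≠ N ∧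
    mv j = c (p (way j)) j - u (p (way j)) - v j
  tree : ∀ j < N, used j = 1 → way j ≤ N ∧ used (way j) = 1 ∧ p (way j) ≠ N ∧ ρ (way j) < ρ j ∧
    c (p (way j)) j = u (p (way j)) + v j
  -- `U` stands for the number of columns outside the tree. The depths so far are thus below `N -
  -- U'` when `U = U' + 1`, so a new column can be given the depth `N - U'`.
  rank : ∀ j ≤ N, used j = 1 → ρ j + U ≤ N
  cur_le : cur ≤ N
  used_cur : used cur = 1
  assigned : ∀ j ≤ N, used j = 1 → j ≠ cur → p j ≠ N

variable {N i : ℕ} {c : ℕ → ℕ → ℝ} {u v mv u' v' mv' : ℕ → ℝ}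
  {p way used ρ p' way' used' : ℕ → ℕ} {cur U U' j₁ : ℕ} {δ : ℝ}

/-- The initial tree consists of the dummy column alone, which holds the new row `i`. All least
slacks therefore come from row `i`, and every parent is the dummy. -/
theorem PartialAssignment.searchTree (h : PartialAssignment N i c u v p) (hi : i < N)
    (hp : ∀ j < N, p' j = p j) (hpN : p' N = i) (hmv : ∀ j < N, mv j = c i j - u i - v j)
    (hway : ∀ j < N, way j = N) (hused : ∀ j ≤ N, used j = 1 ↔ j = N) :
    SearchTree N i c u v mv p' way used (fun _ => 0) N N where
  row_lt := hi
  dummy := hpN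
  used_dummy := (hused N le_rfl).mpr rfl
  feas := h.feas
  tight j hj := by rw [hp j hj]; exact h.tight j hj
  range j hj := by
    rcases Nat.lt_or_eq_of_le hj with hj | rfl
    · rw [hp j hj]
      exact (h.range j hj).imp_left le_of_lt
    · exact Or.inl hpN.le
  inj j hj k hk hjk hjN := by
    rcases Nat.lt_or_eq_of_le hj with hj | rfl <;> rcases Nat.lt_or_eq_of_le hk with hk | rfl
    · rw [hp j hj] at hjk hjN
      rw [hp k hk] at hjk
      exact h.inj j hj k hk hjk hjN
    · have := h.range j hj
      rw [hp j hj] at hjk hjN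
      omega
    · have := h.range k hk
      rw [hp k hk] at hjk
      omega
    · rfl
  surj a ha := by
    rcases Nat.lt_or_eq_of_le ha with ha | rfl
    · obtain ⟨j, hj, e⟩ := h.surj a ha
      exact ⟨j, hj.le, (hp j hj).trans e⟩
    · exact ⟨N, le_rfl, hpN⟩
  min j hj _ k hk hku _ := by
    obtain rfl := (hused k hk).mp hku
    rw [hpN, hmv j hj]
  parent j hj _ := by
    rw [hway j hj, hpN]
    exact ⟨le_rfl, (hused N le_rfl).mpr rfl, hi.ne, hmv j hj⟩
  tree j hj hju := by
    have := (hused j hj.le).mp hju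
    omega
  rank j _ _ := by omega
  cur_le := le_rfl
  used_cur := (hused N le_rfl).mpr rfl
  assigned j hj hju hjN := absurd ((hused j hj).mp hju) hjN

namespace SearchTree

theorem row_of_ne (h : SearchTree N i c u v mv p way used ρ cur U) {j : ℕ} (hj : j ≤ N)
    (hjN : p j ≠ N) : p j < N :=
  lt_of_le_of_lt ((h.range j hj).resolve_right hjN) h.row_lt

/-- Unless the search has reached a free column, there is a column outside the tree. -/
theorem exists_unused (h : SearchTree N i c u v mv p way used ρ cur U) (hcur : p cur ≠ N) :
    ∃ j < N, used j ≠ 1 := by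
  by_contra hcon
  push Not at hcon
  have hall : ∀ j ≤ N, p j ≠ N := by
    intro j hj
    by_cases hjc : j = cur
    · exact hjc ▸ hcur
    · refine h.assigned j hj ?_ hjc
      rcases Nat.lt_or_eq_of_le hj with hj | rfl
      · exact hcon j hj
      · exact h.used_dummy
  -- Otherwise all `N + 1` columns, dummy included, would be assigned to different ones of only `N`
  -- rows.
  have hcard := Finset.card_le_card_of_injOn (s := Finset.range (N + 1)) (t := Finset.range N) p
    (fun j hj => by
      have hj' : j ≤ N := by simpa [Nat.lt_succ_iff] using hj
      simpa using h.row_of_ne hj' (hall j hj'))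
    (fun j hj k hk e => by
      have hj' : j ≤ N := by simpa [Nat.lt_succ_iff] using hj
      have hk' : k ≤ N := by simpa [Nat.lt_succ_iff] using hk
      exact h.inj j hj' k hk' e (hall j hj'))
  simp at hcard

/-- One step of the search: column `j₁` of least slack joins the tree. -/
theorem step (h : SearchTree N i c u v mv p way used ρ cur U) (hcur : p cur ≠ N)
    (hj₁ : j₁ < N) (hj₁u : used j₁ ≠ 1) (hδ : δ = mv j₁)
    (hmin : ∀ j < N, used j ≠ 1 → δ ≤ mv j) (hU : U = U' + 1)
    (hused : ∀ j ≤ N, used' j = 1 ↔ used j = 1 ∨ j = j₁)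
    (hu : ∀ k ≤ N, used k = 1 → u' (p k) = u (p k) + δ)
    (hu' : ∀ a < N, (∀ k ≤ N, used k = 1 → p k ≠ a) → u' a = u a)
    (hv : ∀ j ≤ N, used j = 1 → v' j = v j - δ) (hv' : ∀ j ≤ N, used j ≠ 1 → v' j = v j)
    (hway : ∀ j < N, used' j = 1 → way' j = way j)
    (hm : ∀ j < N, used' j ≠ 1 →
      (p j₁ = N ∧ mv' j = mv j - δ ∧ way' j = way j) ∨
      (p j₁ ≠ N ∧ c (p j₁) j - u' (p j₁) - v' j < mv j - δ ∧
        mv' j = c (p j₁) j - u' (p j₁) - v' j ∧ way' j = j₁) ∨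
      (p j₁ ≠ N ∧ mv j - δ ≤ c (p j₁) j - u' (p j₁) - v' j ∧ mv' j = mv j - δ ∧ way' j = way j)) :
    SearchTree N i c u' v' mv' p way' used' (Function.update ρ j₁ (N - U')) j₁ U' := by
  have hasg : ∀ k ≤ N, used k = 1 → p k ≠ N := by
    intro k hk hku
    by_cases hkc : k = cur
    · exact hkc ▸ hcur
    · exact h.assigned k hk hku hkc
  have hδ0 : 0 ≤ δ := by
    obtain ⟨h1, h2, h3, h4⟩ := h.parent j₁ hj₁ hj₁u
    have := h.feas _ (h.row_of_ne h1 h3) j₁ hj₁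
    rw [hδ, h4]
    linarith
  have hnot : ∀ j < N, used' j ≠ 1 → used j ≠ 1 ∧ j ≠ j₁ := by
    intro j hj hju
    rw [Ne, hused j hj.le, not_or] at hju
    exact hju
  have hlt : ∀ k ≤ N, used k = 1 → p k < N := fun k hk hku => h.row_of_ne hk (hasg k hk hku)
  have hrank : ∀ k, used k = 1 → Function.update ρ j₁ (N - U') k = ρ k := fun k hku =>
    Function.update_of_ne (by rintro rfl; exact hj₁u hku) _ _
  refine ⟨h.row_lt, h.dummy, (hused N le_rfl).mpr (Or.inl h.used_dummy), ?_, ?_, h.range, h.inj,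
    h.surj, ?_, ?_, ?_, ?_, hj₁.le, (hused j₁ hj₁.le).mpr (Or.inr rfl), ?_⟩
  -- Slack is lost only between a tree row and an outside column, and there it is at least `δ`,
  -- because `δ` is the least of the slacks `mv`.
  · intro a ha b hb
    have hab := h.feas a ha b hb
    by_cases hat : ∃ k ≤ N, used k = 1 ∧ p k = a
    · obtain ⟨k, hk, hku, rfl⟩ := hat
      rw [hu k hk hku]
      by_cases hbu : used b = 1
      · rw [hv b hb.le hbu]; linarith
      · rw [hv' b hb.le hbu]
        have := hmin b hb hbu
        have := h.min b hb hbu k hk hku (hasg k hk hku)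
        linarith
    · push Not at hat
      rw [hu' a ha hat]
      by_cases hbu : used b = 1
      · rw [hv b hb.le hbu]; linarith
      · rw [hv' b hb.le hbu]; linarith
  -- An assigned pair has both its row and its column in the tree or neither, so the changes of the
  -- potentials cancel.
  · intro j hj hjN
    have := h.tight j hj hjN
    by_cases hju : used j = 1
    · rw [hu j hj.le hju, hv j hj.le hju]; linarith
    · rw [hv' j hj.le hju, hu' _ (h.row_of_ne hj.le hjN)]
      · exact this
      · intro k hk hku e
        exact hju (h.inj k hk j hj.le e (hasg k hk hku) ▸ hku)
  · intro j hj hju k hk hku hkN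
    obtain ⟨hju1, hju2⟩ := hnot j hj hju
    rcases (hused k hk).mp hku with hku | rfl
    · have h1 := h.min j hj hju1 k hk hku hkN
      have h2 : mv' j ≤ mv j - δ := by
        rcases hm j hj hju with ⟨_, e, _⟩ | ⟨_, e1, e2, _⟩ | ⟨_, _, e, _⟩
        · exact e.le
        · rw [e2]; exact e1.le
        · exact e.le
      rw [hu k hk hku, hv' j hj.le hju1]
      linarith
    · rcases hm j hj hju with ⟨e, _⟩ | ⟨_, _, e, _⟩ | ⟨_, e1, e2, _⟩
      · exact absurd e hkN
      · exact e.le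
      · rw [e2]; exact e1
  · intro j hj hju
    obtain ⟨hju1, hju2⟩ := hnot j hj hju
    have hold : way' j = way j → mv' j = mv j - δ → way' j ≤ N ∧ used' (way' j) = 1 ∧
        p (way' j) ≠ N ∧ mv' j = c (p (way' j)) j - u' (p (way' j)) - v' j := by
      intro e1 e2
      obtain ⟨h1, h2, h3, h4⟩ := h.parent j hj hju1
      rw [e1, e2]
      refine ⟨h1, (hused _ h1).mpr (Or.inl h2), h3, ?_⟩
      rw [h4, hu _ h1 h2, hv' j hj.le hju1]
      ring
    rcases hm j hj hju with ⟨_, e2, e3⟩ | ⟨e1, _, e2, e3⟩ | ⟨_, _, e2, e3⟩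
    · exact hold e3 e2
    · rw [e3]
      exact ⟨hj₁.le, (hused j₁ hj₁.le).mpr (Or.inr rfl), e1, e2⟩
    · exact hold e3 e2
  · intro j hj hju
    rw [hway j hj hju]
    rcases (hused j hj.le).mp hju with hju | rfl
    · obtain ⟨h1, h2, h3, h4, h5⟩ := h.tree j hj hju
      refine ⟨h1, (hused _ h1).mpr (Or.inl h2), h3, ?_, ?_⟩
      · rw [hrank _ h2, hrank _ hju]
        exact h4
      · rw [hu _ h1 h2, hv j hj.le hju]
        linarith
    -- For the new column, the slack with respect to its parent was exactly `δ`, so the pair is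
    -- tight now; the depth of the parent is at most `N - U`, hence below `N - U'`.
    · obtain ⟨h1, h2, h3, h4⟩ := h.parent j hj hj₁u
      refine ⟨h1, (hused _ h1).mpr (Or.inl h2), h3, ?_, ?_⟩
      · rw [hrank _ h2, Function.update_self]
        have := h.rank _ h1 h2
        omega
      · rw [hu _ h1 h2, hv' j hj.le hj₁u, hδ, h4]
        ring
  · intro j hj hju
    rcases (hused j hj).mp hju with hju | rfl
    · rw [hrank _ hju]
      have := h.rank j hj hju
      omega
    · rw [Function.update_self]
      have := h.rank cur h.cur_le h.used_cur
      omega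
  · intro j hj hju hne
    exact hasg j hj (((hused j hj).mp hju).resolve_right hne)

end SearchTree

/-- Moving back along the augmenting path: the assignment `p'` is complete except for the
column `cur`, and agrees with the original one on the columns of smaller depth. -/
structure Augmenting (N i : ℕ) (c : ℕ → ℕ → ℝ) (u v : ℕ → ℝ) (p way used ρ : ℕ → ℕ) (p' : ℕ → ℕ)
    (cur : ℕ) : Prop where
  cur_le : cur ≤ N
  used_cur : used cur = 1
  agree : ∀ k ≤ N, used k = 1 → ρ k < ρ cur → p' k = p k
  tight : ∀ j < N, j ≠ cur → p' j ≠ N → c (p' j) j = u (p' j) + v j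
  range : ∀ j ≤ N, j ≠ cur → p' j ≤ i ∨ p' j = N
  inj : ∀ j ≤ N, ∀ k ≤ N, j ≠ cur → k ≠ cur → p' j = p' k → p' j ≠ N → j = k
  surj : ∀ a ≤ i, ∃ j ≤ N, j ≠ cur ∧ p' j = a

theorem SearchTree.augmenting (h : SearchTree N i c u v mv p way used ρ cur U) (hcur : p cur = N) :
    Augmenting N i c u v p way used ρ p cur where
  cur_le := h.cur_le
  used_cur := h.used_cur
  agree _ _ _ _ := rfl
  tight j hj _ := h.tight j hj
  range j hj _ := h.range j hj
  inj j hj k hk _ _ := h.inj j hj k hk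
  surj a ha := by
    obtain ⟨j, hj, e⟩ := h.surj a ha
    refine ⟨j, hj, ?_, e⟩
    rintro rfl
    have := h.row_lt
    omega

/-- The parent is less deep, so it still has its original row, and tree pairs are tight for the
original rows. Moving this row to `cur` shifts the vacant place to the parent and keeps the other
columns injectively assigned. -/
theorem Augmenting.step {p'' : ℕ → ℕ} (h : Augmenting N i c u v p way used ρ p' cur)
    (hT : ∀ j < N, used j = 1 → way j ≤ N ∧ used (way j) = 1 ∧ p (way j) ≠ N ∧ ρ (way j) < ρ j ∧
      c (p (way j)) j = u (p (way j)) + v j)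
    (hcur : cur ≠ N) (hp : ∀ j, p'' j = if j = cur then p' (way cur) else p' j) :
    Augmenting N i c u v p way used ρ p'' (way cur) := by
  have hlt : cur < N := lt_of_le_of_ne h.cur_le hcur
  obtain ⟨h1, h2, h3, h4, h5⟩ := hT cur hlt h.used_cur
  have hne : way cur ≠ cur := fun e => by rw [e] at h4; exact lt_irrefl _ h4
  have hk : p' (way cur) = p (way cur) := h.agree _ h1 h2 h4
  refine ⟨h1, h2, ?_, ?_, ?_, ?_, ?_⟩
  · intro k hk hku hkr
    rw [hp, if_neg, h.agree k hk hku (hkr.trans h4)]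
    rintro rfl
    exact absurd (hkr.trans h4) (lt_irrefl _)
  · intro j hj hjw
    rw [hp]
    split_ifs with hjc
    · subst hjc
      rw [hk]
      exact fun _ => h5
    · exact h.tight j hj hjc
  · intro j hj hjw
    rw [hp]
    split_ifs with hjc
    · exact h.range _ h1 hne
    · exact h.range j hj hjc
  · intro j hj k hk' hjw hkw
    rw [hp, hp]
    split_ifs with hjc hkc hkc
    · exact fun _ _ => hjc.trans hkc.symm
    · intro e e'
      exact absurd (h.inj _ h1 k hk' hne hkc e e').symm hkw
    · intro e e'
      exact absurd (h.inj j hj _ h1 hjc hne e e') hjw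
    · exact h.inj j hj k hk' hjc hkc
  · intro a ha
    obtain ⟨j, hj, hjc, e⟩ := h.surj a ha
    by_cases hjw : j = way cur
    · exact ⟨cur, h.cur_le, hne.symm, by rw [hp, if_pos rfl, ← hjw, e]⟩
    · exact ⟨j, hj, hjw, by rw [hp, if_neg hjc, e]⟩

/-- Once the vacant place is the dummy column, the rows up to `i` all sit in genuine columns. -/
theorem Augmenting.partialAssignment (h : Augmenting N i c u v p way used ρ p' N)
    (hfeas : ∀ a < N, ∀ b < N, u a + v b ≤ c a b) :
    PartialAssignment N (i + 1) c u v p' where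
  feas := hfeas
  tight j hj := h.tight j hj hj.ne
  range j hj := (h.range j hj.le hj.ne).imp_left Nat.lt_succ_of_le
  inj j hj k hk := h.inj j hj.le k hk.le hj.ne hk.ne
  surj a ha := by
    obtain ⟨j, hj, hjN, e⟩ := h.surj a (Nat.lt_succ_iff.mp ha)
    exact ⟨j, lt_of_le_of_ne hj hjN, e⟩

end

section

/-! ### A program for the assignment problem

The assignment is kept in array `23`, the parents of the columns in array `24`, the marks of the
tree in array `25`; real array `2` holds the costs, `3` and `4` the dual variables, and `5` the
least slacks. -/

/-- The registers with the constants that the program uses. -/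
structure HasConstants (N : ℕ) (s : Memory) : Prop where
  zero : s.reg 5 = 0
  one : s.reg 6 = 1
  card : s.reg 7 = N
  succ : s.reg 13 = N + 1

theorem HasConstants.of_frame {N : ℕ} {f : Prog} {s s' : Memory} (h : HasConstants N s)
    (hf : Frame f s s') (hmod : (f.any (Instr.modReg 5) || f.any (Instr.modReg 6) ||
      f.any (Instr.modReg 7) || f.any (Instr.modReg 13)) = false) : HasConstants N s' := by
  simp only [Bool.or_eq_false_iff] at hmod
  obtain ⟨⟨⟨h1, h2⟩, h3⟩, h4⟩ := hmod
  exact ⟨(hf.reg _ h1).trans h.1, (hf.reg _ h2).trans h.2, (hf.reg _ h3).trans h.3,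
    (hf.reg _ h4).trans h.4⟩

variable {N M i : ℕ} {s : Memory}

/-- Real register `9` becomes the slack of the row in register `11` and the column in
register `9`. -/
def slackCode : List Instr :=
  [.rload 9 2 11 9, .rload 10 3 11 5, .rsub 9 9 10, .rload 10 4 9 5, .rsub 9 9 10]

def startRow : Prog :=
  block [.store 23 7 5 8, .store 25 7 5 6, .copy 10 7, .copy 11 8] ;;
  forLoop 9 0 7 (block (slackCode ++ [.rstore 5 9 5 9, .store 24 9 5 7, .store 25 9 5 5]))

theorem wp_startRow (hM : N + 1 ≤ M) (h : HasConstants N s) :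
    wp startRow s fun t s' => t ≤ 25 * M ∧ Frame startRow s s' ∧ s'.reg 10 = N ∧
      s'.reg 11 = s.reg 8 ∧ (∀ j < N, s'.arr 23 j 0 = s.arr 23 j 0) ∧ s'.arr 23 N 0 = s.reg 8 ∧
      (∀ j < N, s'.rarr 5 j 0 = s.rarr 2 (s.reg 8) j - s.rarr 3 (s.reg 8) 0 - s.rarr 4 j 0) ∧
      (∀ j < N, s'.arr 24 j 0 = N) ∧ ∀ j ≤ N, s'.arr 25 j 0 = 1 ↔ j = N := by
  refine wp_frame (Q := fun t s' => t ≤ 25 * M ∧ s'.reg 10 = N ∧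
      s'.reg 11 = s.reg 8 ∧ (∀ j < N, s'.arr 23 j 0 = s.arr 23 j 0) ∧ s'.arr 23 N 0 = s.reg 8 ∧
      (∀ j < N, s'.rarr 5 j 0 = s.rarr 2 (s.reg 8) j - s.rarr 3 (s.reg 8) 0 - s.rarr 4 j 0) ∧
      (∀ j < N, s'.arr 24 j 0 = N) ∧ ∀ j ≤ N, s'.arr 25 j 0 = 1 ↔ j = N) ?_
    fun t s' h h' => ⟨h'.1, h, h'.2⟩
  refine wp_seq (wp_block ?_)
  set s0 := List.foldl Instr.effect s [.store 23 7 5 8, .store 25 7 5 6, .copy 10 7, .copy 11 8]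
    with hs0
  have c0 : HasConstants N s0 := ⟨h.1, h.2, h.3, h.4⟩
  have e10 : s0.reg 10 = N := by simp [hs0, Instr.effect, h.card]
  have e11 : s0.reg 11 = s.reg 8 := by simp [hs0, Instr.effect]
  have e8 : s0.reg 8 = s.reg 8 := rfl
  have a23 : ∀ j, s0.arr 23 j 0 = if j = N then s.reg 8 else s.arr 23 j 0 := by
    simp [hs0, Instr.effect, h.card, h.zero]
  have a25 : s0.arr 25 N 0 = 1 := by
    simp [hs0, Instr.effect, h.card, h.zero, h.one]
  have hr : s0.rarr = s.rarr := rfl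
  clear_value s0
  refine wp_forLoop (fun k s' =>
    (∀ j < k, s'.rarr 5 j 0 = s.rarr 2 (s.reg 8) j - s.rarr 3 (s.reg 8) 0 - s.rarr 4 j 0) ∧
      (∀ j < k, s'.arr 24 j 0 = N) ∧ (∀ j < k, s'.arr 25 j 0 = 0) ∧ s'.arr 25 N 0 = 1)
    12 0 M (c0.card.trans_le (by omega)) (by omega) (Nat.zero_le _) rfl ?_ ?_ ?_
  · exact ⟨by simp, by simp, by simp, a25⟩
  · rintro k s1 _ hk hfr h9 ⟨i1, i2, i3, i4⟩
    have c1 := c0.of_frame hfr rfl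
    rw [c0.card] at hk
    have f11 : s1.reg 11 = s.reg 8 := (hfr.reg 11 rfl).trans e11
    have b2 : s1.rarr 2 = s.rarr 2 := (hfr.rarr 2 rfl).trans (by rw [hr])
    have b3 : s1.rarr 3 = s.rarr 3 := (hfr.rarr 3 rfl).trans (by rw [hr])
    have b4 : s1.rarr 4 = s.rarr 4 := (hfr.rarr 4 rfl).trans (by rw [hr])
    simp [slackCode, wp_block_cons, wp_block_nil, Instr.effect, c1.zero, c1.card, f11, h9, b2, b3,
      b4, i4, hk.ne']
    refine ⟨fun j hj => ?_, fun j hj => ?_, fun j hj => ?_⟩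
    · split_ifs with hjk
      · rw [hjk]
      · exact i1 j (by omega)
    · exact fun hjk => i2 j (by omega)
    · exact fun hjk => i3 j (by omega)
  · rintro t s1 hfr ht ⟨i1, i2, i3, i4⟩
    rw [c0.card] at i1 i2 i3
    refine ⟨?_, (hfr.reg 10 rfl).trans e10, (hfr.reg 11 rfl).trans e11, fun j hj => ?_, ?_, i1, i2,
      fun j hj => ?_⟩
    · simp at ht ⊢; omega
    · rw [hfr.arr 23 rfl, a23, if_neg hj.ne]
    · rw [hfr.arr 23 rfl, a23, if_pos rfl]
    · rcases Nat.lt_or_eq_of_le hj with hj | rfl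
      · simp [i3 j hj, hj.ne]
      · simp [i4]

def selectBody : Prog :=
  block [.load 14 25 9 5] ;; .ite (.eq 14 6) (block [])
    (block [.rload 9 5 9 5] ;; .ite (.eq 12 7) (block [.copy 12 9, .rcopy 8 9])
      (.ite (.rlt 9 8) (block [.copy 12 9, .rcopy 8 9]) (block [])))

/-- Select a column of least slack outside the tree. -/
def selectProg : Prog := block [.copy 12 7] ;; forLoop 9 0 7 selectBody

/-- The value `N` in register 12 means that no column outside the tree has been met yet. -/
theorem wp_selectBody (h : HasConstants N s) {D : Set ℕ} (hj : s.reg 9 < N)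
    (hD : (s.reg 12 = N ∧ ∀ j ∈ D, s.arr 25 j 0 = 1) ∨
      (s.reg 12 < N ∧ s.arr 25 (s.reg 12) 0 ≠ 1 ∧ s.rreg 8 = s.rarr 5 (s.reg 12) 0 ∧
        ∀ j ∈ D, s.arr 25 j 0 ≠ 1 → s.rreg 8 ≤ s.rarr 5 j 0)) :
    wp selectBody s fun t s' => t ≤ 15 * 1 ∧
      ((s'.reg 12 = N ∧ ∀ j ∈ insert (s.reg 9) D, s.arr 25 j 0 = 1) ∨
      (s'.reg 12 < N ∧ s.arr 25 (s'.reg 12) 0 ≠ 1 ∧ s'.rreg 8 = s.rarr 5 (s'.reg 12) 0 ∧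
        ∀ j ∈ insert (s.reg 9) D, s.arr 25 j 0 ≠ 1 → s'.rreg 8 ≤ s.rarr 5 j 0)) := by
  simp [selectBody, wp_seq_iff, wp_ite_iff, wp_block_cons, wp_block_nil, Instr.effect,
    Test.Holds, h.zero, h.one, h.card]
  refine ⟨fun hu => ?_, fun hu => ⟨fun h12 => ?_, fun h12 => ⟨fun hlt => ?_, fun hle => ?_⟩⟩⟩
  · simpa [hu] using hD
  · rcases hD with hD | hD
    · exact Or.inr ⟨hj, hu, fun a ha hau => absurd (hD.2 a ha) hau⟩
    · omega
  · rcases hD with hD | hD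
    · exact absurd hD.1 h12
    · exact Or.inr ⟨hj, hu, fun a ha hau => hlt.le.trans (hD.2.2.2 a ha hau)⟩
  · rcases hD with hD | hD
    · exact absurd hD.1 h12
    · exact Or.inr ⟨hD.1, hD.2.1, hD.2.2.1, fun _ => hle, hD.2.2.2⟩

theorem wp_selectProg (hM : N + 1 ≤ M) (h : HasConstants N s)
    (hex : ∃ j < N, s.arr 25 j 0 ≠ 1) :
    wp selectProg s fun t s' => t ≤ 25 * M ∧ Frame selectProg s s' ∧ s'.reg 12 < N ∧
      s.arr 25 (s'.reg 12) 0 ≠ 1 ∧ s'.rreg 8 = s.rarr 5 (s'.reg 12) 0 ∧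
      ∀ j < N, s.arr 25 j 0 ≠ 1 → s'.rreg 8 ≤ s.rarr 5 j 0 := by
  refine wp_frame (Q := fun t s' => t ≤ 25 * M ∧ s'.reg 12 < N ∧
      s.arr 25 (s'.reg 12) 0 ≠ 1 ∧ s'.rreg 8 = s.rarr 5 (s'.reg 12) 0 ∧
      ∀ j < N, s.arr 25 j 0 ≠ 1 → s'.rreg 8 ≤ s.rarr 5 j 0) ?_
    fun t s' h h' => ⟨h'.1, h, h'.2⟩
  refine wp_seq (wp_block (wp_forSet (fun D s' =>
    (s'.reg 12 = N ∧ ∀ j ∈ D, s.arr 25 j 0 = 1) ∨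
      (s'.reg 12 < N ∧ s.arr 25 (s'.reg 12) 0 ≠ 1 ∧ s'.rreg 8 = s.rarr 5 (s'.reg 12) 0 ∧
        ∀ j ∈ D, s.arr 25 j 0 ≠ 1 → s'.rreg 8 ≤ s.rarr 5 j 0))
    15 0 M (h.card.trans_le (by omega)) (by omega) rfl (fun _ _ _ h => h) ?_ ?_ ?_))
  · exact Or.inl ⟨by simp [Instr.effect, h.card], by simp⟩
  · intro j D s1 hj hjD hfr h9 hI
    have a25 : s1.arr 25 = s.arr 25 := hfr.arr 25 rfl
    have a5 : s1.rarr 5 = s.rarr 5 := hfr.rarr 5 rfl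
    have c0 : HasConstants N (List.foldl Instr.effect s [Instr.copy 12 7]) := ⟨h.1, h.2, h.3, h.4⟩
    have := wp_selectBody (c0.of_frame hfr rfl) (D := D) (by rw [h9]; exact c0.card ▸ hj)
      (by rw [a25, a5]; exact hI)
    rw [a25, a5, h9] at this
    exact this
  · intro t s1 hfr ht hI
    have e7 : (List.foldl Instr.effect s [Instr.copy 12 7]).reg 7 = N := h.card
    rw [e7] at hI
    obtain ⟨j, hj, hju⟩ := hex
    rcases hI with hI | hI
    · exact absurd (hI.2 j hj) hju
    · refine ⟨?_, hI⟩
      simp at ht ⊢; omega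

def updateBody : Prog :=
  block [.load 14 25 9 5] ;; .ite (.eq 14 6)
    (block [.load 15 23 9 5, .rload 9 3 15 5, .radd 9 9 8, .rstore 3 15 5 9, .rload 9 4 9 5,
      .rsub 9 9 8, .rstore 4 9 5 9])
    (block [.rload 9 5 9 5, .rsub 9 9 8, .rstore 5 9 5 9])

/-- Adjust the dual variables by the least slack. -/
def updateProg : Prog := forLoop 9 0 13 updateBody

theorem wp_updateBody (h : HasConstants N s) :
    wp updateBody s fun t s' => t ≤ 15 * 1 ∧
      (∀ a, s'.rarr 3 a 0 = if s.arr 25 (s.reg 9) 0 = 1 ∧ a = s.arr 23 (s.reg 9) 0 then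
        s.rarr 3 a 0 + s.rreg 8 else s.rarr 3 a 0) ∧
      (∀ j, s'.rarr 4 j 0 = if s.arr 25 (s.reg 9) 0 = 1 ∧ j = s.reg 9 then
        s.rarr 4 j 0 - s.rreg 8 else s.rarr 4 j 0) ∧
      (∀ j, s'.rarr 5 j 0 = if s.arr 25 (s.reg 9) 0 ≠ 1 ∧ j = s.reg 9 then
        s.rarr 5 j 0 - s.rreg 8 else s.rarr 5 j 0) := by
  simp [updateBody, wp_seq_iff, wp_ite_iff, wp_block_cons, wp_block_nil, Instr.effect,
    Test.Holds, h.zero, h.one]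
  constructor <;> intro hu <;> simp [hu]
  · constructor <;> intro a <;> split_ifs with ha <;> simp [ha]
  · intro a; split_ifs with ha <;> simp [ha]

/-- Rows are reached through the tree columns that hold them, so injectivity is needed to raise each
potential only once. The loop includes the dummy column `N` because it holds the row that is being
added. -/
theorem wp_updateProg (hM : N + 1 ≤ M) (h : HasConstants N s)
    (hinj : ∀ j ≤ N, ∀ k ≤ N, s.arr 25 j 0 = 1 → s.arr 25 k 0 = 1 → s.arr 23 j 0 = s.arr 23 k 0 →
      j = k) :
    wp updateProg s fun t s' => t ≤ 25 * M ∧ Frame updateProg s s' ∧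
      (∀ k ≤ N, s.arr 25 k 0 = 1 →
        s'.rarr 3 (s.arr 23 k 0) 0 = s.rarr 3 (s.arr 23 k 0) 0 + s.rreg 8) ∧
      (∀ a, (∀ k ≤ N, s.arr 25 k 0 = 1 → s.arr 23 k 0 ≠ a) → s'.rarr 3 a 0 = s.rarr 3 a 0) ∧
      (∀ j ≤ N, s.arr 25 j 0 = 1 → s'.rarr 4 j 0 = s.rarr 4 j 0 - s.rreg 8) ∧
      (∀ j ≤ N, s.arr 25 j 0 ≠ 1 → s'.rarr 4 j 0 = s.rarr 4 j 0) ∧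
      (∀ j ≤ N, s.arr 25 j 0 ≠ 1 → s'.rarr 5 j 0 = s.rarr 5 j 0 - s.rreg 8) := by
  refine wp_forSet (fun D s' =>
    (∀ k ≤ N, k ∈ D → s.arr 25 k 0 = 1 →
        s'.rarr 3 (s.arr 23 k 0) 0 = s.rarr 3 (s.arr 23 k 0) 0 + s.rreg 8) ∧
      (∀ a, (∀ k ≤ N, k ∈ D → s.arr 25 k 0 = 1 → s.arr 23 k 0 ≠ a) →
        s'.rarr 3 a 0 = s.rarr 3 a 0) ∧
      (∀ j, s'.rarr 4 j 0 = open Classical in if j ∈ D ∧ s.arr 25 j 0 = 1 then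
        s.rarr 4 j 0 - s.rreg 8 else s.rarr 4 j 0) ∧
      (∀ j, s'.rarr 5 j 0 = open Classical in if j ∈ D ∧ s.arr 25 j 0 ≠ 1 then
        s.rarr 5 j 0 - s.rreg 8 else s.rarr 5 j 0))
    15 0 M (h.succ.trans_le hM) (by omega) rfl (fun _ _ _ h => h) ?_ ?_ ?_
  · simp
  · rintro j D s1 hj hjD hfr h9 ⟨i1, i2, i3, i4⟩
    rw [h.succ] at hj
    have a25 : s1.arr 25 = s.arr 25 := hfr.arr 25 rfl
    have a23 : s1.arr 23 = s.arr 23 := hfr.arr 23 rfl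
    have r8 : s1.rreg 8 = s.rreg 8 := hfr.rreg 8 rfl
    refine wp_mono (wp_updateBody (h.of_frame hfr rfl)) ?_
    rintro t s2 ⟨ht, k3, k4, k5⟩
    rw [a25, a23, r8, h9] at k3
    rw [a25, r8, h9] at k4 k5
    refine ⟨ht, fun k hk hkD hku => ?_, fun a ha => ?_, fun k => ?_, fun k => ?_⟩
    · rw [k3]
      by_cases hkj : k = j
      · subst hkj
        rw [if_pos ⟨hku, rfl⟩, i2]
        intro k' hk' hkD' hku' e
        exact hjD (hinj k' hk' k hk hku' hku e ▸ hkD')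
      · rw [if_neg]
        · exact i1 k hk (hkD.resolve_left hkj) hku
        · rintro ⟨hju, e⟩
          exact hkj (hinj k hk j (by omega) hku hju e)
    · rw [k3, if_neg]
      · exact i2 a fun k hk hkD => ha k hk (Or.inr hkD)
      · rintro ⟨hju, e⟩
        exact ha j (by omega) (Or.inl rfl) hju e.symm
    · rw [k4, i3]
      by_cases hkj : k = j
      · subst hkj; simp [hjD]
      · rw [if_neg fun e => hkj e.2]
        have e : k ∈ insert j D ↔ k ∈ D := by simp [hkj]
        split_ifs <;> first | rfl | (exfalso; tauto)
    · rw [k5, i4]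
      by_cases hkj : k = j
      · subst hkj; simp [hjD]
      · rw [if_neg fun e => hkj e.2]
        have e : k ∈ insert j D ↔ k ∈ D := by simp [hkj]
        split_ifs <;> first | rfl | (exfalso; tauto)
  · rintro t s1 hfr ht ⟨i1, i2, i3, i4⟩
    rw [h.succ] at i1 i2 i3 i4
    refine ⟨by simp at ht; omega, hfr, fun k hk => i1 k hk (Nat.lt_succ_of_le hk),
      fun a ha => i2 a fun k hk _ => ha k hk, fun j hj hju => ?_, fun j hj hju => ?_,
      fun j hj hju => ?_⟩
    · rw [i3, if_pos ⟨Nat.lt_succ_of_le hj, hju⟩]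
    · rw [i3, if_neg fun e => hju e.2]
    · rw [i4, if_pos ⟨Nat.lt_succ_of_le hj, hju⟩]

def relaxBody : Prog :=
  block [.load 14 25 9 5] ;; .ite (.eq 14 6) (block [])
    (block (slackCode ++ [.rload 10 5 9 5]) ;;
      .ite (.rlt 9 10) (block [.rstore 5 9 5 9, .store 24 9 5 10]) (block []))

/-- The selected column joins the tree; unless it is free, the least slacks are updated. -/
def joinProg : Prog :=
  block [.store 25 12 5 6, .copy 10 12, .load 11 23 12 5] ;;
  .ite (.eq 11 7) (block []) (forLoop 9 0 7 relaxBody)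

theorem wp_relaxBody (h : HasConstants N s) :
    wp relaxBody s fun t s' => t ≤ 20 * 1 ∧
      (∀ j ≠ s.reg 9, s'.rarr 5 j 0 = s.rarr 5 j 0 ∧ s'.arr 24 j 0 = s.arr 24 j 0) ∧
      (s.arr 25 (s.reg 9) 0 = 1 → s'.arr 24 (s.reg 9) 0 = s.arr 24 (s.reg 9) 0) ∧
      (s.arr 25 (s.reg 9) 0 ≠ 1 →
        (s.rarr 2 (s.reg 11) (s.reg 9) - s.rarr 3 (s.reg 11) 0 - s.rarr 4 (s.reg 9) 0 <
            s.rarr 5 (s.reg 9) 0 ∧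
          s'.rarr 5 (s.reg 9) 0 =
            s.rarr 2 (s.reg 11) (s.reg 9) - s.rarr 3 (s.reg 11) 0 - s.rarr 4 (s.reg 9) 0 ∧
          s'.arr 24 (s.reg 9) 0 = s.reg 10) ∨
        (s.rarr 5 (s.reg 9) 0 ≤
            s.rarr 2 (s.reg 11) (s.reg 9) - s.rarr 3 (s.reg 11) 0 - s.rarr 4 (s.reg 9) 0 ∧
          s'.rarr 5 (s.reg 9) 0 = s.rarr 5 (s.reg 9) 0 ∧
          s'.arr 24 (s.reg 9) 0 = s.arr 24 (s.reg 9) 0)) := by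
  simp [relaxBody, slackCode, wp_seq_iff, wp_ite_iff, wp_block_cons, wp_block_nil, Instr.effect,
    Test.Holds, h.zero, h.one]
  refine ⟨fun hu => by simp [hu], fun hu => ⟨fun hlt => ?_, fun hle => ?_⟩⟩
  · simp [hu, hlt]
    exact fun j hj => ⟨fun e => absurd e hj, fun e => absurd e hj⟩
  · exact fun _ => Or.inr hle

/-- The three alternatives are those in hypothesis `hm` of `SearchTree.step`, the slacks having
already been reduced by `δ`. A free column ends the search, so no further slacks are computed for
it. -/
theorem wp_joinProg (hM : N + 1 ≤ M) (h : HasConstants N s) (hj₁ : s.reg 12 < N) :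
    wp joinProg s fun t s' => t ≤ 40 * M ∧ Frame joinProg s s' ∧ s'.reg 10 = s.reg 12 ∧
      s'.reg 11 = s.arr 23 (s.reg 12) 0 ∧
      (∀ j, s'.arr 25 j 0 = if j = s.reg 12 then 1 else s.arr 25 j 0) ∧
      (∀ j < N, s'.arr 25 j 0 = 1 → s'.arr 24 j 0 = s.arr 24 j 0) ∧
      ∀ j < N, s'.arr 25 j 0 ≠ 1 →
        (s.arr 23 (s.reg 12) 0 = N ∧ s'.rarr 5 j 0 = s.rarr 5 j 0 ∧
          s'.arr 24 j 0 = s.arr 24 j 0) ∨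
        (s.arr 23 (s.reg 12) 0 ≠ N ∧
          s.rarr 2 (s.arr 23 (s.reg 12) 0) j - s.rarr 3 (s.arr 23 (s.reg 12) 0) 0 - s.rarr 4 j 0 <
            s.rarr 5 j 0 ∧
          s'.rarr 5 j 0 =
            s.rarr 2 (s.arr 23 (s.reg 12) 0) j - s.rarr 3 (s.arr 23 (s.reg 12) 0) 0 -
              s.rarr 4 j 0 ∧
          s'.arr 24 j 0 = s.reg 12) ∨
        (s.arr 23 (s.reg 12) 0 ≠ N ∧ s.rarr 5 j 0 ≤
            s.rarr 2 (s.arr 23 (s.reg 12) 0) j - s.rarr 3 (s.arr 23 (s.reg 12) 0) 0 -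
              s.rarr 4 j 0 ∧
          s'.rarr 5 j 0 = s.rarr 5 j 0 ∧ s'.arr 24 j 0 = s.arr 24 j 0) := by
  refine wp_frame (Q := fun t s' => t ≤ 40 * M ∧ s'.reg 10 = s.reg 12 ∧
      s'.reg 11 = s.arr 23 (s.reg 12) 0 ∧
      (∀ j, s'.arr 25 j 0 = if j = s.reg 12 then 1 else s.arr 25 j 0) ∧ _) ?_
    fun t s' h h' => ⟨h'.1, h, h'.2⟩
  refine wp_seq (wp_block ?_)
  set s0 := List.foldl Instr.effect s [.store 25 12 5 6, .copy 10 12, .load 11 23 12 5] with hs0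
  have c0 : HasConstants N s0 := ⟨h.1, h.2, h.3, h.4⟩
  have e10 : s0.reg 10 = s.reg 12 := by simp [hs0, Instr.effect]
  have e11 : s0.reg 11 = s.arr 23 (s.reg 12) 0 := by simp [hs0, Instr.effect, h.zero]
  have a25 : ∀ j, s0.arr 25 j 0 = if j = s.reg 12 then 1 else s.arr 25 j 0 := by
    simp [hs0, Instr.effect, h.zero, h.one]
  have a24 : s0.arr 24 = s.arr 24 := by
    simp [hs0, Instr.effect, Memory.arr_setArr]
  have hr : s0.rarr = s.rarr := rfl
  clear_value s0
  refine wp_ite (fun hb => ?_) (fun hb => ?_)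
  · rw [wp_block_nil]
    simp only [Test.Holds, e11, c0.card] at hb
    refine ⟨by simp; omega, e10, e11, a25, fun j _ _ => by rw [a24], fun j _ _ => Or.inl ⟨hb, ?_, ?_⟩⟩
    · rw [hr]
    · rw [a24]
  · simp only [Test.Holds, e11, c0.card] at hb
    refine wp_forSet (fun D s' =>
      (∀ j, j ∉ D → s'.rarr 5 j 0 = s.rarr 5 j 0 ∧ s'.arr 24 j 0 = s.arr 24 j 0) ∧
      (∀ j ∈ D, s0.arr 25 j 0 = 1 → s'.arr 24 j 0 = s.arr 24 j 0) ∧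
      ∀ j ∈ D, s0.arr 25 j 0 ≠ 1 →
        (s.rarr 2 (s.arr 23 (s.reg 12) 0) j - s.rarr 3 (s.arr 23 (s.reg 12) 0) 0 - s.rarr 4 j 0 <
            s.rarr 5 j 0 ∧
          s'.rarr 5 j 0 =
            s.rarr 2 (s.arr 23 (s.reg 12) 0) j - s.rarr 3 (s.arr 23 (s.reg 12) 0) 0 -
              s.rarr 4 j 0 ∧
          s'.arr 24 j 0 = s.reg 12) ∨
        (s.rarr 5 j 0 ≤
            s.rarr 2 (s.arr 23 (s.reg 12) 0) j - s.rarr 3 (s.arr 23 (s.reg 12) 0) 0 -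
              s.rarr 4 j 0 ∧
          s'.rarr 5 j 0 = s.rarr 5 j 0 ∧ s'.arr 24 j 0 = s.arr 24 j 0))
      20 0 M (c0.card.trans_le (by omega)) (by omega) rfl (fun _ _ _ h => h) ?_ ?_ ?_
    · simp [hr, a24]
    · rintro j D s1 hj hjD hfr h9 ⟨i1, i2, i3⟩
      have b25 : s1.arr 25 = s0.arr 25 := hfr.arr 25 rfl
      have f10 : s1.reg 10 = s.reg 12 := (hfr.reg 10 rfl).trans e10
      have f11 : s1.reg 11 = s.arr 23 (s.reg 12) 0 := (hfr.reg 11 rfl).trans e11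
      have b2 : s1.rarr 2 = s.rarr 2 := (hfr.rarr 2 rfl).trans (by rw [hr])
      have b3 : s1.rarr 3 = s.rarr 3 := (hfr.rarr 3 rfl).trans (by rw [hr])
      have b4 : s1.rarr 4 = s.rarr 4 := (hfr.rarr 4 rfl).trans (by rw [hr])
      obtain ⟨g5, g24⟩ := i1 j hjD
      refine wp_mono (wp_relaxBody (c0.of_frame hfr rfl)) ?_
      rintro t s2 ⟨ht, k1, k2, k3⟩
      rw [h9] at k1 k2 k3
      rw [b25, g24] at k2
      rw [b25, f10, f11, b2, b3, b4, g5, g24] at k3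
      refine ⟨ht, fun k hk => ?_, fun k hk hku => ?_, fun k hk hku => ?_⟩
      · rw [Set.mem_insert_iff, not_or] at hk
        exact ⟨(k1 k hk.1).1.trans (i1 k hk.2).1, (k1 k hk.1).2.trans (i1 k hk.2).2⟩
      · by_cases hkj : k = j
        · subst hkj; exact k2 hku
        · rw [(k1 k hkj).2]
          exact i2 k (hk.resolve_left hkj) hku
      · by_cases hkj : k = j
        · subst hkj; exact k3 hku
        · rw [(k1 k hkj).2, (k1 k hkj).1]
          exact i3 k (hk.resolve_left hkj) hku
    · rintro t s1 hfr ht ⟨i1, i2, i3⟩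
      rw [c0.card] at i2 i3
      have b25 : s1.arr 25 = s0.arr 25 := hfr.arr 25 rfl
      refine ⟨by simp at ht ⊢; omega, (hfr.reg 10 rfl).trans e10, (hfr.reg 11 rfl).trans e11,
        by rw [b25]; exact a25, fun j hj hju => i2 j hj (b25 ▸ hju), fun j hj hju => ?_⟩
      rcases i3 j hj (b25 ▸ hju) with h1 | h1
      · exact Or.inr (Or.inl ⟨hb, h1⟩)
      · exact Or.inr (Or.inr ⟨hb, h1⟩)

end

/-! ### Search and augmentation on the machine -/

section

variable {N M i : ℕ} {s : Memory}

/-- The memory holds a search tree for row `i`. -/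
def HoldsTree (N i : ℕ) (s : Memory) (ρ : ℕ → ℕ) (U : ℕ) : Prop :=
  SearchTree N i (s.rarr 2) (fun a => s.rarr 3 a 0) (fun j => s.rarr 4 j 0) (fun j => s.rarr 5 j 0)
    (fun j => s.arr 23 j 0) (fun j => s.arr 24 j 0) (fun j => s.arr 25 j 0) ρ (s.reg 10) U

/-- The memory holds an assignment of the rows below `i`. -/
def HoldsAssignment (N i : ℕ) (s : Memory) : Prop :=
  PartialAssignment N i (s.rarr 2) (fun a => s.rarr 3 a 0) (fun j => s.rarr 4 j 0)
    (fun j => s.arr 23 j 0)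

/-- The number of columns outside the tree. -/
def Memory.unused (N : ℕ) (s : Memory) : ℕ := ((Finset.range N).filter (s.arr 25 · 0 ≠ 1)).card

theorem Memory.unused_le (N : ℕ) (s : Memory) : s.unused N ≤ N :=
  (Finset.card_filter_le _ _).trans_eq (Finset.card_range N)

theorem Memory.unused_eq {s s' : Memory} {j₁ : ℕ} (hj₁ : j₁ < N) (hu : s.arr 25 j₁ 0 ≠ 1)
    (h : ∀ j, s'.arr 25 j 0 = if j = j₁ then 1 else s.arr 25 j 0) :
    s.unused N = s'.unused N + 1 := by
  have : (Finset.range N).filter (s.arr 25 · 0 ≠ 1) =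
      insert j₁ ((Finset.range N).filter (s'.arr 25 · 0 ≠ 1)) := by
    ext j
    simp only [Finset.mem_filter, Finset.mem_insert, Finset.mem_range, h]
    by_cases hj : j = j₁
    · subst hj; simp [hj₁, hu]
    · simp [hj]
  rw [unused, this, Finset.card_insert_of_notMem (by simp [h]), unused]

def searchBody : Prog := selectProg ;; updateProg ;; joinProg

/-- Each round has linear cost and removes one column from those outside the tree, which bounds the
number of rounds by `N`. The depths exist only in the proof and hence appear existentially. -/
theorem wp_searchBody (hM : N + 1 ≤ M) (h : HasConstants N s) {ρ : ℕ → ℕ}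
    (hT : HoldsTree N i s ρ (s.unused N)) (h11 : s.reg 11 = s.arr 23 (s.reg 10) 0)
    (hcur : s.reg 11 ≠ N) :
    wp searchBody s fun t s' => t ≤ 90 * M ∧ Frame searchBody s s' ∧
      (∃ ρ', HoldsTree N i s' ρ' (s'.unused N)) ∧ s'.reg 11 = s'.arr 23 (s'.reg 10) 0 ∧
      s'.unused N < s.unused N := by
  refine wp_frame (Q := fun t s' => t ≤ 90 * M ∧ (∃ ρ', HoldsTree N i s' ρ' (s'.unused N)) ∧
      s'.reg 11 = s'.arr 23 (s'.reg 10) 0 ∧ s'.unused N < s.unused N) ?_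
    fun t s' h h' => ⟨h'.1, h, h'.2⟩
  rw [h11] at hcur
  unfold HoldsTree at hT
  refine wp_seq (wp_mono (wp_selectProg hM h (hT.exists_unused hcur)) ?_)
  rintro t1 s1 ⟨ht1, f1, hj₁, hj₁u, hδ, hmin⟩
  have c1 := h.of_frame f1 rfl
  have a23 : s1.arr 23 = s.arr 23 := f1.arr 23 rfl
  have a24 : s1.arr 24 = s.arr 24 := f1.arr 24 rfl
  have a25 : s1.arr 25 = s.arr 25 := f1.arr 25 rfl
  have r2 : s1.rarr 2 = s.rarr 2 := f1.rarr 2 rfl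
  have r3 : s1.rarr 3 = s.rarr 3 := f1.rarr 3 rfl
  have r4 : s1.rarr 4 = s.rarr 4 := f1.rarr 4 rfl
  have r5 : s1.rarr 5 = s.rarr 5 := f1.rarr 5 rfl
  refine wp_seq (wp_mono (wp_updateProg hM c1 ?_) ?_)
  · rw [a25, a23]
    intro j hj k hk hju _ e
    refine hT.inj j hj k hk e ?_
    by_cases hjc : j = s.reg 10
    · exact hjc ▸ hcur
    · exact hT.assigned j hj hju hjc
  rintro t2 s2 ⟨ht2, f2, g3, g3', g4, g4', g5⟩
  have c2 := c1.of_frame f2 rfl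
  have b12 : s2.reg 12 = s1.reg 12 := f2.reg 12 rfl
  have b23 : s2.arr 23 = s.arr 23 := (f2.arr 23 rfl).trans a23
  have b24 : s2.arr 24 = s.arr 24 := (f2.arr 24 rfl).trans a24
  have b25 : s2.arr 25 = s.arr 25 := (f2.arr 25 rfl).trans a25
  have q2 : s2.rarr 2 = s.rarr 2 := (f2.rarr 2 rfl).trans r2
  rw [a25, a23, r3] at g3 g3'
  rw [a25, r4] at g4 g4'
  rw [a25, r5] at g5
  refine wp_mono (wp_joinProg hM c2 (b12 ▸ hj₁)) ?_
  rintro t3 s3 ⟨ht3, f3, e10, e11, k25, k24, k5⟩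
  rw [b12] at e10 e11 k25 k5
  rw [b23] at e11 k5
  rw [b25] at k25
  rw [b24] at k24 k5
  rw [q2] at k5
  have d23 : s3.arr 23 = s.arr 23 := (f3.arr 23 rfl).trans b23
  have d2 : s3.rarr 2 = s.rarr 2 := (f3.rarr 2 rfl).trans q2
  have d3 : s3.rarr 3 = s2.rarr 3 := f3.rarr 3 rfl
  have d4 : s3.rarr 4 = s2.rarr 4 := f3.rarr 4 rfl
  have hU := Memory.unused_eq hj₁ hj₁u k25
  refine ⟨by omega, ⟨Function.update ρ (s1.reg 12) (N - s3.unused N), ?_⟩, ?_, by omega⟩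
  · unfold HoldsTree
    rw [d23, d2, d3, d4, e10]
    refine hT.step hcur hj₁ hj₁u hδ hmin hU (fun j hj => ?_) g3 (fun a _ => g3' a) g4 g4' k24
      fun j hj hju => ?_
    · rw [k25]
      split_ifs with hjj
      · simp [hjj]
      · simp [hjj]
    · have hju' : s.arr 25 j 0 ≠ 1 := by
        intro e
        rw [k25] at hju
        split_ifs at hju <;> simp_all
      have := k5 j hj hju
      rw [g5 j hj.le hju'] at this
      exact this
  · rw [e11, d23, e10]

/-- Move the row of the parent column to the current one. -/
def augmentBody : Prog :=
  block [.load 12 24 10 5, .load 14 23 12 5, .store 23 10 5 14, .copy 10 12]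

/-- Add row `i`, the content of register `8`, to the assignment. -/
def rowProg : Prog :=
  startRow ;; .loop (.neg (.eq 11 7)) searchBody ;; .loop (.neg (.eq 10 7)) augmentBody

/-- The depth of the current column decreases and is at most `N`, hence the linear time. The
invariant compares the changing assignment with the tree in the memory before the loop, whose
parents, marks and potentials stay fixed. -/
theorem wp_augmentLoop (hM : N + 1 ≤ M) (h : HasConstants N s) {ρ : ℕ → ℕ} {U : ℕ}
    (hT : HoldsTree N i s ρ U) (hcur : s.arr 23 (s.reg 10) 0 = N) :
    wp (.loop (.neg (.eq 10 7)) augmentBody) s fun t s' => t ≤ 10 * M ∧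
      HoldsAssignment N (i + 1) s' := by
  unfold HoldsTree at hT
  refine wp_loop (fun s' => Augmenting N i (s.rarr 2) (fun a => s.rarr 3 a 0)
    (fun j => s.rarr 4 j 0) (fun j => s.arr 23 j 0) (fun j => s.arr 24 j 0)
    (fun j => s.arr 25 j 0) ρ (fun j => s'.arr 23 j 0) (s'.reg 10)) (fun s' => ρ (s'.reg 10)) 5
    (hT.augmenting hcur) ?_ ?_
  · intro s1 f1 hA hb
    have c1 := h.of_frame f1 rfl
    have a24 : s1.arr 24 = s.arr 24 := f1.arr 24 rfl
    simp only [Test.Holds, c1.card] at hb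
    simp only [augmentBody, wp_block_cons, wp_block_nil, Instr.effect]
    have hlt := lt_of_le_of_ne hA.cur_le hb
    refine ⟨by omega, ?_, ?_⟩
    · have := hA.step (p'' := fun j => if j = s1.reg 10 then s1.arr 23 (s.arr 24 (s1.reg 10) 0) 0
        else s1.arr 23 j 0) hT.tree hb (fun j => rfl)
      simpa [c1.zero, a24] using this
    · have := (hT.tree _ hlt hA.used_cur).2.2.2.1
      simpa [c1.zero, a24] using this
  · intro t s1 f1 ht hA hb
    have c1 := h.of_frame f1 rfl
    simp only [Test.Holds, c1.card, not_not] at hb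
    rw [hb] at hA
    have := hT.rank _ hT.cur_le hT.used_cur
    refine ⟨by omega, ?_⟩
    have := hA.partialAssignment hT.feas
    unfold HoldsAssignment
    rw [f1.rarr 2 rfl, f1.rarr 3 rfl, f1.rarr 4 rfl]
    exact this

theorem wp_rowProg (hM : N + 1 ≤ M) (h : HasConstants N s) (h8 : s.reg 8 < N)
    (hA : HoldsAssignment N (s.reg 8) s) :
    wp rowProg s fun t s' => t ≤ 140 * M ^ 2 ∧ HoldsAssignment N (s.reg 8 + 1) s' := by
  refine wp_seq (wp_mono (wp_startRow hM h) ?_)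
  rintro t0 s0 ⟨ht0, f0, e10, e11, e23, e23', e5, e24, e25⟩
  have c0 := h.of_frame f0 rfl
  have r2 : s0.rarr 2 = s.rarr 2 := f0.rarr 2 rfl
  have r3 : s0.rarr 3 = s.rarr 3 := f0.rarr 3 rfl
  have r4 : s0.rarr 4 = s.rarr 4 := f0.rarr 4 rfl
  refine wp_seq (wp_loop (fun s' => (∃ ρ, HoldsTree N (s.reg 8) s' ρ (s'.unused N)) ∧
    s'.reg 11 = s'.arr 23 (s'.reg 10) 0) (Memory.unused N) (90 * M) ?_ ?_ ?_)
  · refine ⟨⟨fun _ => 0, ?_⟩, ?_⟩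
    · have hT := PartialAssignment.searchTree hA h8 e23 e23' e5 e24 e25
      have hU : s0.unused N = N := by
        rw [Memory.unused, Finset.filter_true_of_mem, Finset.card_range]
        intro j hj
        rw [Finset.mem_range] at hj
        rw [Ne, e25 j hj.le]
        omega
      unfold HoldsTree
      rw [r2, r3, r4, e10, hU]
      exact hT
    · rw [e11, e10, e23']
  · rintro s1 f1 ⟨⟨ρ, hT⟩, h11⟩ hb
    have c1 := c0.of_frame f1 rfl
    simp only [Test.Holds, c1.card] at hb
    exact wp_mono (wp_searchBody hM c1 hT h11 hb) fun t s2 h2 =>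
      ⟨h2.1, ⟨h2.2.2.1, h2.2.2.2.1⟩, h2.2.2.2.2⟩
  · rintro t1 s1 f1 ht1 ⟨⟨ρ, hT⟩, h11⟩ hb
    have c1 := c0.of_frame f1 rfl
    simp only [Test.Holds, c1.card, not_not] at hb
    refine wp_mono (wp_augmentLoop hM c1 hT (h11 ▸ hb)) ?_
    rintro t2 s2 ⟨ht2, h2⟩
    refine ⟨?_, h2⟩
    have h3 := Nat.mul_le_mul_right (90 * M + 1) ((s0.unused_le N).trans (by omega : N ≤ M))
    have h4 : M ≤ M ^ 2 := Nat.le_self_pow (by omega) M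
    nlinarith

/-- Row `i` is assigned to the column in entry `i` of array `14`. -/
def hungarianProg : Prog :=
  block [.copy 13 7, .inc 13, .rsub 9 0 6] ;;
  forLoop 8 0 7 (block [.store 23 8 5 7, .rstore 3 8 5 9, .rstore 4 8 5 0]) ;;
  forLoop 8 0 7 rowProg ;;
  forLoop 9 0 7 (block [.load 14 23 9 5, .store 14 14 5 9])

/-- Given costs that are at least `-H`, the program finds an assignment of least total cost, as
witnessed by an optimal dual solution. -/
theorem wp_hungarianProg (hM : N + 1 ≤ M) (h5 : s.reg 5 = 0) (h6 : s.reg 6 = 1) (h7 : s.reg 7 = N)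
    (hr0 : s.rreg 0 = 0) (hc : ∀ a < N, ∀ b < N, -s.rreg 6 ≤ s.rarr 2 a b) :
    wp hungarianProg s fun t s' => t ≤ 200 * M ^ 3 ∧ Frame hungarianProg s s' ∧
      (∀ a < N, s'.arr 14 a 0 < N) ∧
      (∀ a < N, ∀ b < N, s'.arr 14 a 0 = s'.arr 14 b 0 → a = b) ∧
      ∃ u v : ℕ → ℝ, (∀ a < N, ∀ b < N, u a + v b ≤ s.rarr 2 a b) ∧
        ∀ a < N, s.rarr 2 a (s'.arr 14 a 0) = u a + v (s'.arr 14 a 0) := by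
  refine wp_frame (Q := fun t s' => t ≤ 200 * M ^ 3 ∧ (∀ a < N, s'.arr 14 a 0 < N) ∧
      (∀ a < N, ∀ b < N, s'.arr 14 a 0 = s'.arr 14 b 0 → a = b) ∧
      ∃ u v : ℕ → ℝ, (∀ a < N, ∀ b < N, u a + v b ≤ s.rarr 2 a b) ∧
        ∀ a < N, s.rarr 2 a (s'.arr 14 a 0) = u a + v (s'.arr 14 a 0)) ?_
    fun t s' h h' => ⟨h'.1, h, h'.2⟩
  have hM1 : 1 ≤ M := by omega
  refine wp_seq (wp_block ?_)
  set s0 := List.foldl Instr.effect s [.copy 13 7, .inc 13, .rsub 9 0 6] with hs0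
  have c0 : HasConstants N s0 := by
    constructor <;> simp [hs0, Instr.effect, h5, h6, h7]
  have e9 : s0.rreg 9 = -s.rreg 6 := by simp [hs0, Instr.effect, hr0]
  have e0 : s0.rreg 0 = 0 := by simp [hs0, Instr.effect, hr0]
  have hr : s0.rarr 2 = s.rarr 2 := rfl
  clear_value s0
  refine wp_seq (wp_forLoop (fun k s' => (∀ j < k, s'.arr 23 j 0 = N) ∧
    (∀ j < k, s'.rarr 3 j 0 = -s.rreg 6) ∧ ∀ j < k, s'.rarr 4 j 0 = 0) 4 0 M
    (c0.card.trans_le (by omega)) hM1 (Nat.zero_le _) rfl (by simp) ?_ ?_)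
  · rintro k s1 _ hk f1 h8 ⟨i1, i2, i3⟩
    have c1 := c0.of_frame f1 rfl
    have g9 : s1.rreg 9 = -s.rreg 6 := (f1.rreg 9 rfl).trans e9
    have g0 : s1.rreg 0 = 0 := (f1.rreg 0 rfl).trans e0
    simp only [wp_block_cons, wp_block_nil, Instr.effect]
    refine ⟨by simp, fun j hj => ?_, fun j hj => ?_, fun j hj => ?_⟩
    · simp [c1.zero, c1.card, h8]
      exact fun hjk => i1 j (by omega)
    · simp [c1.zero, h8, g9]
      exact fun hjk => i2 j (by omega)
    · simp [c1.zero, h8, g0]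
      exact fun hjk => i3 j (by omega)
  rintro t1 s1 f1 ht1 ⟨i1, i2, i3⟩
  rw [c0.card] at i1 i2 i3
  have c1 := c0.of_frame f1 rfl
  have r2 : s1.rarr 2 = s.rarr 2 := (f1.rarr 2 rfl).trans hr
  refine wp_seq (wp_forLoop (fun k s' => HoldsAssignment N k s') 140 2 M
    (c1.card.trans_le (by omega)) hM1 (Nat.zero_le _) rfl ?_ ?_ ?_)
  -- The empty assignment is feasible with row potentials `-s.rreg 6` and column potentials zero;
  -- this is the purpose of the lower bound on the costs.
  · constructor
    · intro a ha b hb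
      have := hc a ha b hb
      simp [i2 a ha, i3 b hb, r2]
      exact this
    · exact fun j hj hjN => absurd (i1 j hj) hjN
    · exact fun j hj => Or.inr (i1 j hj)
    · exact fun j hj k _ _ hjN => absurd (i1 j hj) hjN
    · intro a ha; omega
  · rintro k s2 _ hk f2 h8 hA
    have c2 := c1.of_frame f2 rfl
    rw [c1.card] at hk
    have := wp_rowProg hM c2 (h8 ▸ hk) (h8 ▸ hA)
    rw [h8] at this
    exact this
  rintro t2 s2 f2 ht2 hA
  rw [c1.card] at hA
  have c2 := c1.of_frame f2 rfl
  have q2 : s2.rarr 2 = s.rarr 2 := (f2.rarr 2 rfl).trans r2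
  unfold HoldsAssignment at hA
  rw [q2] at hA
  -- All `N` rows are assigned to different columns, so by counting no column is left free.
  have hne : ∀ j < N, s2.arr 23 j 0 ≠ N := by
    have hinv : ∀ a : Fin N, ∃ j : Fin N, s2.arr 23 j 0 = a := fun a => by
      obtain ⟨j, hj, e⟩ := hA.surj a a.2
      exact ⟨⟨j, hj⟩, e⟩
    choose g hg using hinv
    have hginj : Function.Injective g := fun a b e => Fin.ext (by rw [← hg a, ← hg b, e])
    intro j hj e
    obtain ⟨a, ha⟩ := (Finite.injective_iff_surjective.mp hginj) ⟨j, hj⟩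
    have h1 : s2.arr 23 j 0 = a := by
      have := hg a
      rwa [ha] at this
    have := a.2
    omega
  refine wp_forLoop (fun k s' => ∀ j < k, s'.arr 14 (s2.arr 23 j 0) 0 = j) 3 0 M
    (c2.card.trans_le (by omega)) hM1 (Nat.zero_le _) rfl (by simp) ?_ ?_
  · rintro k s3 _ hk f3 h9 hI
    have c3 := c2.of_frame f3 rfl
    rw [c2.card] at hk
    have a23 : s3.arr 23 = s2.arr 23 := f3.arr 23 rfl
    simp only [wp_block_cons, wp_block_nil, Instr.effect]
    refine ⟨by simp, fun j hj => ?_⟩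
    simp [c3.zero, h9, a23]
    split_ifs with hjk
    · exact (hA.inj j (by omega) k hk hjk (hne j (by omega))).symm
    · refine hI j ?_
      have : j ≠ k := by rintro rfl; exact hjk rfl
      omega
  rintro t3 s3 f3 ht3 hI
  rw [c2.card] at hI
  have hrow : ∀ a < N, s3.arr 14 a 0 < N ∧ s2.arr 23 (s3.arr 14 a 0) 0 = a := by
    intro a ha
    obtain ⟨j, hj, e⟩ := hA.surj a ha
    have e' : s2.arr 23 j 0 = a := e
    have := hI j hj
    rw [e'] at this
    rw [this]
    exact ⟨hj, e'⟩
  refine ⟨?_, fun a ha => (hrow a ha).1, fun a ha b hb e => ?_, _, _, hA.feas, fun a ha => ?_⟩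
  · have h4 : M ≤ M ^ 3 := Nat.le_self_pow (by omega) M
    simp at ht1 ht2 ht3 ⊢
    omega
  · rw [← (hrow a ha).2, ← (hrow b hb).2, e]
  · obtain ⟨h1, h2⟩ := hrow a ha
    have := hA.tight _ h1 (hne _ h1)
    simp only [h2] at this
    exact this

end

section

/-! ### Matchings as permutations -/

section

variable {V : Type} [Fintype V] {G : V → V → Prop}

def toGraph (τ : V → V) : V ↪ V × V where
  toFun v := (v, τ v)
  inj' _ _ h := congrArg Prod.fst h

/-- The pairs `(v, τ v)`. -/
def graphOf (τ : V → V) : Finset (V × V) := Finset.univ.map (toGraph τ)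

theorem mem_graphOf {τ : V → V} {e : V × V} : e ∈ graphOf τ ↔ τ e.1 = e.2 := by
  simp only [graphOf, Finset.mem_map, Finset.mem_univ, true_and]
  exact ⟨fun ⟨v, h⟩ => by rw [← h]; rfl, fun h => ⟨e.1, Prod.ext rfl h⟩⟩

theorem sum_graphOf {A : Type} [AddCommMonoid A] (τ : V → V) (c : V × V → A) :
    ∑ e ∈ graphOf τ, c e = ∑ v, c (v, τ v) :=
  Finset.sum_map _ _ _

theorem isPerfectMatching_graphOf {τ : V → V} (hτ : Function.Injective τ) (h : ∀ v, G v (τ v)) :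
    IsPerfectMatching G (graphOf τ) where
  sub e he := by rw [← mem_graphOf.mp he]; exact h _
  left e he f hf hef := Prod.ext hef (by rw [← mem_graphOf.mp he, ← mem_graphOf.mp hf, hef])
  right e he f hf hef := Prod.ext
    (hτ (by rw [mem_graphOf.mp he, mem_graphOf.mp hf, hef])) hef
  card := by simp [graphOf]

/-- As many edges as vertices, with distinct left ends, cover each left vertex once and so define a
map; distinct right ends make it injective, hence bijective by finiteness. -/
theorem IsPerfectMatching.exists_perm {M : Finset (V × V)} (h : IsPerfectMatching G M) :
    ∃ τ : Equiv.Perm V, M = graphOf τ := by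
  classical
  have himg : M.image Prod.fst = Finset.univ := by
    apply Finset.eq_univ_of_card
    rw [Finset.card_image_of_injOn fun e he f hf => h.left e he f hf, h.card]
  have hex : ∀ v, ∃ w, (v, w) ∈ M := by
    intro v
    have : v ∈ M.image Prod.fst := himg ▸ Finset.mem_univ v
    obtain ⟨e, he, rfl⟩ := Finset.mem_image.mp this
    exact ⟨e.2, he⟩
  choose τ hτ using hex
  have hinj : Function.Injective τ := fun a b e =>
    congrArg Prod.fst (h.right _ (hτ a) _ (hτ b) e)
  refine ⟨Equiv.ofBijective τ (Finite.injective_iff_bijective.mp hinj), ?_⟩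
  ext e
  rw [mem_graphOf]
  constructor
  · intro he
    exact congrArg Prod.snd (h.left _ (hτ e.1) e he rfl)
  · intro he
    have := hτ e.1
    rwa [show τ e.1 = e.2 from he] at this

/-- A sum of terms that are at least `-B` is not bounded by a sum of terms that are at most `B` if
one of its terms is large. -/
theorem lt_of_sum_le_sum {x y : V → ℝ} {B H : ℝ} (hx : ∀ v, -B ≤ x v) (hy : ∀ v, y v ≤ B)
    (hH : (2 * Fintype.card V + 1) * B ≤ H) (hB : 0 < B) (h : ∑ v, x v ≤ ∑ v, y v) (v : V) :
    x v < H := by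
  -- With `N` the number of vertices, `x v + B ≤ ∑ (x + B) ≤ ∑ y + N * B ≤ 2 * N * B`, which is less
  -- than `H` as `B > 0`.
  have h1 : x v + B ≤ ∑ v, (x v + B) :=
    Finset.single_le_sum (f := fun v => x v + B) (fun v _ => by linarith [hx v]) (Finset.mem_univ v)
  have h2 : ∑ v, y v ≤ Fintype.card V * B := by
    simpa using Finset.sum_le_card_nsmul Finset.univ y B fun v _ => hy v
  rw [Finset.sum_add_distrib] at h1
  simp only [Finset.sum_const, Finset.card_univ, nsmul_eq_mul] at h1
  nlinarith

end

/-! ### Penalties for infinite costs and for missing edges -/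

variable {n m p : ℕ} {S : StructuredSystem n m p} {P : CostMatrix m p} {b q h : ℝ}

theorem bipCost_le (hb : 1 ≤ b) (hP : ∀ i j, ∀ x : ℝ, P i j = x → |x| ≤ b)
    (e : Vertex n m p × Vertex n m p) {x : ℝ} (hx : bipCost P e = x) : |x| ≤ b := by
  have h0 : (0 : WithTop ℝ) = x → |x| ≤ b := fun h => by
    have : (0 : ℝ) = x := WithTop.coe_injective h
    rw [← this, abs_zero]
    linarith
  rcases e with ⟨i | i | i, j | j | j⟩ <;> first | exact h0 hx | exact hP _ _ _ hx

theorem pairCost_of_not_adj {v w : Vertex n m p} (hvw : ¬ BipAdj S (fun _ _ => true) v w) :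
    pairCost S P q h v w = h := if_neg hvw

theorem pairCost_of_top {v w : Vertex n m p} (hvw : BipAdj S (fun _ _ => true) v w)
    (hc : bipCost P (v, w) = ⊤) : pairCost S P q h v w = q := by
  rw [pairCost, if_pos hvw, hc, WithTop.untopD_top]

theorem coe_pairCost {v w : Vertex n m p} (hvw : BipAdj S (fun _ _ => true) v w)
    (hc : bipCost P (v, w) ≠ ⊤) : (pairCost S P q h v w : WithTop ℝ) = bipCost P (v, w) := by
  rw [pairCost, if_pos hvw]
  lift bipCost P (v, w) to ℝ using hc with x
  rfl

theorem abs_pairCost_le (hb : 1 ≤ b) (hP : ∀ i j, ∀ x : ℝ, P i j = x → |x| ≤ b)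
    {v w : Vertex n m p} (hvw : BipAdj S (fun _ _ => true) v w) (hc : bipCost P (v, w) ≠ ⊤) :
    |pairCost S P q h v w| ≤ b :=
  bipCost_le hb hP _ (coe_pairCost hvw hc).symm

theorem neg_le_pairCost (hb : 1 ≤ b) (hP : ∀ i j, ∀ x : ℝ, P i j = x → |x| ≤ b) (hq : 0 ≤ q)
    (hh : 0 ≤ h) (v w : Vertex n m p) : -b ≤ pairCost S P q h v w := by
  by_cases hvw : BipAdj S (fun _ _ => true) v w
  · by_cases hc : bipCost P (v, w) = ⊤
    · rw [pairCost_of_top hvw hc]; linarith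
    · exact (abs_le.mp (abs_pairCost_le hb hP hvw hc)).1
  · rw [pairCost_of_not_adj hvw]; linarith

theorem pairCost_le (hb : 1 ≤ b) (hP : ∀ i j, ∀ x : ℝ, P i j = x → |x| ≤ b) (hq : b ≤ q)
    {v w : Vertex n m p} (hvw : BipAdj S (fun _ _ => true) v w) : pairCost S P q h v w ≤ q := by
  by_cases hc : bipCost P (v, w) = ⊤
  · rw [pairCost_of_top hvw hc]
  · exact (abs_le.mp (abs_pairCost_le hb hP hvw hc)).2.trans hq

theorem card_vertex : Fintype.card (Vertex n m p) = n + m + p := by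
  simp [Nat.add_assoc]

theorem le_scale {N : ℕ} {x : ℝ} (hx : 0 ≤ x) : x ≤ (2 * (N : ℝ) + 1) * x := by
  have : 0 ≤ (N : ℝ) * x := by positivity
  linarith

/-- An optimal assignment avoids pairs that are not edges if this is possible. -/
theorem adj_of_optimal (hb : 1 ≤ b) (hP : ∀ i j, ∀ x : ℝ, P i j = x → |x| ≤ b)
    (hq : q = (2 * (n + m + p : ℕ) + 1) * b) (hh : h = (2 * (n + m + p : ℕ) + 1) * q)
    {σ : Equiv.Perm (Vertex n m p)}
    (hσ : ∀ τ : Equiv.Perm (Vertex n m p),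
      ∑ v, pairCost S P q h v (σ v) ≤ ∑ v, pairCost S P q h v (τ v))
    (hM : ∃ M, IsPerfectMatching (BipAdj S fun _ _ => true) M) (v : Vertex n m p) :
    BipAdj S (fun _ _ => true) v (σ v) := by
  obtain ⟨M, hM⟩ := hM
  obtain ⟨τ, rfl⟩ := hM.exists_perm
  have hbq : b ≤ q := hq ▸ le_scale (by linarith)
  have hqh : q ≤ h := hh ▸ le_scale (by linarith)
  by_contra hcon
  -- Compared with a perfect matching, all of whose pairs cost at most `q`, an optimal assignment
  -- cannot afford a pair of cost `h`.
  have := lt_of_sum_le_sum (H := h) (B := q)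
    (fun v => (neg_le_neg hbq).trans (neg_le_pairCost hb hP (by linarith) (by linarith) v (σ v)))
    (fun v => pairCost_le hb hP hbq (hM.sub (v, τ v) (mem_graphOf.mpr rfl)))
    (by rw [card_vertex, hh]) (by linarith) (hσ τ) v
  rw [pairCost_of_not_adj hcon] at this
  exact lt_irrefl _ this

/-- An optimal assignment without pairs that are not edges is a matching of minimum cost. -/
theorem isMinCostPerfectMatching_of_optimal (hb : 1 ≤ b)
    (hP : ∀ i j, ∀ x : ℝ, P i j = x → |x| ≤ b)
    (hq : q = (2 * (n + m + p : ℕ) + 1) * b) (hh : h = (2 * (n + m + p : ℕ) + 1) * q)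
    {σ : Equiv.Perm (Vertex n m p)}
    (hσ : ∀ τ : Equiv.Perm (Vertex n m p),
      ∑ v, pairCost S P q h v (σ v) ≤ ∑ v, pairCost S P q h v (τ v))
    (hadj : ∀ v, BipAdj S (fun _ _ => true) v (σ v)) :
    IsMinCostPerfectMatching (BipAdj S fun _ _ => true) (bipCost P) (graphOf σ) where
  perfect := isPerfectMatching_graphOf σ.injective hadj
  min M' hM' := by
    obtain ⟨τ, rfl⟩ := hM'.exists_perm
    have hbq : b ≤ q := hq ▸ le_scale (by linarith)
    have hqh : q ≤ h := hh ▸ le_scale (by linarith)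
    have hτ : ∀ v, BipAdj S (fun _ _ => true) v (τ v) := fun v =>
      hM'.sub (v, τ v) (mem_graphOf.mpr rfl)
    rw [sum_graphOf, sum_graphOf]
    -- A competitor of infinite cost is never better. Against a competitor of finite cost, the same
    -- estimate one level below (`B = b`, `H = q`) shows that `σ` uses no infinite cost, and then
    -- all sums are real.
    by_cases htop : ∃ v, bipCost P (v, τ v) = ⊤
    · obtain ⟨v, hv⟩ := htop
      rw [(WithTop.sum_eq_top.mpr ⟨v, Finset.mem_univ v, hv⟩ : ∑ v, bipCost P (v, τ v) = ⊤)]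
      exact le_top
    push Not at htop
    have hfin : ∀ v, bipCost P (v, σ v) ≠ ⊤ := fun v hv => by
      have := lt_of_sum_le_sum (H := q) (B := b)
        (fun v => neg_le_pairCost hb hP (by linarith) (by linarith) v (σ v))
        (fun v => (abs_le.mp (abs_pairCost_le hb hP (hτ v) (htop v))).2)
        (by rw [card_vertex, hq]) (by linarith) (hσ τ) v
      rw [pairCost_of_top (hadj v) hv] at this
      exact lt_irrefl _ this
    have e1 : ∑ v, bipCost P (v, σ v) = ((∑ v, pairCost S P q h v (σ v) : ℝ) : WithTop ℝ) := by
      rw [WithTop.coe_sum]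
      exact Finset.sum_congr rfl fun v _ => (coe_pairCost (hadj v) (hfin v)).symm
    have e2 : ∑ v, bipCost P (v, τ v) = ((∑ v, pairCost S P q h v (τ v) : ℝ) : WithTop ℝ) := by
      rw [WithTop.coe_sum]
      exact Finset.sum_congr rfl fun v _ => (coe_pairCost (hτ v) (htop v)).symm
    rw [e1, e2]
    exact WithTop.coe_le_coe.mpr (hσ τ)

/-- A permutation with a dual certificate is optimal. -/
theorem sum_le_sum_of_dual {V : Type} [Fintype V] {w : V → V → ℝ} {u u' : V → ℝ}
    {σ : Equiv.Perm V} (hle : ∀ v v', u v + u' v' ≤ w v v') (heq : ∀ v, w v (σ v) = u v + u' (σ v))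
    (τ : Equiv.Perm V) : ∑ v, w v (σ v) ≤ ∑ v, w v (τ v) := by
  calc ∑ v, w v (σ v) = ∑ v, (u v + u' (σ v)) := Finset.sum_congr rfl fun v _ => heq v
    -- The total of the potentials does not depend on the permutation; it is the value of the dual
    -- solution.
    _ = ∑ v, (u v + u' (τ v)) := by
      rw [Finset.sum_add_distrib, Finset.sum_add_distrib, Equiv.sum_comp σ u', Equiv.sum_comp τ u']
    _ ≤ _ := Finset.sum_le_sum fun v _ => hle _ _

theorem vertexKind_eq_one_iff {v : Vertex n m p} {i : Fin m} :
    vertexKind v = 1 ∧ vertexIndex v = i ↔ v = .inr (.inl i) := by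
  rcases v with j | j | j <;> simp [vertexKind, vertexIndex, Fin.ext_iff]

theorem vertexKind_eq_two_iff {v : Vertex n m p} {i : Fin p} :
    vertexKind v = 2 ∧ vertexIndex v = i ↔ v = .inr (.inr i) := by
  rcases v with j | j | j <;> simp [vertexKind, vertexIndex, Fin.ext_iff]

theorem HoldsGraph.exists_perm {s : Memory} {r : ℕ → ℕ} (hr : ∀ a < n + m + p, r a < n + m + p)
    (hinj : ∀ a < n + m + p, ∀ b < n + m + p, r a = r b → a = b)
    (hopt : ∃ u v : ℕ → ℝ,
      (∀ a < n + m + p, ∀ b < n + m + p, u a + v b ≤ s.rarr 2 a b) ∧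
        ∀ a < n + m + p, s.rarr 2 a (r a) = u a + v (r a)) (hG : HoldsGraph S P q h s) :
    ∃ σ : Equiv.Perm (Vertex n m p), (∀ v, vertexNumber (σ v) = r (vertexNumber v)) ∧
      ∀ τ : Equiv.Perm (Vertex n m p),
        ∑ v, pairCost S P q h v (σ v) ≤ ∑ v, pairCost S P q h v (τ v) := by
  choose σ hσ using fun v : Vertex n m p => exists_vertexNumber (hr _ (vertexNumber_lt v))
  have hσi : Function.Injective σ := fun v w e => vertexNumber_injective
    (hinj _ (vertexNumber_lt v) _ (vertexNumber_lt w) (by rw [← hσ, ← hσ, e]))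
  obtain ⟨u, v, h1, h2⟩ := hopt
  refine ⟨Equiv.ofBijective σ (Finite.injective_iff_bijective.mp hσi), hσ,
    sum_le_sum_of_dual (u := fun a => u (vertexNumber a)) (u' := fun a => v (vertexNumber a)) ?_ ?_⟩
  · intro a b
    rw [← hG.cost]
    exact h1 _ (vertexNumber_lt a) _ (vertexNumber_lt b)
  · intro a
    rw [Equiv.ofBijective_apply, ← hG.cost, hσ]
    exact h2 _ (vertexNumber_lt a)

end

section

/-! ## The two-stage algorithm -/

variable {n m p : ℕ} {S : StructuredSystem n m p} {P : CostMatrix m p} {s : Memory} {M N : ℕ}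

/-- Clear register `3` if the assignment contains a pair that is not an edge. -/
def checkProg : Prog :=
  forLoop 8 0 7 (block [.load 14 14 8 5, .load 14 22 8 14] ;;
    .ite (.eq 14 6) (block []) (block [.copy 3 5]))

theorem wp_checkProg (hM : N + 1 ≤ M) (h5 : s.reg 5 = 0) (h6 : s.reg 6 = 1) (h7 : s.reg 7 = N) :
    wp checkProg s fun t s' => t ≤ 15 * M ∧ Frame checkProg s s' ∧
      ((s'.reg 3 = s.reg 3 ∧ ∀ a < N, s.arr 22 a (s.arr 14 a 0) = 1) ∨
        (s'.reg 3 = 0 ∧ ∃ a < N, s.arr 22 a (s.arr 14 a 0) ≠ 1)) := by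
  refine wp_forSet (fun D s' => (s'.reg 3 = s.reg 3 ∧ ∀ a ∈ D, s.arr 22 a (s.arr 14 a 0) = 1) ∨
    (s'.reg 3 = 0 ∧ ∃ a < N, s.arr 22 a (s.arr 14 a 0) ≠ 1)) 10 0 M (by omega) (by omega) rfl
    (fun _ _ _ h => h) (by simp) ?_ ?_
  · intro a D s1 ha _ hfr h8 hI
    have e5 : s1.reg 5 = 0 := (hfr.reg 5 rfl).trans h5
    have e6 : s1.reg 6 = 1 := (hfr.reg 6 rfl).trans h6
    have e14 : s1.arr 14 = s.arr 14 := hfr.arr 14 rfl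
    have e22 : s1.arr 22 = s.arr 22 := hfr.arr 22 rfl
    rw [h7] at ha
    simp [wp_seq_iff, wp_ite_iff, wp_block_cons, wp_block_nil, Instr.effect, Test.Holds, e5, e6,
      e14, e22, h8]
    refine ⟨fun h1 => ?_, fun h1 => Or.inr ⟨a, ha, h1⟩⟩
    rcases hI with hI | hI
    · exact Or.inl ⟨hI.1, h1, hI.2⟩
    · exact Or.inr hI
  · intro t s1 hfr ht hI
    rw [h7] at hI
    exact ⟨by simp at ht; omega, hfr, hI⟩

/-- Read off the feedback edges of the assignment. -/
def extractProg : Prog :=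
  forLoop 8 0 7 (block [.load 9 14 8 5, .load 14 20 8 5, .load 15 20 9 5, .load 10 21 8 5,
      .load 11 21 9 5] ;;
    .ite (.eq 14 6) (.ite (.eq 15 26) (block [.store 15 10 11 6]) (block [])) (block []))

theorem wp_extractProg (hM : N + 1 ≤ M) (h5 : s.reg 5 = 0) (h6 : s.reg 6 = 1) (h7 : s.reg 7 = N)
    (h26 : s.reg 26 = 2) (h15 : s.arr 15 = fun _ _ => 0) :
    wp extractProg s fun t s' => t ≤ 20 * M ∧ Frame extractProg s s' ∧ ∀ i j,
      (s'.arr 15 i j = 1 ↔ ∃ a < N, s.arr 20 a 0 = 1 ∧ s.arr 21 a 0 = i ∧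
        s.arr 20 (s.arr 14 a 0) 0 = 2 ∧ s.arr 21 (s.arr 14 a 0) 0 = j) ∧ s'.arr 15 i j ≤ 1 := by
  refine wp_forSet (fun D s' => ∀ i j,
    (s'.arr 15 i j = 1 ↔ ∃ a ∈ D, s.arr 20 a 0 = 1 ∧ s.arr 21 a 0 = i ∧
      s.arr 20 (s.arr 14 a 0) 0 = 2 ∧ s.arr 21 (s.arr 14 a 0) 0 = j) ∧ s'.arr 15 i j ≤ 1)
    15 0 M (by omega) (by omega) rfl (fun _ _ _ h => h) (by simp [h15]) ?_ ?_
  · intro a D s1 ha _ hfr h8 hI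
    have e5 : s1.reg 5 = 0 := (hfr.reg 5 rfl).trans h5
    have e6 : s1.reg 6 = 1 := (hfr.reg 6 rfl).trans h6
    have e26 : s1.reg 26 = 2 := (hfr.reg 26 rfl).trans h26
    have e14 : s1.arr 14 = s.arr 14 := hfr.arr 14 rfl
    have e20 : s1.arr 20 = s.arr 20 := hfr.arr 20 rfl
    have e21 : s1.arr 21 = s.arr 21 := hfr.arr 21 rfl
    simp [wp_seq_iff, wp_ite_iff, wp_block_cons, wp_block_nil, Instr.effect, Test.Holds, e5, e6,
      e26, e14, e20, e21, h8]
    refine ⟨fun h1 => ⟨fun h2 i j => ?_, fun h2 => ?_⟩, fun h1 => ?_⟩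
    · obtain ⟨k1, k2⟩ := hI i j
      by_cases hc : i = s.arr 21 a 0 ∧ j = s.arr 21 (s.arr 14 a 0) 0
      · simp [h1, h2, hc.1, hc.2]
      · refine ⟨⟨fun h => Or.inr (k1.mp (h (not_and.mp hc))),
          fun h _ => k1.mpr (h.resolve_left ?_)⟩, by rwa [if_neg hc]⟩
        rintro ⟨-, rfl, -, rfl⟩
        exact hc ⟨rfl, rfl⟩
    · simpa [h2] using hI
    · simpa [h1] using hI
  · intro t s1 hfr ht hI
    rw [h7] at hI
    exact ⟨by simp at ht; omega, hfr, hI⟩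

/-- The union of the two feedback patterns. -/
def unionProg : Prog :=
  forLoop 8 0 1 (forLoop 9 0 2 (block [.load 14 13 8 9, .load 15 15 8 9] ;;
    .ite (.eq 14 6) (block [.store 16 8 9 6])
      (.ite (.eq 15 6) (block [.store 16 8 9 6]) (block []))))

theorem wp_unionProg (hM1 : 1 ≤ M) (hm : s.reg 1 ≤ M) (hp : s.reg 2 ≤ M) (h6 : s.reg 6 = 1)
    (h16 : s.arr 16 = fun _ _ => 0) :
    wp unionProg s fun t s' => t ≤ 20 * M ^ 2 ∧ Frame unionProg s s' ∧
      ∀ i < s.reg 1, ∀ j < s.reg 2,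
        (s'.arr 16 i j = 1 ↔ s.arr 13 i j = 1 ∨ s.arr 15 i j = 1) ∧ s'.arr 16 i j ≤ 1 := by
  refine wp_forSet₂ (fun D s' => ∀ i j,
    (s'.arr 16 i j = 1 ↔ (i, j) ∈ D ∧ (s.arr 13 i j = 1 ∨ s.arr 15 i j = 1)) ∧ s'.arr 16 i j ≤ 1)
    12 0 M hm hp hM1 rfl (fun _ _ _ h => h) (fun _ _ _ h => h) (by simp [h16]) ?_ ?_
  · intro i j D s1 hi hj _ hfr h8 h9 hI
    have e6 : s1.reg 6 = 1 := (hfr.reg 6 rfl).trans h6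
    have e13 : s1.arr 13 = s.arr 13 := hfr.arr 13 rfl
    have e15 : s1.arr 15 = s.arr 15 := hfr.arr 15 rfl
    have hset : (s.arr 13 i j = 1 ∨ s.arr 15 i j = 1) → ∀ k l,
        ((if k = i ∧ l = j then 1 else s1.arr 16 k l) = 1 ↔
          (k = i ∧ l = j ∨ (k, l) ∈ D) ∧ (s.arr 13 k l = 1 ∨ s.arr 15 k l = 1)) ∧
        (if k = i ∧ l = j then 1 else s1.arr 16 k l) ≤ 1 := by
      intro hor k l
      by_cases hc : k = i ∧ l = j
      · obtain ⟨rfl, rfl⟩ := hc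
        simpa using hor
      · rw [if_neg hc, or_iff_right hc]
        exact hI k l
    simp [wp_seq_iff, wp_ite_iff, wp_block_cons, wp_block_nil, Instr.effect, Test.Holds, e6,
      e13, e15, h8, h9]
    refine ⟨fun h1 => by simpa using hset (Or.inl h1),
      fun h1 => ⟨fun h2 => by simpa using hset (Or.inr h2), fun h2 k l => ?_⟩⟩
    obtain ⟨k1, k2⟩ := hI k l
    refine ⟨k1.trans (and_congr_left fun hor => (or_iff_right ?_).symm), k2⟩
    rintro ⟨rfl, rfl⟩
    exact hor.elim h1 h2
  · intro t s1 hfr ht hI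
    refine ⟨ht, hfr, fun i hi j hj => ?_⟩
    obtain ⟨k1, k2⟩ := hI i j
    exact ⟨k1.trans (and_iff_right ⟨hi, hj⟩), k2⟩

/-- The second stage of the two-stage algorithm. -/
def matchingProg : Prog :=
  graphProg ;; hungarianProg ;; checkProg ;; extractProg ;; unionProg

/-- An optimal assignment containing a non-edge excludes perfect matchings by `adj_of_optimal`, so
inspecting the computed one decides existence. Register 3 is only ever cleared here, so a failure of
the first stage is not forgotten. -/
theorem wp_matchingProg (hn : s.reg 0 = n) (hm : s.reg 1 = m) (hp : s.reg 2 = p)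
    (hM : n + m + p + 1 ≤ M) (h5 : s.reg 5 = 0) (h6 : s.reg 6 = 1) (hr : s.rreg 0 = 0)
    (a0 : s.arr 0 = tabulate 0 Bool.toNat S.A) (a1 : s.arr 1 = tabulate 0 Bool.toNat S.B)
    (a2 : s.arr 2 = tabulate 0 Bool.toNat S.C) (a15 : s.arr 15 = fun _ _ => 0)
    (a16 : s.arr 16 = fun _ _ => 0) (hP : ∀ (i : Fin m) (j : Fin p), s.cost i j = P i j) :
    wp matchingProg s fun t s' => t ≤ 400 * M ^ 3 ∧ Frame matchingProg s s' ∧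
      ((s'.reg 3 = s.reg 3 ∧
          ∃ E, IsMinCostPerfectMatching (BipAdj S (fun _ _ => true)) (bipCost P) E ∧
            (∀ e ∈ E, s'.arr 14 (vertexNumber e.1) 0 = vertexNumber e.2) ∧
            ∀ (i : Fin m) (j : Fin p), (s'.arr 15 i j = 1 ↔
              ((.inr (.inl i), .inr (.inr j)) : Vertex n m p × Vertex n m p) ∈ E)) ∨
        (s'.reg 3 = 0 ∧ ¬ ∃ E, IsPerfectMatching (BipAdj S (fun _ _ => true)) E)) ∧
      ∀ (i : Fin m) (j : Fin p), s'.arr 15 i j ≤ 1 ∧ s'.arr 16 i j ≤ 1 ∧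
        (s'.arr 16 i j = 1 ↔ s.arr 13 i j = 1 ∨ s'.arr 15 i j = 1) := by
  have hM1 : 1 ≤ M := by omega
  refine wp_frame (Q := fun t s' => t ≤ 400 * M ^ 3 ∧
      ((s'.reg 3 = s.reg 3 ∧
          ∃ E, IsMinCostPerfectMatching (BipAdj S (fun _ _ => true)) (bipCost P) E ∧
            (∀ e ∈ E, s'.arr 14 (vertexNumber e.1) 0 = vertexNumber e.2) ∧
            ∀ (i : Fin m) (j : Fin p), (s'.arr 15 i j = 1 ↔
              ((.inr (.inl i), .inr (.inr j)) : Vertex n m p × Vertex n m p) ∈ E)) ∨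
        (s'.reg 3 = 0 ∧ ¬ ∃ E, IsPerfectMatching (BipAdj S (fun _ _ => true)) E)) ∧
      ∀ (i : Fin m) (j : Fin p), s'.arr 15 i j ≤ 1 ∧ s'.arr 16 i j ≤ 1 ∧
        (s'.arr 16 i j = 1 ↔ s.arr 13 i j = 1 ∨ s'.arr 15 i j = 1)) ?_
    fun t s' h h' => ⟨h'.1, h, h'.2⟩
  refine wp_seq (wp_mono (wp_graphProg hn hm hp hM h5 h6 hr a0 a1 a2 hP) ?_)
  rintro t1 s1 ⟨ht1, f1, b, q, hb, hPb, hq, hh, hG⟩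
  have hbq : b ≤ q := hq ▸ le_scale (by linarith)
  have hqh : q ≤ s1.rreg 6 := hh ▸ le_scale (by linarith)
  have b5 : s1.reg 5 = 0 := (f1.reg 5 rfl).trans h5
  have b6 : s1.reg 6 = 1 := (f1.reg 6 rfl).trans h6
  refine wp_seq (wp_mono (wp_hungarianProg hM b5 b6 hG.card ((f1.rreg 0 rfl).trans hr) ?_) ?_)
  · intro v hv w hw
    obtain ⟨v, rfl⟩ := exists_vertexNumber (n := n) (m := m) (p := p) hv
    obtain ⟨w, rfl⟩ := exists_vertexNumber (n := n) (m := m) (p := p) hw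
    rw [hG.cost]
    exact (neg_le_neg (hbq.trans hqh)).trans
      (neg_le_pairCost hb hPb (by linarith) (by linarith) v w)
  rintro t2 s2 ⟨ht2, f2, hlt, hinj, hopt⟩
  obtain ⟨σ, hσ, hσopt⟩ := hG.exists_perm hlt hinj hopt
  have c5 : s2.reg 5 = 0 := (f2.reg 5 rfl).trans b5
  have c6 : s2.reg 6 = 1 := (f2.reg 6 rfl).trans b6
  have c7 : s2.reg 7 = n + m + p := (f2.reg 7 rfl).trans hG.card
  refine wp_seq (wp_mono (wp_checkProg hM c5 c6 c7) ?_)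
  rintro t3 s3 ⟨ht3, f3, hcheck⟩
  rw [f2.arr 22 rfl] at hcheck
  have d14 : s3.arr 14 = s2.arr 14 := f3.arr 14 rfl
  have d20 : s3.arr 20 = s1.arr 20 := (f3.arr 20 rfl).trans (f2.arr 20 rfl)
  have d21 : s3.arr 21 = s1.arr 21 := (f3.arr 21 rfl).trans (f2.arr 21 rfl)
  refine wp_seq (wp_mono (wp_extractProg hM ((f3.reg 5 rfl).trans c5) ((f3.reg 6 rfl).trans c6)
    ((f3.reg 7 rfl).trans c7) ((f3.reg 26 rfl).trans ((f2.reg 26 rfl).trans hG.two))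
    ((f3.arr 15 rfl).trans ((f2.arr 15 rfl).trans ((f1.arr 15 rfl).trans a15)))) ?_)
  rintro t4 s4 ⟨ht4, f4, hext⟩
  rw [d14, d20, d21] at hext
  have e1 : s4.reg 1 = m := (f4.reg 1 rfl).trans ((f3.reg 1 rfl).trans ((f2.reg 1 rfl).trans
    ((f1.reg 1 rfl).trans hm)))
  have e2 : s4.reg 2 = p := (f4.reg 2 rfl).trans ((f3.reg 2 rfl).trans ((f2.reg 2 rfl).trans
    ((f1.reg 2 rfl).trans hp)))
  have e13 : s4.arr 13 = s.arr 13 := (f4.arr 13 rfl).trans ((f3.arr 13 rfl).trans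
    ((f2.arr 13 rfl).trans (f1.arr 13 rfl)))
  refine wp_mono (wp_unionProg hM1 (by omega) (by omega)
    ((f4.reg 6 rfl).trans ((f3.reg 6 rfl).trans c6))
    ((f4.arr 16 rfl).trans ((f3.arr 16 rfl).trans ((f2.arr 16 rfl).trans
      ((f1.arr 16 rfl).trans a16))))) ?_
  rintro t5 s5 ⟨ht5, f5, hun⟩
  rw [e1, e2, e13] at hun
  have g14 : s5.arr 14 = s2.arr 14 := (f5.arr 14 rfl).trans ((f4.arr 14 rfl).trans d14)
  have g15 : s5.arr 15 = s4.arr 15 := f5.arr 15 rfl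
  have g3 : s5.reg 3 = s3.reg 3 := (f5.reg 3 rfl).trans (f4.reg 3 rfl)
  rw [g14, g15, g3]
  refine ⟨?_, ?_, fun i j => ⟨(hext i j).2, (hun i i.2 j j.2).2, (hun i i.2 j j.2).1⟩⟩
  · have h1 : M ≤ M ^ 3 := Nat.le_self_pow (by omega) M
    have h2 : M ^ 2 ≤ M ^ 3 := Nat.pow_le_pow_right hM1 (by omega)
    omega
  · rcases hcheck with ⟨h3, hedge⟩ | ⟨h3, a, ha, hedge⟩
    · have hadj : ∀ v, BipAdj S (fun _ _ => true) v (σ v) := fun v => by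
        rw [← hG.edge, hσ]
        exact hedge _ (vertexNumber_lt v)
      refine Or.inl ⟨?_, graphOf σ,
        isMinCostPerfectMatching_of_optimal hb hPb hq hh hσopt hadj, fun e he => ?_,
        fun i j => ?_⟩
      · rw [h3, f2.reg 3 rfl, f1.reg 3 rfl]
      · rw [← hσ, mem_graphOf.mp he]
      · rw [(hext i j).1, mem_graphOf]
        constructor
        · rintro ⟨a, ha, k1, k2, k3, k4⟩
          obtain ⟨v, rfl⟩ := exists_vertexNumber (n := n) (m := m) (p := p) ha
          rw [← hσ] at k3 k4
          rw [hG.kind] at k1 k3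
          rw [hG.index] at k2 k4
          rw [← vertexKind_eq_one_iff.mp ⟨k1, k2⟩]
          exact vertexKind_eq_two_iff.mp ⟨k3, k4⟩
        · intro e
          refine ⟨_, vertexNumber_lt (.inr (.inl i)), ?_, ?_, ?_, ?_⟩
          · rw [hG.kind]; rfl
          · rw [hG.index]; rfl
          · rw [← hσ, hG.kind, e]; rfl
          · rw [← hσ, hG.index, e]; rfl
    · refine Or.inr ⟨h3, fun hE => hedge ?_⟩
      obtain ⟨v, rfl⟩ := exists_vertexNumber (n := n) (m := m) (p := p) ha
      rw [← hσ, hG.edge]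
      exact adj_of_optimal hb hPb hq hh hσopt hE v

/-- Used to keep the results of the first stage: the matching program writes to none of the cells
that represent a run of the dynamic program. -/
theorem HoldsDPRun.of_frame {r : DPRun S P} {f : Prog} {s' : Memory} (h : HoldsDPRun s r)
    (hf : Frame f s s') (h4 : f.any (Instr.modReg 4) = false)
    (ha : ∀ a ∈ Finset.Icc 4 13, f.any (Instr.modArr a) = false)
    (h1 : f.any (Instr.modRarr 1) = false) : HoldsDPRun s' r := by
  have e : ∀ a, 4 ≤ a → a ≤ 13 → s'.arr a = s.arr a := fun a h h' =>
    hf.arr a (ha a (Finset.mem_Icc.mpr ⟨h, h'⟩))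
  refine ⟨?_, ?_, ?_, ?_, ?_, ?_, ?_, ?_, fun i j => ?_⟩
  · rw [hf.reg 4 h4]; exact h.ell
  · rw [e 4 (by norm_num) (by norm_num)]; exact h.comp
  · rw [e 5 (by norm_num) (by norm_num)]; exact h.U
  · rw [e 6 (by norm_num) (by norm_num)]; exact h.Y
  · rw [e 7 (by norm_num) (by norm_num)]; exact h.cumU
  · rw [e 8 (by norm_num) (by norm_num)]; exact h.cumY
  · rw [e 9 (by norm_num) (by norm_num), hf.rarr 1 h1]; exact h.W
  · rw [e 10 (by norm_num) (by norm_num), e 11 (by norm_num) (by norm_num),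
      e 12 (by norm_num) (by norm_num)]
    exact h.sel
  · rw [e 13 (by norm_num) (by norm_num)]; exact h.Ka i j

/-- The two-stage algorithm. -/
def twoStageAlgorithm : Prog := dpAlgorithm ;; matchingProg

theorem twoStageAlgorithm_correct (c : ℕ) : ∃ D : ℕ, ∀ n m p : ℕ, 0 < n → m ≤ c * n → p ≤ c * n →
    ∀ (S : StructuredSystem n m p) (P : CostMatrix m p), S.IsLineGraph →
      ∃ (t : ℕ) (s : Memory), Exec twoStageAlgorithm (inputMemory S P) t s ∧
        t ≤ D * n ^ 3 ∧ TwoStageDone S P s := by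
  classical
  refine ⟨800 * (2 * c + 2) ^ 3, fun n m p hn hm hp S P hS => ?_⟩
  obtain ⟨ℓ, 𝒞, hL⟩ := hS
  obtain ⟨f, hf, h𝒞⟩ := hL.exists_position
  suffices h : wp twoStageAlgorithm (inputMemory S P)
      fun t s => t ≤ 800 * (n + m + p + 1) ^ 3 ∧ TwoStageDone S P s by
    obtain ⟨t, s, h1, h2, h3⟩ := h
    exact ⟨t, s, h1, h2.trans (cube_le hn hm hp _), h3⟩
  refine wp_seq (wp_mono (wp_dpAlgorithm hn S P hf) ?_)
  rintro t1 s1 ⟨ht1, f1, h5, h6, hdp⟩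
  refine wp_mono (wp_matchingProg (S := S) (P := P) (f1.reg 0 rfl) (f1.reg 1 rfl) (f1.reg 2 rfl)
    le_rfl h5 h6 (f1.rreg 0 rfl) (f1.arr 0 rfl) (f1.arr 1 rfl) (f1.arr 2 rfl) (f1.arr 15 rfl)
    (f1.arr 16 rfl) hdp.cost) ?_
  rintro t2 s2 ⟨ht2, f2, hmatch, hfb⟩
  refine ⟨by omega, ?_⟩
  rcases hdp.dpDone hf hL h𝒞 with ⟨h3, r, hr⟩ | ⟨h3, hempty⟩
  · rcases hmatch with ⟨g3, E, hE, h14, h15⟩ | ⟨g3, hE⟩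
    · have hbool : ∀ a ≤ 1, a = (decide (a = 1)).toNat := by
        intro a ha
        interval_cases a <;> rfl
      refine Or.inl ⟨g3.trans h3, ⟨r, E, hE, fun i j => decide (s2.arr 15 i j = 1),
        fun i j => by rw [decide_eq_true_iff, h15], fun i j => decide (s2.arr 16 i j = 1),
        fun i j => ?_⟩, hr.of_frame f2 rfl (by decide) rfl, h14, fun i j => hbool _ (hfb i j).1,
        fun i j => hbool _ (hfb i j).2.1⟩
      have hKa := hr.Ka i j
      rw [decide_eq_true_iff, decide_eq_true_iff, (hfb i j).2.2, hKa]
      cases r.Ka i j <;> simp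
    · exact Or.inr ⟨g3, ⟨fun r => hE ⟨r.M, r.M_min.perfect⟩⟩⟩
  -- Without a run of the dynamic program there is no run of the two-stage algorithm, whatever the
  -- matching program finds; register 3 is zero in both of its outcomes.
  · refine Or.inr ⟨?_, ⟨fun r => hempty.false r.dp⟩⟩
    rcases hmatch with ⟨g3, _⟩ | ⟨g3, _⟩
    · exact g3.trans h3
    · exact g3

end

end FeedbackSelection

theorem theorem5 :
    (∃ alg : FeedbackSelection.Prog, ∀ c : ℕ, ∃ D : ℕ, ∀ n m p : ℕ,
      0 < n → m ≤ c * n → p ≤ c * n →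
      ∀ (S : FeedbackSelection.StructuredSystem n m p) (P : FeedbackSelection.CostMatrix m p),
        S.IsLineGraph → ∃ (t : ℕ) (s : FeedbackSelection.Memory),
          FeedbackSelection.Exec alg (FeedbackSelection.inputMemory S P) t s ∧
          t ≤ D * n ^ 3 ∧ FeedbackSelection.DPDone S P s) ∧
    (∃ alg : FeedbackSelection.Prog, ∀ c : ℕ, ∃ D : ℕ, ∀ n m p : ℕ,
      0 < n → m ≤ c * n → p ≤ c * n →
      ∀ (S : FeedbackSelection.StructuredSystem n m p) (P : FeedbackSelection.CostMatrix m p),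
        S.IsLineGraph → ∃ (t : ℕ) (s : FeedbackSelection.Memory),
          FeedbackSelection.Exec alg (FeedbackSelection.inputMemory S P) t s ∧
          t ≤ D * n ^ 3 ∧ FeedbackSelection.TwoStageDone S P s) := by
  exact ⟨⟨_, FeedbackSelection.dpAlgorithm_correct⟩, ⟨_, FeedbackSelection.twoStageAlgorithm_correct⟩⟩
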